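/- Let $M$ be a smooth manifold with corners (Hausdorff and paracompact, of dimension $n$, modelled on $[0,\infty)^n$), let $G$ be a compact Lie group acting smoothly on $M$ with finite stabilizers, and let $\pi\colon E\to M$ be an oriented smooth $G$-vector bundle of rank $r$, that is, an oriented smooth real vector bundle with a smooth lift of the action to $E$ by fibrewise linear, orientation-preserving maps. For a submanifold $S\subseteq M$, a *Thom form* on $E|_S$ is a smooth closed $r$-form $\tau$ on the total space of $E|_S$ that has compact vertical support, i.e. $\operatorname{supp}(\tau)\cap\pi^{-1}(K)$ is compact for every compact $K\subseteq S$, and satisfies $\int_{E_p}\tau=1$ for every $p\in S$, where $E_p$ carries the given orientation. Let $(M_i)_{i\in\mathcal I}$ be a finite family of closed $G$-invariant submanifolds of $M$ with clean intersections, in the following sense: around every $p\in M$ there is a single smooth chart $\varphi=(\varphi_1,\dots,\varphi_n)\colon U\to[0,\infty)^n$ of $M$ such that for every $i$ with $p\in M_i$ there is a set $K_i\subseteq\{1,\dots,n\}$ with $M_i\cap U=\{x\in U : \varphi_c(x)=\varphi_c(p)\text{ for all }c\in K_i\}$. For each $i\in\mathcal I$ let $\tau_i$ be a $G$-invariant Thom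 form on $E|_{M_i}$, and suppose that for all $i,j\in\mathcal I$ the forms $\tau_i$ and $\tau_j$ have the same restriction (pullback) to $E|_{M_i\cap M_j}$. Then there exists a $G$-invariant Thom form $\tau_M$ on $E$ whose restriction to $E|_{M_i}$ is $\tau_i$ for all $i\in\mathcal I$. -/

import Mathlib

open Set Filter Topology Manifold Bundle MeasureTheory
open scoped ContDiff

noncomputable section

namespace ThomExt

/-! ### Differential forms on a manifold (possibly with corners) -/

section Forms

variable {V : Type*} [NormedAddCommGroup V] [NormedSpace ℝ V]
  {H : Type*} [TopologicalSpace H] (J : ModelWithCorners ℝ V H)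
  {N : Type*} [TopologicalSpace N] [ChartedSpace H N]

/-- A (not necessarily smooth) differential `k`-form on the manifold `N`. -/
abbrev Form (k : ℕ) : Type _ := ∀ x : N, TangentSpace J x [⋀^Fin k]→L[ℝ] ℝ

variable {J} {k : ℕ}

/-- The expression of a form in the preferred (extended) chart at `x₀`: its pullback to the model
space under the inverse of that chart. Only the values on the target of the chart matter. -/
def Form.inChart (α : Form J (N := N) k) (x₀ : N) (y : V) : V [⋀^Fin k]→L[ℝ] ℝ :=
  (α ((extChartAt J x₀).symm y)).compContinuousLinearMap
    (mfderivWithin 𝓘(ℝ, V) J (extChartAt J x₀).symm (range J) y)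

/-- A form is smooth if all its expressions in charts are smooth (up to the boundary). -/
def Form.IsSmooth (α : Form J (N := N) k) : Prop :=
  ∀ x₀ : N, ContDiffOn ℝ ∞ (α.inChart x₀) (extChartAt J x₀).target

/-- The exterior derivative, computed at `x` in the preferred chart at `x`. -/
def Form.d (α : Form J (N := N) k) : Form J (N := N) (k + 1) := fun x =>
  (extDerivWithin (α.inChart x) (range J) (extChartAt J x x)).compContinuousLinearMap
    (mfderiv J 𝓘(ℝ, V) (extChartAt J x) x)

variable (J) in
/-- The tangent space at `p` of a subset `S` of a manifold, as a subspace of the ambient tangent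
space: the span of all limits of secants of `S` at `p`, in the preferred chart at `p`. For an
embedded submanifold this is the usual tangent space. -/
def tangentSub (S : Set N) (p : N) : Submodule ℝ (TangentSpace J p) :=
  Submodule.span ℝ (M := V) (tangentConeAt ℝ
    (extChartAt J p '' (S ∩ (extChartAt J p).source)) (extChartAt J p p))

theorem tangentSub_mono {S T : Set N} (h : S ⊆ T) (p : N) :
    tangentSub J S p ≤ tangentSub J T p :=
  Submodule.span_mono (tangentConeAt_mono (image_mono (inter_subset_inter_left _ h)))

end Forms

/-! ### Manifolds with corners and families of submanifolds -/

section Corners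

variable {n : ℕ} {M : Type*} [TopologicalSpace M] [ChartedSpace (EuclideanQuadrant n) M]

/-- The family `S` of subsets of the `n`-manifold with corners `M` consists of submanifolds with
clean intersections: around every point `p` there is one smooth chart of `M`, with values in the
quadrant `[0,∞)ⁿ`, in which every `S i` through `p` is a coordinate subspace through the
image of `p`, that is, it is cut out by fixing some of the coordinates. (Both boundary faces and
submanifolds that are transverse to the boundary strata are of this form.) -/
def CleanFamily {ι : Type*} (S : ι → Set M) : Prop :=
  ∀ p : M, ∃ φ ∈ IsManifold.maximalAtlas (modelWithCornersEuclideanQuadrant n) ∞ M,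
    p ∈ φ.source ∧ ∀ i, p ∈ S i → ∃ K : Finset (Fin n), ∀ x ∈ φ.source,
      (x ∈ S i ↔ ∀ c ∈ K, (φ x).1 c = (φ p).1 c)

end Corners

/-! ### Vector bundles of rank `r` over a manifold with corners -/

section Bundles

variable {n r : ℕ} {M : Type*} [TopologicalSpace M] [ChartedSpace (EuclideanQuadrant n) M]
  {E : M → Type*} [TopologicalSpace (TotalSpace (EuclideanSpace ℝ (Fin r)) E)]
  [∀ p, TopologicalSpace (E p)] [FiberBundle (EuclideanSpace ℝ (Fin r)) E]

variable (n r) in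
/-- The model with corners of the total space of a rank `r` bundle over an `n`-manifold. -/
abbrev totalModel : ModelWithCorners ℝ (EuclideanSpace ℝ (Fin n) × EuclideanSpace ℝ (Fin r))
    (ModelProd (EuclideanQuadrant n) (EuclideanSpace ℝ (Fin r))) :=
  (modelWithCornersEuclideanQuadrant n).prod 𝓘(ℝ, EuclideanSpace ℝ (Fin r))

variable (n r E) in
/-- Differential `k`-forms on the total space of `E`. -/
abbrev BundleForm (k : ℕ) : Type _ :=
  Form (totalModel n r) (N := TotalSpace (EuclideanSpace ℝ (Fin r)) E) k

/-- The tangent space at `v` of the total space of the restricted bundle `E|_S`: the vectors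
tangent to `E` whose projection to `M` is tangent to `S`. -/
def tangentOver (S : Set M) (v : TotalSpace (EuclideanSpace ℝ (Fin r)) E) :
    Submodule ℝ (TangentSpace (totalModel n r) v) :=
  (tangentSub (modelWithCornersEuclideanQuadrant n) S v.proj).comap
    (mfderiv (totalModel n r) (modelWithCornersEuclideanQuadrant n)
      (TotalSpace.proj : TotalSpace (EuclideanSpace ℝ (Fin r)) E → M) v).toLinearMap

theorem tangentOver_mono {S T : Set M} (h : S ⊆ T)
    (v : TotalSpace (EuclideanSpace ℝ (Fin r)) E) :
    tangentOver (n := n) S v ≤ tangentOver T v :=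
  Submodule.comap_mono (tangentSub_mono h v.proj)

variable (n r E) in
/-- A (not necessarily smooth) differential `k`-form on the total space of `E|_S`. -/
abbrev FormOver (S : Set M) (k : ℕ) : Type _ :=
  ∀ v : TotalSpace (EuclideanSpace ℝ (Fin r)) E, v.proj ∈ S →
    tangentOver (n := n) S v [⋀^Fin k]→L[ℝ] ℝ

/-- Restriction (pullback) to `E|_S` of a form on the total space of `E`. -/
def restrictTo (S : Set M) {k : ℕ} (α : BundleForm n r E k) : FormOver n r E S k := fun v _ =>
  (α v).compContinuousLinearMap (tangentOver (n := n) S v).subtypeL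

/-- Restriction (pullback) to `E|_S` of a form on `E|_T`, where `S ⊆ T`. -/
def FormOver.restrict {S T : Set M} (h : S ⊆ T) {k : ℕ} (τ : FormOver n r E T k) :
    FormOver n r E S k := fun v hv =>
  (τ v (h hv)).compContinuousLinearMap
    (⟨Submodule.inclusion (tangentOver_mono h v), by
      exact Continuous.subtype_mk continuous_subtype_val _⟩ :
      tangentOver (n := n) S v →L[ℝ] tangentOver (n := n) T v)

/-- `τ` agrees near `v₀` with the restriction to `E|_S` of the form `α` on `E`. -/
def FormOver.AgreesNear {S : Set M} {k : ℕ} (τ : FormOver n r E S k) (α : BundleForm n r E k)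
    (v₀ : TotalSpace (EuclideanSpace ℝ (Fin r)) E) : Prop :=
  ∀ᶠ v in 𝓝 v₀, ∀ hv : v.proj ∈ S, τ v hv = restrictTo S α v hv

/-- A form on `E|_S` is smooth if it is locally the restriction of a smooth form on `E`. -/
def FormOver.IsSmooth {S : Set M} {k : ℕ} (τ : FormOver n r E S k) : Prop :=
  ∀ v₀ : TotalSpace (EuclideanSpace ℝ (Fin r)) E, v₀.proj ∈ S →
    ∃ α : BundleForm n r E k, α.IsSmooth ∧ τ.AgreesNear α v₀

/-- A smooth form `τ` on `E|_S` is closed: `dτ` is at each point the restriction of `dα`, where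
`α` is any smooth form on `E` that restricts to `τ` near that point, and it vanishes. -/
def FormOver.IsClosed {S : Set M} {k : ℕ} (τ : FormOver n r E S k) : Prop :=
  ∀ (v₀ : TotalSpace (EuclideanSpace ℝ (Fin r)) E) (hv₀ : v₀.proj ∈ S) (α : BundleForm n r E k),
    α.IsSmooth → τ.AgreesNear α v₀ → restrictTo S α.d v₀ hv₀ = 0

variable [∀ p, AddCommGroup (E p)] [∀ p, Module ℝ (E p)]

/-- The linear parametrization of the fibre `E p` by `ℝʳ` that a basis of `E p` gives, as a map
into the total space. -/
def fiberMap (p : M) (b : Module.Basis (Fin r) ℝ (E p)) (x : EuclideanSpace ℝ (Fin r)) :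
    TotalSpace (EuclideanSpace ℝ (Fin r)) E :=
  ⟨p, ∑ j, x j • b j⟩

/-- The `j`-th coordinate vector field on the fibre `E p`. -/
def fiberVec (p : M) (b : Module.Basis (Fin r) ℝ (E p)) (x : EuclideanSpace ℝ (Fin r))
    (j : Fin r) : TangentSpace (totalModel n r) (fiberMap p b x) :=
  mfderiv 𝓘(ℝ, EuclideanSpace ℝ (Fin r)) (totalModel n r) (fiberMap p b) x
    (EuclideanSpace.single j (1 : ℝ))

/-- The integral over the fibre `E p` of the restriction of an `r`-form on `E`; the fibre is
oriented by the basis `b`. -/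
def fiberIntegral (τ : BundleForm n r E r) (p : M) (b : Module.Basis (Fin r) ℝ (E p)) : ℝ :=
  ∫ x : EuclideanSpace ℝ (Fin r), τ (fiberMap p b x) (fiberVec p b x)

/-- A family of orientations of the fibres is continuous (an orientation of the bundle) if it is
locally constant in the local trivializations. -/
def IsBundleOrientation [VectorBundle ℝ (EuclideanSpace ℝ (Fin r)) E]
    (o : ∀ p, Orientation ℝ (E p) (Fin r)) : Prop :=
  ∀ p₀ : M, ∃ o₀ : Orientation ℝ (EuclideanSpace ℝ (Fin r)) (Fin r), ∀ᶠ p in 𝓝 p₀,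
    ∀ hp : p ∈ (trivializationAt (EuclideanSpace ℝ (Fin r)) E p₀).baseSet,
      Orientation.map (Fin r)
        ((trivializationAt (EuclideanSpace ℝ (Fin r)) E p₀).linearEquivAt ℝ p hp) (o p) = o₀

/-- A Thom form on the bundle `E` oriented by `o`: a smooth closed `r`-form (`r` is the rank) with
compact support in the vertical direction, and with integral `1` over each oriented fibre. (For
`r ≥ 1` the last clause is redundant; for `r = 0` it covers the fibres that are negative points.) -/
structure IsThomForm (o : ∀ p, Orientation ℝ (E p) (Fin r)) (τ : BundleForm n r E r) : Prop where
  smooth : τ.IsSmooth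
  closed : τ.d = 0
  compact_vertical : ∀ K : Set M, IsCompact K →
    IsCompact (closure {v | τ v ≠ 0} ∩ TotalSpace.proj ⁻¹' K)
  integral_pos : ∀ (p : M) (b : Module.Basis (Fin r) ℝ (E p)), b.orientation = o p →
    fiberIntegral τ p b = 1
  integral_neg : ∀ (p : M) (b : Module.Basis (Fin r) ℝ (E p)), b.orientation = -o p →
    fiberIntegral τ p b = -1

/-- Vectors tangent to a fibre of `E` are tangent to `E|_S`. -/
theorem fiberVec_mem (S : Set M) (p : M) (b : Module.Basis (Fin r) ℝ (E p))
    (x : EuclideanSpace ℝ (Fin r)) (j : Fin r) :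
    fiberVec p b x j ∈ tangentOver (n := n) S (fiberMap p b x) := by
  by_cases h : MDifferentiableAt 𝓘(ℝ, EuclideanSpace ℝ (Fin r)) (totalModel n r)
      (fiberMap p b) x
  · have hp : MDifferentiableAt (totalModel n r) (modelWithCornersEuclideanQuadrant n)
        (TotalSpace.proj : TotalSpace (EuclideanSpace ℝ (Fin r)) E → M) (fiberMap p b x) :=
      (contMDiffAt_proj (n := ∞) E).mdifferentiableAt (by simp)
    have hc := mfderiv_comp x hp h
    have hconst : ((TotalSpace.proj : TotalSpace (EuclideanSpace ℝ (Fin r)) E → M) ∘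
        fiberMap p b) = fun _ => p := rfl
    have h0 : mfderiv (totalModel n r) (modelWithCornersEuclideanQuadrant n)
        (TotalSpace.proj : TotalSpace (EuclideanSpace ℝ (Fin r)) E → M) (fiberMap p b x)
        (fiberVec p b x j) = 0 := by
      have := congrArg (fun L => L (EuclideanSpace.single j (1 : ℝ))) hc
      rw [hconst, mfderiv_const] at this
      exact this.symm
    change mfderiv (totalModel n r) (modelWithCornersEuclideanQuadrant n)
        (TotalSpace.proj : TotalSpace (EuclideanSpace ℝ (Fin r)) E → M) (fiberMap p b x)
        (fiberVec p b x j) ∈ tangentSub (modelWithCornersEuclideanQuadrant n) S p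
    rw [h0]
    exact Submodule.zero_mem _
  · have : fiberVec (n := n) p b x j = 0 := by
      unfold fiberVec
      rw [mfderiv_zero_of_not_mdifferentiableAt h]
      rfl
    rw [this]
    exact Submodule.zero_mem _

/-- The integral of an `r`-form on `E|_S` over the fibre at `p ∈ S`, oriented by the basis `b`. -/
def FormOver.fiberIntegral {S : Set M} (τ : FormOver n r E S r) (p : M) (hp : p ∈ S)
    (b : Module.Basis (Fin r) ℝ (E p)) : ℝ :=
  ∫ x : EuclideanSpace ℝ (Fin r),
    τ (fiberMap p b x) hp (fun j => ⟨fiberVec p b x j, fiberVec_mem S p b x j⟩)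

/-- A Thom form on the restricted bundle `E|_S`, oriented by `o`. -/
structure IsThomFormOver (S : Set M) (o : ∀ p, Orientation ℝ (E p) (Fin r))
    (τ : FormOver n r E S r) : Prop where
  smooth : τ.IsSmooth
  closed : τ.IsClosed
  compact_vertical : ∀ K : Set M, K ⊆ S → IsCompact K →
    IsCompact (closure {v | ∃ hv : v.proj ∈ S, τ v hv ≠ 0} ∩ TotalSpace.proj ⁻¹' K)
  integral_pos : ∀ (p : M) (hp : p ∈ S) (b : Module.Basis (Fin r) ℝ (E p)),
    b.orientation = o p → τ.fiberIntegral p hp b = 1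
  integral_neg : ∀ (p : M) (hp : p ∈ S) (b : Module.Basis (Fin r) ℝ (E p)),
    b.orientation = -o p → τ.fiberIntegral p hp b = -1

/-! ### Group actions -/

variable {G : Type*} [Group G] [MulAction G M]
  [MulAction G (TotalSpace (EuclideanSpace ℝ (Fin r)) E)]

variable (G) in
/-- The action of `G` on the total space of `E` lifts the action on `M`, and it is by linear
isomorphisms between the fibres that preserve the orientation `o`. -/
def ActsByOrientedBundleMaps (o : ∀ p, Orientation ℝ (E p) (Fin r)) : Prop :=
  ∀ (g : G) (p : M), ∃ ρ : E p ≃ₗ[ℝ] E (g • p),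
    (∀ u : E p, g • (⟨p, u⟩ : TotalSpace (EuclideanSpace ℝ (Fin r)) E) = ⟨g • p, ρ u⟩) ∧
    Orientation.map (Fin r) ρ (o p) = o (g • p)

variable (G) in
/-- The differential of the action of `g` on the total space of `E`. -/
def actionDeriv (g : G) (v : TotalSpace (EuclideanSpace ℝ (Fin r)) E) :
    TangentSpace (totalModel n r) v →L[ℝ] TangentSpace (totalModel n r) (g • v) :=
  mfderiv (totalModel n r) (totalModel n r)
    (fun w : TotalSpace (EuclideanSpace ℝ (Fin r)) E => g • w) v

variable (G) in
/-- A form on `E` is `G`-invariant: `g^*τ = τ` for all `g`. -/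
def InvariantForm {k : ℕ} (τ : BundleForm n r E k) : Prop :=
  ∀ (g : G) (v : TotalSpace (EuclideanSpace ℝ (Fin r)) E),
    (τ (g • v)).compContinuousLinearMap (actionDeriv G g v) = τ v

variable (G) in
/-- A form on `E|_S` is `G`-invariant: `g^*τ = τ` for all `g`. (`S` is meant to be `G`-invariant,
and then the differential of `g` maps the tangent spaces of `E|_S` to each other.) -/
def FormOver.Invariant {S : Set M} {k : ℕ} (τ : FormOver n r E S k) : Prop :=
  ∀ (g : G) (v : TotalSpace (EuclideanSpace ℝ (Fin r)) E) (hv : v.proj ∈ S)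
    (hgv : (g • v).proj ∈ S) (w : Fin k → tangentOver (n := n) S v)
    (w' : Fin k → tangentOver (n := n) S (g • v)),
    (∀ j, (w' j : TangentSpace (totalModel n r) (g • v)) = actionDeriv G g v (w j)) →
      τ (g • v) hgv w' = τ v hv w

end Bundles

end ThomExt

end

set_option linter.unusedSectionVars false

noncomputable section

namespace ThomExt

/-! ### Smooth dependence on parameters -/

section Parametric

variable {T : Type*} [TopologicalSpace T] [T2Space T] [MeasurableSpace T] [BorelSpace T]
  {V W : Type*} [NormedAddCommGroup V] [NormedSpace ℝ V]
  [NormedAddCommGroup W] [NormedSpace ℝ W] [CompleteSpace W]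

/-! The group enters only at the end. If σ is any Thom form that extends the given τ_i, then its
average ∫ g^*σ dμ(g) over a right invariant probability measure on G is an invariant Thom form. It
still restricts to τ_i, because τ_i is invariant, and compactness of G keeps the support vertically
compact. So the task is to find some extension σ (`exists_goodAt`).

Locally an extension is found by linear algebra (`exists_flat_extension`). In a clean chart each M_i
through the centre is the fixed set of an affine retraction A_i that resets some coordinates to
those of the centre, and the A_i commute. If σ extends the forms treated so far, then σ + A_i^*(τ_i
− σ) extends τ_i as well: over an earlier M_j the correction vanishes, because A_i maps M_j into M_i
∩ M_j, where both forms restrict to τ_j. The fibre integral is ε + (ε − ε) = ε.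

A partition of unity cannot glue local extensions, since multiplication by functions on the base
destroys closedness. Instead, the difference α of two local extensions is closed, has fibre
integrals 0 and restricts to 0 over every M_i. A Poincaré lemma with bounded vertical supports
(`exists_primitive_of_integral_eq_zero`) gives a primitive β that also restricts to 0 over the M_i.
For a function ρ on the base, d(ρβ) interpolates between 0 and α and changes neither fibre integrals
nor restrictions (`IsFlatForm.exists_cutoff`). Hence an extension over an open set can be corrected
inside one chart (`ThomBox.exists_step`), and a Zorn argument over a locally finite cover
(`exists_forall_near`) corrects it everywhere.

The Poincaré lemma goes by induction on the number of fibre directions. Integration along half lines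
in the first direction gives a primitive of α, but far out on the positive side it equals the
integral I over the full line. The form I is closed, has one degree less, depends only on the
remaining directions and has fibre integrals 0. So I = dγ by induction, and subtracting d(θγ), for a
step function θ of the first coordinate, repairs the support. All operations commute with
restriction to affine subspaces that contain the fibre directions, so vanishing over M_i is
inherited.

The corners cause no trouble: in coordinates everything happens on a quadrant times ℝʳ. This is a
convex set with interior points, where derivatives are unique, d² = 0 and d commutes with pullback.
-/

theorem integrable_of_continuousOn_compact {μ : Measure T} [IsFiniteMeasure μ] {k : Set T}
    (hk : IsCompact k) (hμ : ∀ᵐ t ∂μ, t ∈ k) {f : T → W} (hf : ContinuousOn f k) :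
    Integrable f μ := by
  have := hf.integrableOn_compact (μ := μ) hk
  rwa [IntegrableOn, Measure.restrict_eq_self_of_ae_mem hμ] at this

theorem continuousOn_slice {s : Set V} {k : Set T} {Φ : T → V → W}
    (hc : ContinuousOn (Function.uncurry Φ) (k ×ˢ s)) {y : V} (hy : y ∈ s) :
    ContinuousOn (fun t => Φ t y) k :=
  hc.comp (f := fun t => (t, y)) (by fun_prop) (fun t ht => ⟨ht, hy⟩)

/-- Differentiation under the integral sign over a compact set, on a set that is relatively open
in a convex set. -/
theorem hasFDerivWithinAt_integral_of_compact {μ : Measure T} [IsFiniteMeasure μ] {k : Set T}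
    (hk : IsCompact k) (hμ : ∀ᵐ t ∂μ, t ∈ k) {C O : Set V} (hC : Convex ℝ C) (hO : IsOpen O)
    {Φ : T → V → W} {Φ' : T → V → V →L[ℝ] W}
    (hΦ : ∀ t ∈ k, ∀ y ∈ C ∩ O, HasFDerivWithinAt (Φ t) (Φ' t y) (C ∩ O) y)
    (hc : ContinuousOn (Function.uncurry Φ) (k ×ˢ (C ∩ O)))
    (hc' : ContinuousOn (Function.uncurry Φ') (k ×ˢ (C ∩ O))) {y₀ : V} (hy₀ : y₀ ∈ C ∩ O) :
    HasFDerivWithinAt (fun y => ∫ t, Φ t y ∂μ) (∫ t, Φ' t y₀ ∂μ) (C ∩ O) y₀ := by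
  have hi : ∀ y ∈ C ∩ O, Integrable (fun t => Φ t y) μ := fun y hy =>
    integrable_of_continuousOn_compact hk hμ (continuousOn_slice hc hy)
  have hi' : ∀ y ∈ C ∩ O, Integrable (fun t => Φ' t y) μ := fun y hy =>
    integrable_of_continuousOn_compact hk hμ (continuousOn_slice hc' hy)
  rw [hasFDerivWithinAt_iff_isLittleO, Asymptotics.isLittleO_iff]
  intro ε hε
  set m : ℝ := μ.real univ with hm
  have hm0 : 0 ≤ m := measureReal_nonneg
  obtain ⟨δ, hδ, hδm⟩ : ∃ δ > 0, δ * m ≤ ε := by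
    -- The summand 1 covers the case of total mass 0.
    refine ⟨ε / (m + 1), by positivity, ?_⟩
    rw [div_mul_eq_mul_div, div_le_iff₀ (by positivity)]
    nlinarith
  have hloc : ∀ t₀ ∈ k, ∀ᶠ q : V × T in 𝓝 (y₀, t₀), q.2 ∈ k → q.1 ∈ C ∩ O →
      ‖Φ' q.2 q.1 - Φ' q.2 y₀‖ ≤ δ := by
    intro t₀ ht₀
    have h1 := hc' (t₀, y₀) ⟨ht₀, hy₀⟩
    have h2 := continuousOn_slice hc' hy₀ t₀ ht₀
    have h3 := Metric.tendsto_nhds.1 h1 (δ / 2) (by positivity)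
    have h4 := Metric.tendsto_nhds.1 h2 (δ / 2) (by positivity)
    rw [eventually_nhdsWithin_iff] at h3 h4
    have h3' : ∀ᶠ q : V × T in 𝓝 (y₀, t₀), (q.2, q.1) ∈ k ×ˢ (C ∩ O) →
        dist (Function.uncurry Φ' (q.2, q.1)) (Function.uncurry Φ' (t₀, y₀)) < δ / 2 :=
      (continuous_swap.tendsto (y₀, t₀)).eventually h3
    have h4' : ∀ᶠ q : V × T in 𝓝 (y₀, t₀), q.2 ∈ k →
        dist (Φ' q.2 y₀) (Φ' t₀ y₀) < δ / 2 :=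
      (continuous_snd.tendsto (y₀, t₀)).eventually h4
    filter_upwards [h3', h4'] with q hq1 hq2 hk1 hk2
    have := dist_triangle_right (Φ' q.2 q.1) (Φ' q.2 y₀) (Φ' t₀ y₀)
    have a1 := hq1 ⟨hk1, hk2⟩
    have a2 := hq2 hk1
    simp only [Function.uncurry] at a1
    rw [← dist_eq_norm]
    linarith
  -- Tube lemma: by compactness of `k` the closeness of `Φ' t z` to `Φ' t y₀` is uniform in `t`.
  have hev : ∀ᶠ z in 𝓝 y₀, ∀ t ∈ k, z ∈ C ∩ O → ‖Φ' t z - Φ' t y₀‖ ≤ δ := by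
    have hP : ∀ᶠ z in 𝓝 y₀, ∀ t ∈ k, t ∈ k → z ∈ C ∩ O → ‖Φ' t z - Φ' t y₀‖ ≤ δ := by
      refine hk.eventually_forall_of_forall_eventually (x₀ := y₀)
        (P := fun z t => t ∈ k → z ∈ C ∩ O → ‖Φ' t z - Φ' t y₀‖ ≤ δ) fun t₀ ht₀ => ?_
      exact hloc t₀ ht₀
    exact hP.mono fun z hz t ht => hz t ht ht
  obtain ⟨ρ, hρ, hball⟩ := Metric.eventually_nhds_iff_ball.1 (hev.and (hO.mem_nhds hy₀.2))
  have hsub : C ∩ Metric.ball y₀ ρ ⊆ C ∩ O := fun z hz => ⟨hz.1, (hball z hz.2).2⟩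
  -- The mean value inequality needs a convex set. `C ∩ O` need not be convex, but its part in a
  -- small ball is.
  have hconv : Convex ℝ (C ∩ Metric.ball y₀ ρ) := hC.inter (convex_ball _ _)
  rw [eventually_nhdsWithin_iff]
  filter_upwards [Metric.ball_mem_nhds y₀ hρ] with y hyb hys
  have key : ∀ t ∈ k, ‖Φ t y - Φ t y₀ - Φ' t y₀ (y - y₀)‖ ≤ δ * ‖y - y₀‖ := by
    intro t ht
    refine hconv.norm_image_sub_le_of_norm_hasFDerivWithin_le' (𝕜 := ℝ) (f' := Φ' t)
      (fun z hz => (hΦ t ht z (hsub hz)).mono hsub)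
      (fun z hz => (hball z hz.2).1 t ht (hsub hz)) ⟨hy₀.1, Metric.mem_ball_self hρ⟩
      ⟨hys.1, hyb⟩
  have e1 : (∫ t, Φ' t y₀ ∂μ) (y - y₀) = ∫ t, Φ' t y₀ (y - y₀) ∂μ :=
    (ContinuousLinearMap.integral_apply (hi' y₀ hy₀) _)
  have e2 : Integrable (fun t => Φ' t y₀ (y - y₀)) μ :=
    (ContinuousLinearMap.apply ℝ W (y - y₀)).integrable_comp (hi' y₀ hy₀)
  have e3 : Integrable (fun t => Φ t y - Φ t y₀) μ := (hi y hys).sub (hi y₀ hy₀)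
  rw [e1, ← integral_sub (hi y hys) (hi y₀ hy₀), ← integral_sub e3 e2]
  calc _ ≤ δ * ‖y - y₀‖ * m := by
        refine norm_integral_le_of_norm_le_const ?_
        filter_upwards [hμ] with t ht using key t ht
    _ = (δ * m) * ‖y - y₀‖ := by ring
    _ ≤ ε * ‖y - y₀‖ := by gcongr

set_option synthInstance.maxHeartbeats 200000 in
-- Currying is a continuous linear map, so it passes under the integral. This matches the derivative
-- of the integrated `m`-th Taylor term with the integrated term of order `m + 1`.
theorem integral_curryLeft {μ : Measure T} {m : ℕ} {F : T → V [×(m + 1)]→L[ℝ] W}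
    (h : Integrable F μ) : (∫ t, F t ∂μ).curryLeft = ∫ t, (F t).curryLeft ∂μ :=
  (ContinuousLinearMap.integral_comp_comm (𝕜 := ℝ) (E := V [×(m + 1)]→L[ℝ] W)
    (Fₗ := V →L[ℝ] V [×m]→L[ℝ] W) (X := T) (μ := μ) (φ := F)
    (continuousMultilinearCurryLeftEquiv ℝ
      (fun _ : Fin (m + 1) => V) W).toContinuousLinearEquiv.toContinuousLinearMap h).symm

set_option synthInstance.maxHeartbeats 200000 in
/-- Integrals over compact sets depend smoothly on parameters. -/
theorem contDiffOn_integral_of_compact {μ : Measure T} [IsFiniteMeasure μ] {k : Set T}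
    (hk : IsCompact k) (hμ : ∀ᵐ t ∂μ, t ∈ k) {C O : Set V} (hC : Convex ℝ C) (hO : IsOpen O)
    (hu : UniqueDiffOn ℝ (C ∩ O)) {F : T → V → W} (hF : ∀ t ∈ k, ContDiffOn ℝ ∞ (F t) (C ∩ O))
    (hj : ∀ m : ℕ, ContinuousOn
      (Function.uncurry fun t y => iteratedFDerivWithin ℝ m (F t) (C ∩ O) y) (k ×ˢ (C ∩ O))) :
    ContDiffOn ℝ ∞ (fun y => ∫ t, F t y ∂μ) (C ∩ O) := by
  set s := C ∩ O
  have hi : ∀ m : ℕ, ∀ y ∈ s, Integrable (fun t => iteratedFDerivWithin ℝ m (F t) s y) μ :=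
    fun m y hy => integrable_of_continuousOn_compact hk hμ (continuousOn_slice (hj m) hy)
  have hder : ∀ m : ℕ, ∀ y ∈ s, HasFDerivWithinAt
      (fun y => ∫ t, iteratedFDerivWithin ℝ m (F t) s y ∂μ)
      (∫ t, iteratedFDerivWithin ℝ (m + 1) (F t) s y ∂μ).curryLeft s y := by
    intro m y hy
    let L := continuousMultilinearCurryLeftEquiv ℝ (fun _ : Fin (m + 1) => V) W
    have e := integral_curryLeft (hi (m + 1) y hy)
    rw [e]
    refine hasFDerivWithinAt_integral_of_compact hk hμ hC hO
      (Φ' := fun t y => (iteratedFDerivWithin ℝ (m + 1) (F t) s y).curryLeft) ?_ (hj m) ?_ hy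
    · intro t ht z hz
      exact ((hF t ht).ftaylorSeriesWithin hu).fderivWithin m (by exact_mod_cast ENat.natCast_lt_top m)
        z hz
    · exact L.continuous.comp_continuousOn (hj (m + 1))
  -- The integrals of the iterated derivatives are themselves a Taylor series, which settles all
  -- orders at once.
  have : HasFTaylorSeriesUpToOn ((⊤ : ℕ∞) : ℕ∞ω) (fun y => ∫ t, F t y ∂μ)
      (fun y m => ∫ t, iteratedFDerivWithin ℝ m (F t) s y ∂μ) s := by
    refine ⟨fun y hy => ?_, fun m _ y hy => hder m y hy, fun m _ y hy =>
      (hder m y hy).continuousWithinAt⟩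
    let L := continuousMultilinearCurryFin0 ℝ V W
    have e := (L.toContinuousLinearEquiv.toContinuousLinearMap.integral_comp_comm (hi 0 y hy)).symm
    exact e.trans rfl
  exact this.contDiffOn

set_option synthInstance.maxHeartbeats 200000 in
/-- Partial derivatives of a jointly smooth function are jointly smooth. -/
theorem contDiffOn_iteratedFDerivWithin_uncurry {P : Type*} [NormedAddCommGroup P]
    [NormedSpace ℝ P] {W : Type*} [NormedAddCommGroup W] [NormedSpace ℝ W]
    {u : Set P} {s : Set V} (hs : UniqueDiffOn ℝ s)
    {F : P → V → W} (hF : ContDiffOn ℝ ∞ (Function.uncurry F) (u ×ˢ s)) (m : ℕ) :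
    ContDiffOn ℝ ∞ (Function.uncurry fun t y => iteratedFDerivWithin ℝ m (F t) s y)
      (u ×ˢ s) := by
  induction m with
  | zero =>
    exact (continuousMultilinearCurryFin0 ℝ V W).symm.contDiff.comp_contDiffOn hF
  | succ m ih =>
    rintro ⟨t, y⟩ ht
    -- The whole pair `(t, y)` serves as the parameter, and its second entry is also the point at
    -- which the derivative is evaluated.
    have h := ContDiffWithinAt.fderivWithin (𝕜 := ℝ) (m := ∞) (n := ∞) (s := u ×ˢ s)
      (x₀ := (t, y)) (t := s) (f := fun q : P × V => iteratedFDerivWithin ℝ m (F q.1) s)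
      (g := Prod.snd)
      (ContDiffWithinAt.comp (t := u ×ˢ s) (f := fun q : (P × V) × V => (q.1.1, q.2)) ((t, y), y)
        (ih (t, y) ht) (by fun_prop) (fun q hq => ⟨hq.1.1, hq.2⟩))
      contDiffWithinAt_snd hs (by simp) ht (fun q hq => hq.2)
    have h' := (continuousMultilinearCurryLeftEquiv ℝ (fun _ : Fin (m + 1) => V)
      W).symm.contDiff.comp_contDiffWithinAt h
    exact h'

end Parametric

/-! ### Smoothness of alternating-map valued functions -/

section Alternating

variable {V V' : Type*} [NormedAddCommGroup V] [NormedSpace ℝ V] [NormedAddCommGroup V']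
  [NormedSpace ℝ V'] {k : ℕ}

variable (V k) in
/-- The antisymmetrization of multilinear maps, as a continuous linear map. -/
def alternatizationL :
    ContinuousMultilinearMap ℝ (fun _ : Fin k => V) ℝ →L[ℝ] V [⋀^Fin k]→L[ℝ] ℝ :=
  LinearMap.mkContinuous
    { toFun := fun f => ContinuousMultilinearMap.alternatization f
      map_add' := fun f g => map_add _ f g
      map_smul' := fun c f => by
        ext v
        simp [ContinuousMultilinearMap.alternatization_apply_apply, Finset.mul_sum, mul_left_comm,
          Units.smul_def] }
    (Fintype.card (Equiv.Perm (Fin k))) (fun f => by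
      refine ContinuousAlternatingMap.opNorm_le_bound _ (by positivity) fun v => ?_
      change ‖ContinuousMultilinearMap.alternatization f v‖ ≤ _
      rw [ContinuousMultilinearMap.alternatization_apply_apply]
      refine (norm_sum_le _ _).trans ?_
      have : ∀ σ ∈ (Finset.univ : Finset (Equiv.Perm (Fin k))),
          ‖Equiv.Perm.sign σ • f (v ∘ σ)‖ ≤ ‖f‖ * ∏ i, ‖v i‖ := by
        intro σ _
        have h1 : ‖Equiv.Perm.sign σ • f (v ∘ σ)‖ = ‖f (v ∘ σ)‖ := by
          rcases Int.units_eq_one_or (Equiv.Perm.sign σ) with h | h <;> rw [h] <;> simp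
        rw [h1]
        refine (f.le_opNorm _).trans_eq ?_
        congr 1
        exact Equiv.prod_comp σ (fun i => ‖v i‖)
      refine (Finset.sum_le_sum this).trans_eq ?_
      simp [mul_assoc])

/-- All k! signed permutations of an alternating map are equal to it. After division by k! this
gives a continuous linear left inverse of the inclusion of alternating maps into multilinear maps.
-/
theorem alternatizationL_toContinuousMultilinearMap (f : V [⋀^Fin k]→L[ℝ] ℝ) :
    alternatizationL V k f.toContinuousMultilinearMap =
      (Fintype.card (Equiv.Perm (Fin k)) : ℝ) • f := by
  ext v
  change ContinuousMultilinearMap.alternatization _ v = _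
  rw [ContinuousMultilinearMap.alternatization_apply_apply]
  have : ∀ σ ∈ (Finset.univ : Finset (Equiv.Perm (Fin k))),
      Equiv.Perm.sign σ • f.toContinuousMultilinearMap (v ∘ σ) = f v := by
    intro σ _
    change Equiv.Perm.sign σ • f (v ∘ σ) = f v
    have := f.toAlternatingMap.map_perm v σ
    change f (v ∘ σ) = _ at this
    rw [this, smul_smul, Int.units_mul_self, one_smul]
    rfl
  rw [Finset.sum_congr rfl this]
  simp

/-- Compose with the left inverse `alternatizationL` divided by k!. In this way smoothness
statements about multilinear maps carry over to alternating ones. -/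
theorem contDiffWithinAt_of_toContinuousMultilinearMap {n : ℕ∞ω} {f : V' → V [⋀^Fin k]→L[ℝ] ℝ}
    {s : Set V'} {x : V'}
    (h : ContDiffWithinAt ℝ n (fun y => (f y).toContinuousMultilinearMap) s x) :
    ContDiffWithinAt ℝ n f s x := by
  have hc : (Fintype.card (Equiv.Perm (Fin k)) : ℝ) ≠ 0 := by simp [Fintype.card_perm, Nat.factorial_ne_zero]
  have h1 := ((alternatizationL V k).contDiff.comp_contDiffWithinAt h).const_smul
    (Fintype.card (Equiv.Perm (Fin k)) : ℝ)⁻¹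
  refine h1.congr_of_eventuallyEq (Eventually.of_forall fun y => ?_) ?_ <;>
  · simp only [Function.comp]
    rw [alternatizationL_toContinuousMultilinearMap, smul_smul, inv_mul_cancel₀ hc, one_smul]

/-- The pullback of an alternating map under a linear map depends smoothly on both. -/
theorem _root_.ContDiffWithinAt.compContinuousLinearMap_alternating {P : Type*}
    [NormedAddCommGroup P] [NormedSpace ℝ P] {n : ℕ∞ω}
    {f : P → V [⋀^Fin k]→L[ℝ] ℝ} {L : P → V' →L[ℝ] V} {s : Set P} {x : P}
    (hf : ContDiffWithinAt ℝ n f s x) (hL : ContDiffWithinAt ℝ n L s x) :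
    ContDiffWithinAt ℝ n (fun y => (f y).compContinuousLinearMap (L y)) s x := by
  apply contDiffWithinAt_of_toContinuousMultilinearMap
  have h1 : ContDiffWithinAt ℝ n (fun y => (f y).toContinuousMultilinearMap) s x :=
    (ContinuousAlternatingMap.toContinuousMultilinearMapLI (𝕜 := ℝ) (E := V) (F := ℝ)
      (ι := Fin k)).contDiff.comp_contDiffWithinAt hf
  -- Precomposition with `(L, …, L)` is multilinear in the `k` copies of `L`, hence smooth in `L`.
  have h2 : ContDiffWithinAt ℝ n (fun y => ContinuousMultilinearMap.compContinuousLinearMapContinuousMultilinear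
      ℝ (fun _ : Fin k => V') (fun _ => V) ℝ (fun _ => L y)) s x :=
    (ContinuousMultilinearMap.contDiff _).comp_contDiffWithinAt (contDiffWithinAt_pi.2 fun _ => hL)
  exact h2.clm_apply h1

end Alternating

/-! ### Integration of forms along lines -/

section Lines

variable {V : Type*} [NormedAddCommGroup V] [NormedSpace ℝ V]
  {W : Type*} [NormedAddCommGroup W] [NormedSpace ℝ W] [CompleteSpace W]

theorem hasFDerivWithinAt_comp_add {C : Set V} {e : V} (hCe : ∀ x ∈ C, ∀ t : ℝ, x + t • e ∈ C)
    {f : V → W} {f' : V →L[ℝ] W} {x : V} {t : ℝ} (hf : HasFDerivWithinAt f f' C (x + t • e)) :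
    HasFDerivWithinAt (fun y => f (y + t • e)) f' C x := by
  have h1 : HasFDerivWithinAt (fun y : V => y + t • e) (ContinuousLinearMap.id ℝ V) C x :=
    (hasFDerivWithinAt_id x C).add_const _
  exact hf.comp x h1 (fun y hy => hCe y hy t)

/-- The data for integration along the lines in direction `e`: a convex set `C` with interior and
an open set `O`, both invariant under translations along `e`. -/
structure LineDomain (C O : Set V) (e : V) : Prop where
  convex : Convex ℝ C
  interior_nonempty : (interior C).Nonempty
  isOpen : IsOpen O
  add_mem : ∀ x ∈ C, ∀ t : ℝ, x + t • e ∈ C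
  add_mem_open : ∀ x ∈ O, ∀ t : ℝ, x + t • e ∈ O

theorem uniqueDiffOn_inter_of_convex {C O : Set V} (hC : Convex ℝ C)
    (hi : (interior C).Nonempty) (hO : IsOpen O) : UniqueDiffOn ℝ (C ∩ O) :=
  (uniqueDiffOn_convex hC hi).inter hO

/-- Being a limit of interior points is what makes second derivatives within `C` symmetric, and so
it is the condition for d² = 0 and for the naturality of `d` at boundary points. -/
theorem mem_closure_interior_of_convex {C : Set V} (hC : Convex ℝ C)
    (hi : (interior C).Nonempty) {x : V} (hx : x ∈ C) : x ∈ closure (interior C) := by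
  rw [hC.closure_interior_eq_closure_of_nonempty_interior hi]
  exact subset_closure hx

/-- The function `f` has bounded support along the lines in direction `e`, locally uniformly. -/
def LineSupport (C O : Set V) (e : V) (f : V → W) : Prop :=
  ∀ x ∈ C ∩ O, ∃ R : ℝ, ∀ᶠ x' in 𝓝[C] x, ∀ t : ℝ, R < |t| → f (x' + t • e) = 0

variable {C O : Set V} {e : V}

theorem LineDomain.add_mem_inter (h : LineDomain C O e) {x : V} (hx : x ∈ C ∩ O) (t : ℝ) :
    x + t • e ∈ C ∩ O :=
  ⟨h.add_mem x hx.1 t, h.add_mem_open x hx.2 t⟩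

theorem LineDomain.inter_mem_nhdsWithin (h : LineDomain C O e) {x : V} (hx : x ∈ C ∩ O) :
    C ∩ O ∈ 𝓝[C] x :=
  _root_.inter_mem_nhdsWithin C (h.isOpen.mem_nhds hx.2)

theorem ContDiffOn.hasFDerivWithinAt_of_convex {C O : Set V} (hO : IsOpen O) {f : V → W}
    (hf : ContDiffOn ℝ ∞ f (C ∩ O)) {x : V} (hx : x ∈ C ∩ O) :
    HasFDerivWithinAt f (fderivWithin ℝ f C x) C x := by
  have h1 : DifferentiableWithinAt ℝ f (C ∩ O) x := hf.differentiableOn (by simp) x hx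
  rw [differentiableWithinAt_inter (hO.mem_nhds hx.2)] at h1
  exact h1.hasFDerivWithinAt

theorem ContDiffOn.contDiffWithinAt_of_isOpen {C O : Set V} (hO : IsOpen O) {f : V → W}
    (hf : ContDiffOn ℝ ∞ f (C ∩ O)) {x : V} (hx : x ∈ C ∩ O) :
    ContDiffWithinAt ℝ ∞ f C x :=
  (contDiffWithinAt_inter (hO.mem_nhds hx.2)).1 (hf x hx)

theorem contDiffOn_fderivWithin_of_convex {C O : Set V} (hC : Convex ℝ C)
    (hi : (interior C).Nonempty) (hO : IsOpen O) {f : V → W} (hf : ContDiffOn ℝ ∞ f (C ∩ O)) :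
    ContDiffOn ℝ ∞ (fderivWithin ℝ f C) (C ∩ O) := by
  refine (hf.fderivWithin (uniqueDiffOn_inter_of_convex hC hi hO) (m := ∞) (by simp)).congr ?_
  intro x hx
  exact (fderivWithin_inter (hO.mem_nhds hx.2)).symm

/-- The bound holds for all base points near `x'`. Translation by `t • e` preserves `C`, so `f`
vanishes on a whole neighbourhood of `x' + t • e` within `C`, and its derivative vanishes there. -/
theorem LineSupport.fderivWithin (h : LineDomain C O e) {f : V → W} (hf : LineSupport C O e f) :
    LineSupport C O e (fderivWithin ℝ f C) := by
  intro x hx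
  obtain ⟨R, hR⟩ := hf x hx
  refine ⟨R, ?_⟩
  filter_upwards [eventually_eventually_nhdsWithin.2 hR, self_mem_nhdsWithin] with x' hx' hx'C t ht
  have hloc : f =ᶠ[𝓝[C] (x' + t • e)] fun _ => 0 := by
    have htend : Tendsto (fun z : V => z + (-t) • e) (𝓝[C] (x' + t • e)) (𝓝[C] x') := by
      have h1 : ContinuousWithinAt (fun z : V => z + (-t) • e) C (x' + t • e) := by fun_prop
      have h2 := h1.tendsto_nhdsWithin (t := C) (fun z hz => h.add_mem z hz (-t))
      simpa using h2
    filter_upwards [htend.eventually hx'] with z hz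
    have := hz t ht
    simpa using this
  rw [hloc.fderivWithin_eq (hloc.self_of_nhdsWithin (h.add_mem x' hx'C t))]
  simp

theorem LineSupport.integrable (h : LineDomain C O e) {f : V → W} (hf : LineSupport C O e f)
    (hc : ContinuousOn f (C ∩ O)) {x : V} (hx : x ∈ C ∩ O) :
    Integrable fun t : ℝ => f (x + t • e) := by
  obtain ⟨R, hR⟩ := hf x hx
  have hR' := hR.self_of_nhdsWithin hx.1
  have hcont : Continuous fun t : ℝ => f (x + t • e) := by
    rw [← continuousOn_univ]
    exact hc.comp (by fun_prop) (fun t _ => h.add_mem_inter hx t)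
  refine hcont.integrable_of_hasCompactSupport ?_
  refine HasCompactSupport.of_support_subset_isCompact (isCompact_Icc (a := -R) (b := R)) ?_
  intro t ht
  by_contra hcon
  refine ht (hR' t ?_)
  by_contra! hle
  exact hcon (abs_le.1 hle)

theorem LineSupport.setIntegral_eq {f : V → W} {R : ℝ} {A : Set ℝ} (hA : MeasurableSet A) {x : V}
    (hR : ∀ t : ℝ, R < |t| → f (x + t • e) = 0) :
    ∫ t in A, f (x + t • e) = ∫ t in A ∩ Icc (-R) R, f (x + t • e) := by
  refine setIntegral_eq_of_subset_of_forall_sdiff_eq_zero hA inter_subset_left ?_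
  intro t ht
  refine hR t ?_
  by_contra! hle
  exact ht.2 ⟨ht.1, abs_le.1 hle⟩

/-- Near each point the integrand vanishes outside one interval `[-R, R]`, so the integral is
locally one over a compact set and can be differentiated under the integral sign. The set `A` is
arbitrary because half lines and full lines are both needed. -/
theorem contDiffOn_lineIntegral (h : LineDomain C O e) {f : V → W} (hf : LineSupport C O e f)
    (hc : ContDiffOn ℝ ∞ f (C ∩ O)) {A : Set ℝ} (hA : MeasurableSet A) :
    ContDiffOn ℝ ∞ (fun x => ∫ t in A, f (x + t • e)) (C ∩ O) ∧
    ∀ x ∈ C ∩ O, HasFDerivWithinAt (fun x => ∫ t in A, f (x + t • e))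
      (∫ t in A, fderivWithin ℝ f C (x + t • e)) C x := by
  have hu := uniqueDiffOn_inter_of_convex h.convex h.interior_nonempty h.isOpen
  suffices H : ∀ x ∈ C ∩ O, ContDiffWithinAt ℝ ∞ (fun x => ∫ t in A, f (x + t • e)) C x ∧
      HasFDerivWithinAt (fun x => ∫ t in A, f (x + t • e))
      (∫ t in A, fderivWithin ℝ f C (x + t • e)) C x from
    ⟨fun x hx => (H x hx).1.mono inter_subset_left, fun x hx => (H x hx).2⟩
  intro x hx
  obtain ⟨R₁, hR₁⟩ := hf x hx
  obtain ⟨R₂, hR₂⟩ := (hf.fderivWithin h) x hx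
  set R := max R₁ R₂
  obtain ⟨u, hu1, hxu, hu2⟩ := mem_nhdsWithin.1 (hR₁.and hR₂)
  have hf1 : ∀ x' ∈ C ∩ (O ∩ u), ∀ t : ℝ, R < |t| → f (x' + t • e) = 0 := fun x' hx' t ht =>
    (hu2 ⟨hx'.2.2, hx'.1⟩).1 t (lt_of_le_of_lt (le_max_left _ _) ht)
  have hf2 : ∀ t : ℝ, R < |t| → fderivWithin ℝ f C (x + t • e) = 0 := fun t ht =>
    (hu2 ⟨hxu, hx.1⟩).2 t (lt_of_le_of_lt (le_max_right _ _) ht)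
  have hOu : IsOpen (O ∩ u) := h.isOpen.inter hu1
  have hsub : C ∩ (O ∩ u) ⊆ C ∩ O := fun z hz => ⟨hz.1, hz.2.1⟩
  have hxm : x ∈ C ∩ (O ∩ u) := ⟨hx.1, hx.2, hxu⟩
  have hnhds : C ∩ (O ∩ u) ∈ 𝓝[C] x := inter_mem_nhdsWithin C (hOu.mem_nhds hxm.2)
  -- The cut-off at `R` is put into the measure, which makes it finite. The bound `R` serves both
  -- `f` and its derivative.
  set μ : Measure ℝ := volume.restrict (A ∩ Icc (-R) R) with hμdef
  have hμfin : IsFiniteMeasure μ := by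
    refine ⟨?_⟩
    rw [hμdef, Measure.restrict_apply_univ]
    exact (measure_mono inter_subset_right).trans_lt (by simp)
  have hμ : ∀ᵐ t ∂μ, t ∈ Icc (-R) R :=
    (ae_restrict_mem (hA.inter measurableSet_Icc)).mono fun t ht => ht.2
  have huu := uniqueDiffOn_inter_of_convex h.convex h.interior_nonempty hOu
  have hjoint : ContDiffOn ℝ ∞ (Function.uncurry fun (t : ℝ) (y : V) => f (y + t • e))
      ((univ : Set ℝ) ×ˢ (C ∩ (O ∩ u))) := by
    refine hc.comp (f := fun q : ℝ × V => q.2 + q.1 • e) (by fun_prop) ?_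
    intro q hq
    exact h.add_mem_inter (hsub hq.2) q.1
  have hslice : ∀ t : ℝ, ContDiffOn ℝ ∞ (fun y : V => f (y + t • e)) (C ∩ (O ∩ u)) := fun t =>
    hjoint.comp (f := fun y : V => (t, y)) (by fun_prop) (fun y hy => ⟨mem_univ _, hy⟩)
  have hsmooth := contDiffOn_integral_of_compact (μ := μ) (isCompact_Icc (a := -R) (b := R)) hμ
    h.convex hOu huu (F := fun t y => f (y + t • e)) (fun t _ => hslice t)
    (fun m => ((contDiffOn_iteratedFDerivWithin_uncurry huu hjoint m).continuousOn).mono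
      (prod_mono (subset_univ _) subset_rfl))
  have heq : ∀ x' ∈ C ∩ (O ∩ u), (∫ t in A, f (x' + t • e)) = ∫ t, f (x' + t • e) ∂μ :=
    fun x' hx' => LineSupport.setIntegral_eq hA (hf1 x' hx')
  have heq' : (fun x' => ∫ t in A, f (x' + t • e)) =ᶠ[𝓝[C] x] fun x' => ∫ t, f (x' + t • e) ∂μ :=
    eventually_of_mem hnhds heq
  constructor
  · have h1 : ContDiffWithinAt ℝ ∞ (fun x' => ∫ t, f (x' + t • e) ∂μ) C x :=
      (contDiffWithinAt_inter (hOu.mem_nhds hxm.2)).1 (hsmooth x hxm)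
    exact h1.congr_of_eventuallyEq heq' (heq x hxm)
  · have hder : ContDiffOn ℝ ∞ (_root_.fderivWithin ℝ f C) (C ∩ O) :=
      contDiffOn_fderivWithin_of_convex h.convex h.interior_nonempty h.isOpen hc
    have h2 := hasFDerivWithinAt_integral_of_compact (μ := μ) (isCompact_Icc (a := -R) (b := R))
      hμ h.convex hOu (Φ := fun t y => f (y + t • e))
      (Φ' := fun t y => _root_.fderivWithin ℝ f C (y + t • e)) (y₀ := x) ?_
      (hjoint.continuousOn.mono (prod_mono (subset_univ _) subset_rfl)) ?_ hxm
    · rw [LineSupport.setIntegral_eq hA hf2]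
      have h3 := (hasFDerivWithinAt_inter (hOu.mem_nhds hxm.2)).1 h2
      exact h3.congr_of_eventuallyEq heq' (heq x hxm)
    · intro t _ y hy
      exact (hasFDerivWithinAt_comp_add h.add_mem
        (ContDiffOn.hasFDerivWithinAt_of_convex h.isOpen hc
          (h.add_mem_inter (hsub hy) t))).mono inter_subset_left
    · refine hder.continuousOn.comp (f := fun q : ℝ × V => q.2 + q.1 • e) (by fun_prop) ?_
      intro q hq
      exact h.add_mem_inter (hsub hq.2) q.1

end Lines

/-! ### Line integrals of closed forms and their exterior derivatives -/

section LineForms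

variable {V : Type*} [NormedAddCommGroup V] [NormedSpace ℝ V] {C O : Set V} {e : V} {k : ℕ}

/-- Contraction of alternating maps with a fixed vector. -/
def contractL (e : V) (k : ℕ) : (V [⋀^Fin (k + 1)]→L[ℝ] ℝ) →L[ℝ] (V [⋀^Fin k]→L[ℝ] ℝ) :=
  (ContinuousLinearMap.apply ℝ _ e) ∘L
    (ContinuousAlternatingMap.curryLeftLI (𝕜 := ℝ) (E := V) (F := ℝ)
      (n := k)).toContinuousLinearMap

@[simp]
theorem contractL_apply (f : V [⋀^Fin (k + 1)]→L[ℝ] ℝ) (v : Fin k → V) :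
    contractL e k f v = f (Fin.cons e v) := rfl

theorem contractL_compContinuousLinearMap (f : V [⋀^Fin (k + 1)]→L[ℝ] ℝ) (L : V →L[ℝ] V)
    (hL : L e = e) :
    contractL e k (f.compContinuousLinearMap L) =
      (contractL e k f).compContinuousLinearMap L := by
  ext v
  simp only [contractL_apply, ContinuousAlternatingMap.compContinuousLinearMap_apply]
  congr 1
  ext i
  refine Fin.cases ?_ (fun i => ?_) i <;> simp [hL]

/-- Cartan's formula for a constant vector field. -/
theorem extDerivWithin_contractL {α : V → V [⋀^Fin (k + 1)]→L[ℝ] ℝ} {x : V}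
    (hu : UniqueDiffWithinAt ℝ C x) (hα : DifferentiableWithinAt ℝ α C x) :
    extDerivWithin (fun y => contractL e k (α y)) C x =
      fderivWithin ℝ α C x e - contractL e (k + 1) (extDerivWithin α C x) := by
  have h1 : DifferentiableWithinAt ℝ (fun y => contractL e k (α y)) C x :=
    (contractL e k).differentiableAt.comp_differentiableWithinAt x hα
  ext v
  rw [extDerivWithin_apply h1 hu]
  simp only [ContinuousAlternatingMap.sub_apply, contractL_apply]
  -- In `dα(e, v)` the summand of index 0 is the derivative in the direction `e`. The other summands
  -- are those of `d(ι_e α)(v)` with opposite sign, since every index moves up by one.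
  rw [extDerivWithin_apply hα hu, Fin.sum_univ_succ (n := k + 1)]
  have e0 : fderivWithin ℝ (fun y => α y ((0 : Fin (k + 2)).removeNth
      (Fin.cons e v : Fin (k + 2) → V))) C x e = fderivWithin ℝ α C x e v := by
    rw [fderivWithin_continuousAlternatingMap_apply_const_apply hu hα]
    rfl
  have e1 : ∀ i : Fin (k + 1), ((i.succ).removeNth (Fin.cons e v : Fin (k + 2) → V)) =
      Fin.cons e (i.removeNth v) := by
    intro i
    ext j
    refine Fin.cases ?_ (fun j => ?_) j <;> simp [Fin.removeNth]
  simp only [Fin.val_zero, pow_zero, one_smul, Fin.cons_zero, e0, Fin.cons_succ, e1, Fin.val_succ,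
    pow_succ, mul_neg, mul_one, neg_smul, Finset.sum_neg_distrib]
  abel

/-- The integral of a form along the part of the line in direction `e` given by `A`. -/
def lineInt (e : V) (A : Set ℝ) (α : V → V [⋀^Fin (k + 1)]→L[ℝ] ℝ) (x : V) :
    V [⋀^Fin k]→L[ℝ] ℝ :=
  ∫ t in A, contractL e k (α (x + t • e))

theorem LineSupport.contractL {α : V → V [⋀^Fin (k + 1)]→L[ℝ] ℝ} (hs : LineSupport C O e α) :
    LineSupport C O e (fun x => contractL e k (α x)) := by
  intro x hx
  obtain ⟨R, hR⟩ := hs x hx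
  refine ⟨R, hR.mono fun x' hx' t ht => ?_⟩
  simp only [hx' t ht, map_zero]

theorem contDiffOn_lineInt (h : LineDomain C O e) {α : V → V [⋀^Fin (k + 1)]→L[ℝ] ℝ}
    (hs : LineSupport C O e α) (hc : ContDiffOn ℝ ∞ α (C ∩ O)) {A : Set ℝ}
    (hA : MeasurableSet A) : ContDiffOn ℝ ∞ (lineInt e A α) (C ∩ O) :=
  (contDiffOn_lineIntegral h hs.contractL ((contractL e k).contDiff.comp_contDiffOn hc) hA).1

set_option synthInstance.maxHeartbeats 200000 in
-- `d` is a continuous linear function of the first derivative, so it passes under the integral. For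
-- closed `α`, Cartan's formula leaves only the derivative along the line, to which the fundamental
-- theorem of calculus will apply.
theorem extDerivWithin_lineInt (h : LineDomain C O e) {α : V → V [⋀^Fin (k + 1)]→L[ℝ] ℝ}
    (hs : LineSupport C O e α) (hc : ContDiffOn ℝ ∞ α (C ∩ O))
    (hd : ∀ x ∈ C ∩ O, extDerivWithin α C x = 0) {A : Set ℝ}
    (hA : MeasurableSet A) {x : V} (hx : x ∈ C ∩ O) :
    extDerivWithin (lineInt e A α) C x = ∫ t in A, fderivWithin ℝ α C (x + t • e) e := by
  have hcc : ContDiffOn ℝ ∞ (fun x => contractL e k (α x)) (C ∩ O) :=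
    (contractL e k).contDiff.comp_contDiffOn hc
  have h1 := (contDiffOn_lineIntegral h hs.contractL hcc hA).2 x hx
  have hu := uniqueDiffOn_convex h.convex h.interior_nonempty
  have hi :=
    (hs.contractL.fderivWithin h).integrable h
      (contDiffOn_fderivWithin_of_convex h.convex h.interior_nonempty h.isOpen hcc).continuousOn hx
  change ContinuousAlternatingMap.alternatizeUncurryFinCLM ℝ V ℝ
    (fderivWithin ℝ (fun x => ∫ t in A, contractL e k (α (x + t • e))) C x) = _
  rw [h1.fderivWithin (hu x hx.1), ← ContinuousLinearMap.integral_comp_comm _ hi.integrableOn]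
  refine integral_congr_ae (Eventually.of_forall fun t => ?_)
  have hxt := h.add_mem_inter hx t
  have := extDerivWithin_contractL (e := e) (hu _ hxt.1)
    (ContDiffOn.hasFDerivWithinAt_of_convex h.isOpen hc hxt).differentiableWithinAt
  rw [hd _ hxt, map_zero, sub_zero] at this
  exact this

theorem hasDerivAt_line (h : LineDomain C O e) {α : V → V [⋀^Fin (k + 1)]→L[ℝ] ℝ}
    (hc : ContDiffOn ℝ ∞ α (C ∩ O)) {x : V} (hx : x ∈ C ∩ O) (t : ℝ) :
    HasDerivAt (fun t : ℝ => α (x + t • e)) (fderivWithin ℝ α C (x + t • e) e) t := by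
  have h1 := ContDiffOn.hasFDerivWithinAt_of_convex h.isOpen hc (h.add_mem_inter hx t)
  have h2 : HasDerivWithinAt (fun t : ℝ => x + t • e) e univ t := by
    have := (((hasDerivAt_id t).smul_const e).const_add x).hasDerivWithinAt (s := univ)
    rwa [one_smul] at this
  have h3 := HasFDerivWithinAt.comp_hasDerivWithinAt t h1 h2 (fun s _ => h.add_mem x hx.1 s)
  rw [hasDerivWithinAt_univ] at h3
  exact h3

theorem LineSupport.integrable_fderivWithin (h : LineDomain C O e)
    {α : V → V [⋀^Fin (k + 1)]→L[ℝ] ℝ}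
    (hs : LineSupport C O e α) (hc : ContDiffOn ℝ ∞ α (C ∩ O)) {x : V} (hx : x ∈ C ∩ O) :
    Integrable fun t : ℝ => _root_.fderivWithin ℝ α C (x + t • e) e :=
  (ContinuousLinearMap.apply ℝ (V [⋀^Fin (k + 1)]→L[ℝ] ℝ) e).integrable_comp
    ((hs.fderivWithin h).integrable h
      (contDiffOn_fderivWithin_of_convex h.convex h.interior_nonempty h.isOpen hc).continuousOn hx)

theorem LineSupport.tendsto_atBot {α : V → V [⋀^Fin (k + 1)]→L[ℝ] ℝ}
    (hs : LineSupport C O e α) {x : V} (hx : x ∈ C ∩ O) :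
    Tendsto (fun t : ℝ => α (x + t • e)) atBot (𝓝 0) := by
  obtain ⟨R, hR⟩ := hs x hx
  refine tendsto_const_nhds.congr' ?_
  filter_upwards [eventually_lt_atBot (-R), eventually_lt_atBot 0] with t ht ht0
  exact (hR.self_of_nhdsWithin hx.1 t (by rw [abs_of_neg ht0]; linarith)).symm

theorem LineSupport.tendsto_atTop {α : V → V [⋀^Fin (k + 1)]→L[ℝ] ℝ}
    (hs : LineSupport C O e α) {x : V} (hx : x ∈ C ∩ O) :
    Tendsto (fun t : ℝ => α (x + t • e)) atTop (𝓝 0) := by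
  obtain ⟨R, hR⟩ := hs x hx
  refine tendsto_const_nhds.congr' ?_
  filter_upwards [eventually_gt_atTop R] with t ht
  exact (hR.self_of_nhdsWithin hx.1 t (ht.trans_le (le_abs_self t))).symm

/-- Integration along half lines is a primitive of closed forms. -/
theorem extDerivWithin_lineInt_Iic (h : LineDomain C O e) {α : V → V [⋀^Fin (k + 1)]→L[ℝ] ℝ}
    (hs : LineSupport C O e α) (hc : ContDiffOn ℝ ∞ α (C ∩ O))
    (hd : ∀ x ∈ C ∩ O, extDerivWithin α C x = 0) {x : V} (hx : x ∈ C ∩ O) :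
    extDerivWithin (lineInt e (Iic 0) α) C x = α x := by
  rw [extDerivWithin_lineInt h hs hc hd measurableSet_Iic hx]
  have := integral_Iic_of_hasDerivAt_of_tendsto' (a := (0 : ℝ))
    (fun t _ => hasDerivAt_line h hc hx t) (hs.integrable_fderivWithin h hc hx).integrableOn
    (hs.tendsto_atBot hx)
  simpa using this

/-- Integration along lines maps closed forms to closed forms. -/
theorem extDerivWithin_lineInt_univ (h : LineDomain C O e) {α : V → V [⋀^Fin (k + 1)]→L[ℝ] ℝ}
    (hs : LineSupport C O e α) (hc : ContDiffOn ℝ ∞ α (C ∩ O))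
    (hd : ∀ x ∈ C ∩ O, extDerivWithin α C x = 0) {x : V} (hx : x ∈ C ∩ O) :
    extDerivWithin (lineInt e univ α) C x = 0 := by
  rw [extDerivWithin_lineInt h hs hc hd MeasurableSet.univ hx]
  have := integral_of_hasDerivAt_of_tendsto
    (fun t => hasDerivAt_line h hc hx t) (hs.integrable_fderivWithin h hc hx)
    (hs.tendsto_atBot hx) (hs.tendsto_atTop hx)
  simpa using this

theorem lineInt_eq_zero {α : V → V [⋀^Fin (k + 1)]→L[ℝ] ℝ} {A : Set ℝ} (hA : MeasurableSet A)
    {x : V} (hz : ∀ t ∈ A, α (x + t • e) = 0) : lineInt e A α x = 0 := by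
  unfold lineInt
  rw [setIntegral_congr_fun hA (g := fun _ => 0) (fun t ht => by simp [hz t ht])]
  simp

/-- If a form is the pullback of another one under a linear map that fixes `e`, then so are their
integrals along lines. -/
theorem lineInt_compContinuousLinearMap (h : LineDomain C O e)
    {α : V → V [⋀^Fin (k + 1)]→L[ℝ] ℝ}
    (hs : LineSupport C O e α) (hc : ContDiffOn ℝ ∞ α (C ∩ O)) {x y : V}
    (hx : x ∈ C ∩ O) (A : Set ℝ) {L : V →L[ℝ] V} (hL : L e = e)
    {α' : V → V [⋀^Fin (k + 1)]→L[ℝ] ℝ}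
    (hα : ∀ t : ℝ, α' (y + t • e) = (α (x + t • e)).compContinuousLinearMap L) :
    lineInt e A α' y = (lineInt e A α x).compContinuousLinearMap L := by
  have hi : Integrable fun t : ℝ => contractL e k (α (x + t • e)) :=
    hs.contractL.integrable h ((contractL e k).continuous.comp_continuousOn hc.continuousOn) hx
  have := (ContinuousAlternatingMap.compContinuousLinearMapCLM (𝕜 := ℝ) (F := ℝ) (ι := Fin k)
    L).integral_comp_comm (μ := volume.restrict A) hi.integrableOn
  refine Eq.trans ?_ this
  unfold lineInt
  refine integral_congr_ae (Eventually.of_forall fun t => ?_)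
  change contractL e k (α' (y + t • e)) = (contractL e k _).compContinuousLinearMap L
  rw [hα, contractL_compContinuousLinearMap _ _ hL]

end LineForms

/-! ### The Poincaré lemma with compact supports in the fibre directions -/

section Fibre

variable {V : Type*} [NormedAddCommGroup V] [NormedSpace ℝ V] {C O : Set V} {k j : ℕ}

theorem minSmoothness_two_le : minSmoothness ℝ 2 ≤ (∞ : ℕ∞ω) := by
  simp
  exact ENat.LEInfty.out

/-- Naturality of `d` for an affine self-map of `C`, whose derivative is constantly `L`. It serves
both the retractions onto submanifolds and the linear projections along fibre directions. -/
theorem extDerivWithin_comp_affine (hC : Convex ℝ C) (hi : (interior C).Nonempty) (hO : IsOpen O)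
    {L : V →L[ℝ] V} {c : V} (hL : ∀ x ∈ C, L x + c ∈ C) {α : V → V [⋀^Fin k]→L[ℝ] ℝ}
    (hα : ContDiffOn ℝ ∞ α (C ∩ O)) {x : V} (hx : x ∈ C) (hx' : L x + c ∈ O) :
    extDerivWithin (fun y => (α (L y + c)).compContinuousLinearMap L) C x =
      (extDerivWithin α C (L x + c)).compContinuousLinearMap L := by
  have hu := uniqueDiffOn_convex hC hi
  have hf : ∀ y ∈ C, fderivWithin ℝ (fun y => L y + c) C y = L := fun y hy =>
    (L.hasFDerivWithinAt.add_const c).fderivWithin (hu y hy)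
  have h1 := extDerivWithin_pullback (f := fun y => L y + c) (s := C) (t := C) (x := x)
    (r := ∞)
    (ContDiffOn.hasFDerivWithinAt_of_convex hO hα ⟨hL x hx, hx'⟩).differentiableWithinAt
    (by fun_prop) minSmoothness_two_le hu (mem_closure_interior_of_convex hC hi hx) hx hL
  rw [hf x hx] at h1
  rw [← h1]
  exact extDerivWithin_congr' (fun y hy => by simp only [hf y hy]) hx

/-- An affine retraction of a convex set onto an affine subspace of it. -/
structure AffineRetraction (C : Set V) (L : V →L[ℝ] V) (c : V) : Prop where
  mem : ∀ x ∈ C, L x + c ∈ C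
  idem : ∀ x, L (L x + c) + c = L x + c

/-- The restriction of the form `α` to the image of an affine retraction vanishes. -/
def VanishesOn (C O : Set V) (L : V →L[ℝ] V) (c : V) (α : V → V [⋀^Fin k]→L[ℝ] ℝ) : Prop :=
  ∀ x ∈ C ∩ O, L x + c = x → (α x).compContinuousLinearMap L = 0

/-- The pullback of `α` under the whole retraction is zero near a fixed point. By naturality its
differential, which is zero as well, is the pullback of `dα`. -/
theorem VanishesOn.extDerivWithin (hC : Convex ℝ C) (hi : (interior C).Nonempty) (hO : IsOpen O)
    {L : V →L[ℝ] V} {c : V} (hL : AffineRetraction C L c) {α : V → V [⋀^Fin k]→L[ℝ] ℝ}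
    (hα : ContDiffOn ℝ ∞ α (C ∩ O)) (hv : VanishesOn C O L c α) :
    VanishesOn C O L c (extDerivWithin α C) := by
  intro x hx hxL
  have h1 := extDerivWithin_comp_affine hC hi hO hL.mem hα hx.1 (by rw [hxL]; exact hx.2)
  rw [hxL] at h1
  rw [← h1]
  have h2 : (fun y => (α (L y + c)).compContinuousLinearMap L) =ᶠ[𝓝[C] x] fun _ => 0 := by
    have h3 : ∀ᶠ y in 𝓝[C] x, L y + c ∈ O := by
      have : ContinuousWithinAt (fun y => L y + c) C x := by fun_prop
      exact this.eventually (by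
        simp only [hxL]; exact hO.mem_nhds hx.2)
    filter_upwards [h3, self_mem_nhdsWithin] with y hy hyC
    exact hv _ ⟨hL.mem y hyC, hy⟩ (hL.idem y)
  rw [h2.extDerivWithin_eq_of_mem hx.1]
  simp only [_root_.extDerivWithin, fderivWithin_fun_const, Pi.zero_apply]
  exact map_zero (ContinuousAlternatingMap.alternatizeUncurryFinCLM ℝ V ℝ)

/-- The function `f` has bounded support in the affine subspaces spanned by the vectors `e a`,
locally uniformly. -/
def FibreSupport {W : Type*} [Zero W] (C O : Set V) (e : Fin j → V) (f : V → W) : Prop :=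
  ∀ x ∈ C ∩ O, ∃ R : ℝ, ∀ᶠ x' in 𝓝[C] x, ∀ t : Fin j → ℝ, (∃ a, R < |t a|) →
    f (x' + ∑ a, t a • e a) = 0

theorem FibreSupport.lineSupport {W : Type*} [NormedAddCommGroup W] {e : Fin j → V} {f : V → W}
    (hf : FibreSupport C O e f) (a : Fin j) : LineSupport C O (e a) f := by
  intro x hx
  obtain ⟨R, hR⟩ := hf x hx
  refine ⟨R, hR.mono fun x' hx' t ht => ?_⟩
  have := hx' (Pi.single a t) ⟨a, by simpa using ht⟩
  rwa [Finset.sum_eq_single a (fun b _ hb => by simp [hb]) (by simp), Pi.single_eq_same] at this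

theorem add_sum_mem {e : Fin j → V} (h : ∀ a, LineDomain C O (e a)) {x : V} (hx : x ∈ C ∩ O)
    (t : Fin j → ℝ) : x + ∑ a, t a • e a ∈ C ∩ O := by
  have : ∀ s : Finset (Fin j), x + ∑ a ∈ s, t a • e a ∈ C ∩ O := by
    intro s
    induction s using Finset.induction_on with
    | empty => simpa using hx
    | insert a s ha ih =>
      rw [Finset.sum_insert ha, add_comm (t a • e a), ← add_assoc]
      exact (h a).add_mem_inter ih (t a)
  exact this Finset.univ

/-- Fubini, with the coordinate of index 0 as the inner variable; the bounded fibre support provides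
integrability. -/
theorem integral_fin_succ {e : Fin (j + 1) → V} (h : ∀ a, LineDomain C O (e a)) {f : V → ℝ}
    (hc : ContinuousOn f (C ∩ O)) (hf : FibreSupport C O e f) {x : V} (hx : x ∈ C ∩ O) :
    ∫ t : Fin j → ℝ, ∫ s : ℝ, f (x + ∑ a, t a • e a.succ + s • e 0) =
      ∫ t : Fin (j + 1) → ℝ, f (x + ∑ a, t a • e a) := by
  have hcont : Continuous fun t : Fin (j + 1) → ℝ => f (x + ∑ a, t a • e a) := by
    rw [← continuousOn_univ]
    exact hc.comp (by fun_prop) (fun t _ => add_sum_mem h hx t)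
  have hint : Integrable fun t : Fin (j + 1) → ℝ => f (x + ∑ a, t a • e a) := by
    obtain ⟨R, hR⟩ := hf x hx
    refine hcont.integrable_of_hasCompactSupport ?_
    refine HasCompactSupport.of_support_subset_isCompact
      (isCompact_univ_pi fun _ => isCompact_Icc (a := -R) (b := R)) ?_
    intro t ht
    by_contra hcon
    refine ht (hR.self_of_nhdsWithin hx.1 t ?_)
    by_contra! hle
    exact hcon fun a _ => abs_le.1 (hle a)
  have hmp := (volume_preserving_piFinSuccAbove (fun _ : Fin (j + 1) => ℝ) 0).symm
  have he := (MeasurableEquiv.piFinSuccAbove (fun _ : Fin (j + 1) => ℝ) 0).symm.measurableEmbedding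
  rw [← hmp.integral_comp he]
  have hint' := (hmp.integrable_comp_emb he).2 hint
  have e1 : ∀ q : ℝ × (Fin j → ℝ),
      f (x + ∑ a, (MeasurableEquiv.piFinSuccAbove (fun _ : Fin (j + 1) => ℝ) 0).symm q a • e a) =
        f (x + ∑ a, q.2 a • e a.succ + q.1 • e 0) := by
    intro q
    congr 1
    rw [Fin.sum_univ_succ, add_comm (_ • e 0), add_assoc]
    simp [MeasurableEquiv.piFinSuccAbove]
  have hint2 : Integrable (fun q : ℝ × (Fin j → ℝ) => f (x + ∑ a, q.2 a • e a.succ + q.1 • e 0))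
      (volume.prod volume) := by
    refine hint'.congr (Eventually.of_forall fun q => e1 q)
  rw [integral_congr_ae (Eventually.of_forall e1)]
  exact (integral_prod_symm _ hint2).symm

/-- The form `α` is the pullback of itself under the linear projection `q`. -/
def IsBasic (C O : Set V) (q : V →L[ℝ] V) (α : V → V [⋀^Fin k]→L[ℝ] ℝ) : Prop :=
  ∀ x ∈ C ∩ O, α x = (α (q x)).compContinuousLinearMap q

theorem IsBasic.extDerivWithin (hC : Convex ℝ C) (hi : (interior C).Nonempty) (hO : IsOpen O)
    {q : V →L[ℝ] V} (hqC : ∀ x ∈ C, q x ∈ C) (hqO : ∀ x ∈ O, q x ∈ O)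
    {α : V → V [⋀^Fin k]→L[ℝ] ℝ} (hα : ContDiffOn ℝ ∞ α (C ∩ O)) (hb : IsBasic C O q α) :
    IsBasic C O q (extDerivWithin α C) := by
  intro x hx
  have h1 := extDerivWithin_comp_affine (c := 0) hC hi hO (L := q)
    (fun y hy => by simpa using hqC y hy) hα hx.1 (by simpa using hqO x hx.2)
  simp only [add_zero] at h1
  rw [← h1]
  refine Filter.EventuallyEq.extDerivWithin_eq_of_mem ?_ hx.1
  exact eventually_of_mem (inter_mem_nhdsWithin C (hO.mem_nhds hx.2)) fun y hy => hb y hy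

theorem contDiffOn_extDerivWithin (hC : Convex ℝ C) (hi : (interior C).Nonempty) (hO : IsOpen O)
    {α : V → V [⋀^Fin k]→L[ℝ] ℝ} (hα : ContDiffOn ℝ ∞ α (C ∩ O)) :
    ContDiffOn ℝ ∞ (extDerivWithin α C) (C ∩ O) :=
  ContDiff.comp_contDiffOn (g := ContinuousAlternatingMap.alternatizeUncurryFinCLM (n := k) ℝ V ℝ)
    (ContinuousLinearMap.contDiff _) (contDiffOn_fderivWithin_of_convex hC hi hO hα)

theorem extDerivWithin_extDerivWithin_of_convex (hC : Convex ℝ C) (hi : (interior C).Nonempty)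
    (hO : IsOpen O) {α : V → V [⋀^Fin k]→L[ℝ] ℝ} (hα : ContDiffOn ℝ ∞ α (C ∩ O)) {x : V}
    (hx : x ∈ C ∩ O) : extDerivWithin (extDerivWithin α C) C x = 0 :=
  extDerivWithin_extDerivWithin_apply
    (ContDiffOn.contDiffWithinAt_of_isOpen hO hα hx) minSmoothness_two_le
    (uniqueDiffOn_convex hC hi) (mem_closure_interior_of_convex hC hi hx.1) hx.1

variable {e : Fin (j + 1) → V}

theorem lineInt_basic {e₀ : V} (h : LineDomain C O e₀) {q : V →L[ℝ] V}
    (hqC : ∀ x ∈ C, q x ∈ C) (hqO : ∀ x ∈ O, q x ∈ O) (hqe : q e₀ = e₀)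
    {α : V → V [⋀^Fin (k + 1)]→L[ℝ] ℝ} (hs : LineSupport C O e₀ α)
    (hc : ContDiffOn ℝ ∞ α (C ∩ O)) (hq : IsBasic C O q α) (A : Set ℝ) :
    IsBasic C O q (lineInt e₀ A α) := by
  intro x hx
  refine lineInt_compContinuousLinearMap h hs hc (x := q x) (y := x)
    ⟨hqC x hx.1, hqO x hx.2⟩ A hqe fun t => ?_
  rw [hq _ (h.add_mem_inter hx t), map_add, map_smul, hqe]

/-- Since `L e₀ = e₀`, a line in direction `e₀` through a fixed point of the retraction consists of
fixed points, so the integrand restricts to zero along the whole line. -/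
theorem lineInt_vanishesOn {e₀ : V} (h : LineDomain C O e₀)
    {L : V →L[ℝ] V} {c : V} (hLe : L e₀ = e₀)
    {α : V → V [⋀^Fin (k + 1)]→L[ℝ] ℝ} (hs : LineSupport C O e₀ α)
    (hc : ContDiffOn ℝ ∞ α (C ∩ O)) (hv : VanishesOn C O L c α) (A : Set ℝ) :
    VanishesOn C O L c (lineInt e₀ A α) := by
  intro x hx hxL
  rw [← lineInt_compContinuousLinearMap h hs hc hx A hLe (α' := fun _ => 0) (y := x)]
  · simp [lineInt]
  · intro t
    refine (hv _ (h.add_mem_inter hx t) ?_).symm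
    rw [map_add, map_smul, hLe, add_right_comm, hxL]

/-- A primitive along half lines, corrected by a closed form that agrees with it far away, is a
primitive with bounded support in the fibre directions. -/
theorem exists_primitive_of_correction (h : ∀ a, LineDomain C O (e a)) {q : V →L[ℝ] V}
    (hqC : ∀ x ∈ C, q x ∈ C) (hqO : ∀ x ∈ O, q x ∈ O) (hqe : ∀ a, q (e a) = e a)
    {α : V → V [⋀^Fin (k + 1)]→L[ℝ] ℝ} (hc : ContDiffOn ℝ ∞ α (C ∩ O))
    (hd : ∀ x ∈ C ∩ O, extDerivWithin α C x = 0) (hs : FibreSupport C O e α)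
    (hq : IsBasic C O q α)
    {η : V → V [⋀^Fin k]→L[ℝ] ℝ} (hηc : ContDiffOn ℝ ∞ η (C ∩ O))
    (hηd : ∀ x ∈ C ∩ O, extDerivWithin η C x = 0) (hηq : IsBasic C O q η)
    (hηv : ∀ (L : V →L[ℝ] V) (c : V), AffineRetraction C L c → (∀ a, L (e a) = e a) →
      VanishesOn C O L c α → VanishesOn C O L c η)
    (hηs : ∀ x ∈ C ∩ O, ∃ R : ℝ, ∀ᶠ x' in 𝓝[C] x, ∀ t : Fin (j + 1) → ℝ,
      (((∃ a : Fin j, R < |t a.succ|) ∨ t 0 < -R) → η (x' + ∑ a, t a • e a) = 0) ∧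
      (R < t 0 → η (x' + ∑ a, t a • e a) = lineInt (e 0) univ α (x' + ∑ a, t a • e a))) :
    ∃ β : V → V [⋀^Fin k]→L[ℝ] ℝ, ContDiffOn ℝ ∞ β (C ∩ O) ∧
      (∀ x ∈ C ∩ O, extDerivWithin β C x = α x) ∧ FibreSupport C O e β ∧ IsBasic C O q β ∧
      ∀ (L : V →L[ℝ] V) (c : V), AffineRetraction C L c → (∀ a, L (e a) = e a) →
        VanishesOn C O L c α → VanishesOn C O L c β := by
  have hs0 := hs.lineSupport 0
  have h0 := h 0
  have hβ0 := contDiffOn_lineInt h0 hs0 hc (A := Iic 0) measurableSet_Iic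
  -- The half line integral has the correct differential, and `η` is closed, so only the support of
  -- the difference needs an argument.
  refine ⟨fun x => lineInt (e 0) (Iic 0) α x - η x, hβ0.sub hηc, ?_, ?_, ?_, ?_⟩
  · intro x hx
    have h1 := ContDiffOn.hasFDerivWithinAt_of_convex h0.isOpen hβ0 hx
    have h2 := ContDiffOn.hasFDerivWithinAt_of_convex h0.isOpen hηc hx
    have hu := uniqueDiffOn_convex h0.convex h0.interior_nonempty x hx.1
    have h3 : extDerivWithin (fun x => lineInt (e 0) (Iic 0) α x - η x) C x =
        extDerivWithin (lineInt (e 0) (Iic 0) α) C x - extDerivWithin η C x := by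
      simp only [extDerivWithin]
      rw [fderivWithin_fun_sub hu h1.differentiableWithinAt h2.differentiableWithinAt]
      exact map_sub (ContinuousAlternatingMap.alternatizeUncurryFinCLM ℝ V ℝ) _ _
    rw [h3, extDerivWithin_lineInt_Iic h0 hs0 hc hd hx, hηd x hx, sub_zero]
  · intro x hx
    obtain ⟨R₁, hR₁⟩ := hs x hx
    obtain ⟨R₂, hR₂⟩ := hηs x hx
    refine ⟨max (max R₁ R₂) 0, ?_⟩
    filter_upwards [hR₁, hR₂] with x' h1 h2 t ⟨a, ha⟩
    obtain ⟨ha12, ha0⟩ := max_lt_iff.1 ha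
    obtain ⟨ha1, ha2⟩ := max_lt_iff.1 ha12
    have hz : ∀ s : ℝ, x' + ∑ a, t a • e a + s • e 0 =
        x' + ∑ a, (t + Pi.single 0 s : Fin (j + 1) → ℝ) a • e a := by
      intro s
      rw [add_assoc]
      congr 1
      simp only [Pi.add_apply, add_smul, Finset.sum_add_distrib]
      congr 1
      rw [Finset.sum_eq_single 0 (fun b _ hb => by simp [hb]) (by simp), Pi.single_eq_same]
    change lineInt (e 0) (Iic 0) α _ - η _ = 0
    induction a using Fin.cases with
    | succ b =>
      rw [(h2 t).1 (Or.inl ⟨b, ha2⟩), lineInt_eq_zero measurableSet_Iic, sub_zero]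
      intro s _
      rw [hz]
      exact h1 _ ⟨b.succ, by simpa using ha1⟩
    | zero =>
      -- Far out on the positive side the half line `s ≤ 0` contains the entire support, so its
      -- integral is the full one and `η` cancels it. On the negative side the half line misses the
      -- support, and `η` vanishes.
      rcases lt_or_ge 0 (t 0) with hp | hn
      · rw [abs_of_pos hp] at ha1 ha2
        rw [(h2 t).2 ha2, sub_eq_zero]
        unfold lineInt
        symm
        refine setIntegral_eq_of_subset_of_forall_sdiff_eq_zero MeasurableSet.univ
          (subset_univ _) ?_
        rintro s ⟨-, hs⟩
        have hs' : 0 < s := not_le.1 hs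
        rw [hz, h1 _ ⟨0, ?_⟩, map_zero]
        simp only [Pi.add_apply, Pi.single_eq_same]
        exact lt_abs.2 (Or.inl (by linarith))
      · rw [abs_of_nonpos hn] at ha1 ha2
        rw [(h2 t).1 (Or.inr (by linarith)), sub_zero]
        refine lineInt_eq_zero measurableSet_Iic fun s hs => ?_
        have hs' : s ≤ 0 := hs
        rw [hz]
        refine h1 _ ⟨0, ?_⟩
        simp only [Pi.add_apply, Pi.single_eq_same]
        exact lt_abs.2 (Or.inr (by linarith))
  · intro x hx
    change lineInt (e 0) (Iic 0) α x - η x = ContinuousAlternatingMap.compContinuousLinearMapCLM q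
      (lineInt (e 0) (Iic 0) α (q x) - η (q x))
    rw [map_sub, lineInt_basic h0 hqC hqO (hqe 0) hs0 hc hq _ x hx, hηq x hx]
    rfl
  · intro L c hL hLe hv x hx hxL
    change ContinuousAlternatingMap.compContinuousLinearMapCLM L
      (lineInt (e 0) (Iic 0) α x - η x) = 0
    rw [map_sub]
    have h1 := lineInt_vanishesOn h0 (hLe 0) hs0 hc hv (Iic 0) x hx hxL
    have h2 := hηv L c hL hLe hv x hx hxL
    change (lineInt (e 0) (Iic 0) α x).compContinuousLinearMap L -
      (η x).compContinuousLinearMap L = 0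
    rw [h1, h2, sub_zero]

end Fibre

/-! ### The vertical Poincaré lemma -/

section Primitive

variable {V : Type*} [NormedAddCommGroup V] [NormedSpace ℝ V] {C O : Set V} {k j : ℕ}

/-- Change one argument at a time; each extra term has `e₀` among its arguments. This shows that a
form annihilated by `e₀` does not see a modification of the arguments along `e₀`. -/
theorem alternating_map_add_smul (A : V [⋀^Fin k]→L[ℝ] ℝ) {e₀ : V}
    (hA : ∀ (v : Fin k → V) (i : Fin k), v i = e₀ → A v = 0) (v : Fin k → V) (c : Fin k → ℝ) :
    A (fun i => v i + c i • e₀) = A v := by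
  have : ∀ s : Finset (Fin k), A (fun i => v i + (if i ∈ s then c i else 0) • e₀) = A v := by
    intro s
    induction s using Finset.induction_on with
    | empty => simp
    | insert a s ha ih =>
      set w : Fin k → V := fun i => v i + (if i ∈ s then c i else 0) • e₀ with hw
      have h1 : (fun i => v i + (if i ∈ insert a s then c i else 0) • e₀) =
          Function.update w a (w a + c a • e₀) := by
        ext i
        rcases eq_or_ne i a with rfl | hi
        · simp [hw, ha]
        · simp [hw, hi]
      rw [h1, A.map_update_add, A.map_update_smul, hA (Function.update w a e₀) a (by simp),
        Function.update_eq_self, ih, smul_zero, add_zero]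
  simpa using this Finset.univ

theorem lineInt_apply {e₀ : V} (h : LineDomain C O e₀) {α : V → V [⋀^Fin (k + 1)]→L[ℝ] ℝ}
    (hs : LineSupport C O e₀ α) (hc : ContDiffOn ℝ ∞ α (C ∩ O)) {x : V} (hx : x ∈ C ∩ O)
    (v : Fin k → V) :
    lineInt e₀ univ α x v = ∫ t : ℝ, α (x + t • e₀) (Fin.cons e₀ v) := by
  have hi : Integrable fun t : ℝ => contractL e₀ k (α (x + t • e₀)) :=
    hs.contractL.integrable h ((contractL e₀ k).continuous.comp_continuousOn hc.continuousOn) hx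
  have := (ContinuousAlternatingMap.apply ℝ V ℝ v).integral_comp_comm hi
  unfold lineInt
  rw [setIntegral_univ]
  exact this.symm

/-- Translation invariance of Lebesgue measure: the integral depends on the line and not on the
starting point. -/
theorem lineInt_univ_add {e₀ : V} (α : V → V [⋀^Fin (k + 1)]→L[ℝ] ℝ) (x : V) (s : ℝ) :
    lineInt e₀ univ α (x + s • e₀) = lineInt e₀ univ α x := by
  unfold lineInt
  rw [setIntegral_univ, setIntegral_univ,
    ← integral_add_left_eq_self (fun t => contractL e₀ k (α (x + t • e₀))) s]
  simp only [add_smul, add_assoc]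

/-- By Fubini the fibre integral of the line integral is the fibre integral of the form. Thus the
hypothesis of vanishing integrals passes to the induction step. -/
theorem integral_lineInt {e : Fin (j + 1) → V} (h : ∀ a, LineDomain C O (e a))
    {α : V → V [⋀^Fin (j + 1)]→L[ℝ] ℝ}
    (hs : FibreSupport C O e α) (hc : ContDiffOn ℝ ∞ α (C ∩ O)) {x : V} (hx : x ∈ C ∩ O) :
    ∫ t : Fin j → ℝ, lineInt (e 0) univ α (x + ∑ a, t a • e a.succ) (fun a => e a.succ) =
      ∫ t : Fin (j + 1) → ℝ, α (x + ∑ a, t a • e a) e := by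
  have hs' : FibreSupport C O e (fun y => α y e) := by
    intro y hy
    obtain ⟨R, hR⟩ := hs y hy
    exact ⟨R, hR.mono fun x' hx' t ht => by simp only [hx' t ht]; rfl⟩
  have hfub := integral_fin_succ h (f := fun y => α y e)
    ((ContinuousAlternatingMap.apply ℝ V ℝ e).continuous.comp_continuousOn
    hc.continuousOn) hs' hx
  rw [← hfub]
  refine integral_congr_ae (Eventually.of_forall fun t => ?_)
  have hxt : x + ∑ a, t a • e a.succ ∈ C ∩ O := add_sum_mem (fun a => h a.succ) hx t
  simp only
  rw [lineInt_apply (h 0) (hs.lineSupport 0) hc hxt]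
  have : (Fin.cons (e 0) (fun a => e a.succ) : Fin (j + 1) → V) = e := Fin.cons_self_tail e
  rw [this]

theorem fibreSupport_lineInt {e : Fin (j + 1) → V} {α : V → V [⋀^Fin (k + 1)]→L[ℝ] ℝ}
    (hs : FibreSupport C O e α) :
    FibreSupport C O (fun a : Fin j => e a.succ) (lineInt (e 0) univ α) := by
  intro x hx
  obtain ⟨R, hR⟩ := hs x hx
  refine ⟨R, hR.mono fun x' hx' t ⟨a, ha⟩ => lineInt_eq_zero MeasurableSet.univ fun s _ => ?_⟩
  have := hx' (Fin.cons s t : Fin (j + 1) → ℝ) ⟨a.succ, by simpa using ha⟩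
  rw [Fin.sum_univ_succ] at this
  simp only [Fin.cons_zero, Fin.cons_succ] at this
  rwa [add_assoc, add_comm _ (s • e 0)]

/-- Closed forms with bounded support in the fibre directions and with vanishing integrals over the
fibres have primitives with bounded support in the fibre directions, and the primitives vanish
on those affine subspaces that contain the fibre directions and on which the form vanishes. -/
theorem exists_primitive_of_integral_eq_zero (j : ℕ) (e : Fin (j + 1) → V)
    (ℓ : Fin (j + 1) → V →L[ℝ] ℝ) (q : V →L[ℝ] V) (h : ∀ a, LineDomain C O (e a))
    (hℓ : ∀ a b, ℓ a (e b) = if a = b then 1 else 0)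
    (hqC : ∀ x ∈ C, q x ∈ C) (hqO : ∀ x ∈ O, q x ∈ O) (hqe : ∀ a, q (e a) = e a)
    (hℓq : ∀ a x, ℓ a (q x) = ℓ a x) (hqq : ∀ x, q (q x) = q x)
    (α : V → V [⋀^Fin (j + 1)]→L[ℝ] ℝ) (hc : ContDiffOn ℝ ∞ α (C ∩ O))
    (hd : ∀ x ∈ C ∩ O, extDerivWithin α C x = 0) (hs : FibreSupport C O e α)
    (hq : IsBasic C O q α)
    (hint : ∀ x ∈ C ∩ O, ∫ t : Fin (j + 1) → ℝ, α (x + ∑ a, t a • e a) e = 0) :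
    ∃ β : V → V [⋀^Fin j]→L[ℝ] ℝ, ContDiffOn ℝ ∞ β (C ∩ O) ∧
      (∀ x ∈ C ∩ O, extDerivWithin β C x = α x) ∧ FibreSupport C O e β ∧ IsBasic C O q β ∧
      ∀ (L : V →L[ℝ] V) (c : V), AffineRetraction C L c → (∀ a, L (e a) = e a) →
        VanishesOn C O L c α → VanishesOn C O L c β := by
  induction j generalizing q with
  | zero =>
    -- With one fibre direction the line integral is a 0-form, and its value is the fibre integral.
    -- Hence no correction is needed, and `η = 0` works.
    have hI : ∀ x ∈ C ∩ O, lineInt (e 0) univ α x = 0 := by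
      intro x hx
      have h1 := integral_lineInt h hs hc hx
      rw [hint x hx] at h1
      ext v
      have h2 : (fun t : Fin 0 → ℝ => lineInt (e 0) univ α (x + ∑ a, t a • e a.succ)
          (fun a => e a.succ)) = fun _ => lineInt (e 0) univ α x v := by
        ext t
        rw [Subsingleton.elim (fun a : Fin 0 => e a.succ) v]
        simp
      rw [h2] at h1
      rw [Measure.volume_pi_eq_dirac (x := fun _ => 0), integral_dirac] at h1
      exact h1
    refine exists_primitive_of_correction h hqC hqO hqe hc hd hs hq (η := fun _ => 0)
      contDiffOn_const ?_ ?_ ?_ ?_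
    · intro x hx
      simp only [extDerivWithin, fderivWithin_fun_const, Pi.zero_apply]
      exact map_zero (ContinuousAlternatingMap.alternatizeUncurryFinCLM ℝ V ℝ)
    · intro x _
      exact (map_zero (ContinuousAlternatingMap.compContinuousLinearMapCLM (𝕜 := ℝ) (F := ℝ)
        (ι := Fin 0) q)).symm
    · intro L c _ _ _ x _ _
      exact map_zero (ContinuousAlternatingMap.compContinuousLinearMapCLM (𝕜 := ℝ) (F := ℝ)
        (ι := Fin 0) L)
    · intro x hx
      refine ⟨0, ?_⟩
      filter_upwards [(h 0).inter_mem_nhdsWithin hx] with x' hx' t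
      exact ⟨fun _ => rfl, fun _ => (hI _ (add_sum_mem h hx' t)).symm⟩
  | succ j ih =>
    have h0 := h 0
    have hs0 := hs.lineSupport 0
    -- The projection `q` followed by removal of the `e 0`-component. The line integral `I` is
    -- constant along `e 0` and annihilated by `e 0`, so it is basic for `q'`. Carrying `q` along in
    -- the statement keeps this information in the induction.
    set q' : V →L[ℝ] V := q - (ℓ 0).smulRight (e 0) with hq'
    have hq'x : ∀ x, q' x = q x + (-ℓ 0 x) • e 0 := fun x => by simp [hq', sub_eq_add_neg]
    have hℓ00 : ℓ 0 (e 0) = 1 := by simp [hℓ]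
    have hℓs : ∀ a : Fin (j + 1), ℓ a.succ (e 0) = 0 := fun a => by
      simp [hℓ]
    have hℓ0s : ∀ a : Fin (j + 1), ℓ 0 (e a.succ) = 0 := fun a => by
      simp [hℓ, (Fin.succ_ne_zero a).symm]
    have hqW : ∀ x ∈ C ∩ O, q x ∈ C ∩ O := fun x hx => ⟨hqC x hx.1, hqO x hx.2⟩
    set I := lineInt (e 0) univ α with hIdef
    have hIc : ContDiffOn ℝ ∞ I (C ∩ O) := contDiffOn_lineInt h0 hs0 hc MeasurableSet.univ
    have hIb : IsBasic C O q' I := by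
      intro x hx
      have h1 := lineInt_basic h0 hqC hqO (hqe 0) hs0 hc hq univ x hx
      rw [← hIdef] at h1
      rw [h1, hq'x, hIdef, lineInt_univ_add, ← hIdef]
      ext v
      simp only [ContinuousAlternatingMap.compContinuousLinearMap_apply]
      have h2 := alternating_map_add_smul (I (q x)) (e₀ := e 0) (fun w i hi => by
        rw [hIdef, lineInt_apply h0 hs0 hc (hqW x hx)]
        have : ∀ t : ℝ, α (q x + t • e 0) (Fin.cons (e 0) w) = 0 := fun t =>
          (α (q x + t • e 0)).map_eq_zero_of_eq _ (i := 0) (j := i.succ) (by simp [hi])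
            (Fin.succ_ne_zero i).symm
        simp [this]) (fun i => q (v i)) (fun i => -ℓ 0 (v i))
      have h3 : (⇑q' ∘ v) = fun i => q (v i) + (-ℓ 0 (v i)) • e 0 := by
        ext i
        exact hq'x (v i)
      rw [h3]
      exact h2.symm
    -- A primitive `γ` of `I` that is bounded in the remaining directions and, being basic for `q'`,
    -- constant along `e 0`.
    obtain ⟨γ, hγc, hγd, hγs, hγb, hγv⟩ := ih (fun a => e a.succ) (fun a => ℓ a.succ) q'
      (fun a => h a.succ) (fun a b => by simp [hℓ])
      (fun x hx => by rw [hq'x]; exact h0.add_mem _ (hqC x hx) _)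
      (fun x hx => by rw [hq'x]; exact h0.add_mem_open _ (hqO x hx) _)
      (fun a => by rw [hq'x, hqe, hℓ0s]; simp)
      (fun a x => by rw [hq'x, map_add, hℓq, map_smul, hℓs]; simp)
      (fun x => by
        have h1 : ℓ 0 (q' x) = 0 := by rw [hq'x, map_add, hℓq, map_smul, hℓ00]; simp
        rw [hq'x (q' x), h1, hq'x, map_add, hqq, map_smul, hqe]
        simp)
      I hIc (fun x hx => extDerivWithin_lineInt_univ h0 hs0 hc hd hx)
      (fibreSupport_lineInt hs) hIb
      (fun x hx => (integral_lineInt h hs hc hx).trans (hint x hx))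
    -- The correction is `η = d(θ γ)`: it is zero where `ℓ 0 < 0` and equals `dγ = I` where `ℓ 0 >
    -- 1`. Being exact, it is closed.
    set θ : V → ℝ := fun x => Real.smoothTransition (ℓ 0 x) with hθ
    have hθc : ContDiff ℝ ∞ θ := Real.smoothTransition.contDiff.comp (ℓ 0).contDiff
    have hθγ : ContDiffOn ℝ ∞ (fun x => θ x • γ x) (C ∩ O) := hθc.contDiffOn.smul hγc
    have hγeq : ∀ x ∈ C ∩ O, ∀ y ∈ C ∩ O, q' x = q' y → γ x = γ y := by
      intro x hx y hy hxy
      rw [hγb x hx, hγb y hy, hxy]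
    have hγq : IsBasic C O q γ := by
      intro x hx
      have hqq' : ∀ y, q' (q y) = q' y := fun y => by rw [hq'x, hq'x, hqq, hℓq]
      rw [hγb (q x) (hqW x hx), hγb x hx, hqq']
      ext v
      simp only [ContinuousAlternatingMap.compContinuousLinearMap_apply]
      congr 1
      ext i
      exact (hqq' (v i)).symm
    refine exists_primitive_of_correction h hqC hqO hqe hc hd hs hq
      (η := extDerivWithin (fun x => θ x • γ x) C)
      (contDiffOn_extDerivWithin h0.convex h0.interior_nonempty h0.isOpen hθγ)
      (fun x hx => extDerivWithin_extDerivWithin_of_convex h0.convex h0.interior_nonempty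
        h0.isOpen hθγ hx) ?_ ?_ ?_
    · refine IsBasic.extDerivWithin h0.convex h0.interior_nonempty h0.isOpen hqC hqO hθγ ?_
      intro x hx
      have : θ (q x) = θ x := by simp only [hθ, hℓq]
      simp only [this]
      rw [hγq x hx]
      rfl
    · intro L c hL hLe hv
      refine VanishesOn.extDerivWithin h0.convex h0.interior_nonempty h0.isOpen hL hθγ ?_
      intro x hx hxL
      have h1 := hγv L c hL (fun a => hLe a.succ)
        (lineInt_vanishesOn h0 (hLe 0) hs0 hc hv univ) x hx hxL
      change θ x • (γ x).compContinuousLinearMap L = 0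
      rw [h1, smul_zero]
    · intro x hx
      obtain ⟨R, hR⟩ := hγs x hx
      -- For `x'` near `x` one has `|ℓ 0 x' - ℓ 0 x| < 1`, so a shift of more than `|ℓ 0 x| + 2`
      -- along `e 0` moves the point into `ℓ 0 > 1` or into `ℓ 0 < 0`.
      refine ⟨max R (|ℓ 0 x| + 2), ?_⟩
      have hℓx : ∀ᶠ x' in 𝓝[C] x, |ℓ 0 x' - ℓ 0 x| < 1 := by
        have : ContinuousWithinAt (fun y => ℓ 0 y) C x := by fun_prop
        exact Metric.tendsto_nhds.1 this 1 one_pos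
      filter_upwards [eventually_eventually_nhdsWithin.2 hR, hℓx, self_mem_nhdsWithin,
        h0.inter_mem_nhdsWithin hx] with x' hx' hx'ℓ hx'C hx'W t
      set z := x' + ∑ a, t a • e a with hz
      have hzW : z ∈ C ∩ O := add_sum_mem h hx'W t
      have hℓz : ℓ 0 z = ℓ 0 x' + t 0 := by
        rw [hz, map_add, map_sum, Finset.sum_eq_single 0]
        · simp [hℓ00]
        · intro b _ hb
          simp [hℓ, hb.symm]
        · simp
      have hcontz : ContinuousWithinAt (fun y => ℓ 0 y) C z := by fun_prop
      have habs := abs_lt.1 hx'ℓ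
      have hle := neg_abs_le (ℓ 0 x)
      have hle' := le_abs_self (ℓ 0 x)
      have hzero : (fun x => θ x • γ x) =ᶠ[𝓝[C] z] (fun _ => 0) →
          extDerivWithin (fun x => θ x • γ x) C z = 0 := by
        intro he
        rw [he.extDerivWithin_eq_of_mem hzW.1]
        simp only [extDerivWithin, fderivWithin_fun_const, Pi.zero_apply]
        exact map_zero (ContinuousAlternatingMap.alternatizeUncurryFinCLM ℝ V ℝ)
      refine ⟨?_, fun ht => ?_⟩
      · rintro (⟨a, ha⟩ | ht)
        · refine hzero ?_
          have htend : Tendsto (fun y : V => y - ∑ a, t a • e a) (𝓝[C] z) (𝓝[C] x') := by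
            have h1 : ContinuousWithinAt (fun y : V => y - ∑ a, t a • e a) C z := by fun_prop
            have h2 := h1.tendsto_nhdsWithin (t := C) (fun y hy => by
              have := (add_sum_mem (O := univ) (fun a => (⟨h0.convex, h0.interior_nonempty,
                isOpen_univ, (h a).add_mem, by simp⟩ : LineDomain C univ (e a)))
                ⟨hy, mem_univ _⟩ (fun a => -t a)).1
              simpa [sub_eq_add_neg] using this)
            have h3 : z - ∑ a, t a • e a = x' := by rw [hz]; abel
            rwa [h3] at h2
          filter_upwards [htend.eventually hx', htend.eventually (h0.inter_mem_nhdsWithin hx'W)]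
            with y hy hyW
          have hyW' : y - ∑ a, t a • e a ∈ C ∩ O := hyW
          have h1 := hy (fun a => t a.succ) ⟨a, (le_max_left _ _).trans_lt ha⟩
          have hyW2 : y ∈ C ∩ O := by
            have := add_sum_mem h hyW' t
            rwa [sub_add_cancel] at this
          -- `γ` ignores the `e 0`-component, so the shift by `t 0 • e 0` may be dropped and the
          -- support bound of `γ` in the other directions applies.
          have h2 : γ y = γ (y - ∑ a, t a • e a + ∑ a : Fin (j + 1), t a.succ • e a.succ) := by
            refine hγeq _ hyW2 _ (add_sum_mem (fun a => h a.succ) hyW' _) ?_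
            have h3 : y = y - ∑ a, t a • e a + ∑ a : Fin (j + 1), t a.succ • e a.succ +
                t 0 • e 0 := by
              rw [Fin.sum_univ_succ]
              abel
            have h4 : q' (e 0) = 0 := by rw [hq'x, hqe, hℓ00]; simp
            conv_lhs => rw [h3]
            rw [map_add, map_smul, h4, smul_zero, add_zero]
          rw [h2, h1, smul_zero]
        · refine hzero ?_
          have h1 : ℓ 0 z < 0 := by
            have := (le_max_right R (|ℓ 0 x| + 2))
            rw [hℓz]
            linarith
          filter_upwards [hcontz.eventually (Iio_mem_nhds h1)] with y hy
          have : θ y = 0 := Real.smoothTransition.zero_of_nonpos (le_of_lt hy)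
          rw [this, zero_smul]
      · have h1 : 1 < ℓ 0 z := by
          have := (le_max_right R (|ℓ 0 x| + 2))
          rw [hℓz]
          linarith
        change _ = I z
        rw [← hγd z hzW]
        refine Filter.EventuallyEq.extDerivWithin_eq_of_mem ?_ hzW.1
        filter_upwards [hcontz.eventually (Ioi_mem_nhds h1)] with y hy
        have : θ y = 1 := Real.smoothTransition.one_of_one_le (le_of_lt hy)
        rw [this, one_smul]

end Primitive

/-! ### Thom forms on trivial bundles over convex sets -/

section Flat

variable {B : Type*} [NormedAddCommGroup B] [NormedSpace ℝ B] {k r : ℕ}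

/-- Over the part `u` of the convex set `Q`, the form `α` on the trivial bundle of rank `r` is
smooth and closed with bounded support in the fibre directions. -/
structure IsFlatForm (Q u : Set B)
    (α : B × EuclideanSpace ℝ (Fin r) → (B × EuclideanSpace ℝ (Fin r)) [⋀^Fin k]→L[ℝ] ℝ) :
    Prop where
  smooth : ContDiffOn ℝ ∞ α ((Q ×ˢ univ) ∩ (u ×ˢ univ))
  closed : ∀ z ∈ (Q ×ˢ univ) ∩ (u ×ˢ univ), extDerivWithin α (Q ×ˢ univ) z = 0
  support : ∀ x ∈ Q ∩ u, ∃ R : ℝ, ∀ᶠ x' in 𝓝[Q] x, ∀ y, R < ‖y‖ → α (x', y) = 0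

/-- The integral of an `r`-form over the fibre at `x` of the trivial bundle of rank `r`. -/
def flatInt (α : B × EuclideanSpace ℝ (Fin r) → (B × EuclideanSpace ℝ (Fin r)) [⋀^Fin r]→L[ℝ] ℝ)
    (x : B) : ℝ :=
  ∫ y : EuclideanSpace ℝ (Fin r), α (x, y) fun j => (0, EuclideanSpace.single j 1)

/-- The identity of the fibre times a linear map of the base. -/
def baseMap (r : ℕ) (L : B →L[ℝ] B) :
    B × EuclideanSpace ℝ (Fin r) →L[ℝ] B × EuclideanSpace ℝ (Fin r) :=
  L.prodMap (ContinuousLinearMap.id ℝ _)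

@[simp]
theorem baseMap_apply (L : B →L[ℝ] B) (z : B × EuclideanSpace ℝ (Fin r)) :
    baseMap r L z = (L z.1, z.2) := rfl

variable {Q u : Set B}

theorem convex_prod_univ (hQ : Convex ℝ Q) :
    Convex ℝ (Q ×ˢ (univ : Set (EuclideanSpace ℝ (Fin r)))) := hQ.prod convex_univ

theorem interior_prod_univ_nonempty (hi : (interior Q).Nonempty) :
    (interior (Q ×ˢ (univ : Set (EuclideanSpace ℝ (Fin r))))).Nonempty := by
  rw [interior_prod_eq, interior_univ]
  exact hi.prod univ_nonempty

theorem isOpen_prod_univ (hu : IsOpen u) :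
    IsOpen (u ×ˢ (univ : Set (EuclideanSpace ℝ (Fin r)))) := hu.prod isOpen_univ

theorem extDerivWithin_sub_of_differentiable {V : Type*} [NormedAddCommGroup V] [NormedSpace ℝ V]
    {α β : V → V [⋀^Fin k]→L[ℝ] ℝ} {s : Set V} {x : V} (hs : UniqueDiffWithinAt ℝ s x)
    (hα : DifferentiableWithinAt ℝ α s x) (hβ : DifferentiableWithinAt ℝ β s x) :
    extDerivWithin (fun x => α x - β x) s x = extDerivWithin α s x - extDerivWithin β s x := by
  simp only [extDerivWithin]
  rw [fderivWithin_fun_sub hs hα hβ]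
  exact map_sub (ContinuousAlternatingMap.alternatizeUncurryFinCLM ℝ V ℝ) _ _

theorem extDerivWithin_zero {V : Type*} [NormedAddCommGroup V] [NormedSpace ℝ V]
    {s : Set V} {x : V} : extDerivWithin (fun _ => (0 : V [⋀^Fin k]→L[ℝ] ℝ)) s x = 0 := by
  simp only [extDerivWithin, fderivWithin_fun_const, Pi.zero_apply]
  exact map_zero (ContinuousAlternatingMap.alternatizeUncurryFinCLM ℝ V ℝ)

section Ops

variable {α β : B × EuclideanSpace ℝ (Fin r) → (B × EuclideanSpace ℝ (Fin r)) [⋀^Fin k]→L[ℝ] ℝ}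

theorem IsFlatForm.differentiableWithinAt (hu : IsOpen u) (hα : IsFlatForm Q u α)
    {z : B × EuclideanSpace ℝ (Fin r)} (hz : z ∈ (Q ×ˢ univ) ∩ (u ×ˢ univ)) :
    DifferentiableWithinAt ℝ α (Q ×ˢ univ) z :=
  (ContDiffOn.hasFDerivWithinAt_of_convex (isOpen_prod_univ hu) hα.smooth hz).differentiableWithinAt

theorem IsFlatForm.add (hQ : Convex ℝ Q) (hi : (interior Q).Nonempty) (hu : IsOpen u)
    (hα : IsFlatForm Q u α) (hβ : IsFlatForm Q u β) : IsFlatForm Q u (fun z => α z + β z) := by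
  refine ⟨hα.smooth.add hβ.smooth, fun z hz => ?_, fun x hx => ?_⟩
  · rw [extDerivWithin_fun_add (uniqueDiffOn_convex (convex_prod_univ hQ)
      (interior_prod_univ_nonempty hi) z hz.1) (hα.differentiableWithinAt hu hz)
      (hβ.differentiableWithinAt hu hz), hα.closed z hz, hβ.closed z hz, add_zero]
  · obtain ⟨R₁, h1⟩ := hα.support x hx
    obtain ⟨R₂, h2⟩ := hβ.support x hx
    refine ⟨max R₁ R₂, ?_⟩
    filter_upwards [h1, h2] with x' h1 h2 y hy
    rw [h1 y ((le_max_left _ _).trans_lt hy), h2 y ((le_max_right _ _).trans_lt hy), add_zero]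

theorem IsFlatForm.sub (hQ : Convex ℝ Q) (hi : (interior Q).Nonempty) (hu : IsOpen u)
    (hα : IsFlatForm Q u α) (hβ : IsFlatForm Q u β) : IsFlatForm Q u (fun z => α z - β z) := by
  refine ⟨hα.smooth.sub hβ.smooth, fun z hz => ?_, fun x hx => ?_⟩
  · rw [extDerivWithin_sub_of_differentiable (uniqueDiffOn_convex (convex_prod_univ hQ)
      (interior_prod_univ_nonempty hi) z hz.1) (hα.differentiableWithinAt hu hz)
      (hβ.differentiableWithinAt hu hz), hα.closed z hz, hβ.closed z hz, sub_zero]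
  · obtain ⟨R₁, h1⟩ := hα.support x hx
    obtain ⟨R₂, h2⟩ := hβ.support x hx
    refine ⟨max R₁ R₂, ?_⟩
    filter_upwards [h1, h2] with x' h1 h2 y hy
    rw [h1 y ((le_max_left _ _).trans_lt hy), h2 y ((le_max_right _ _).trans_lt hy), sub_zero]

theorem IsFlatForm.pullback (hQ : Convex ℝ Q) (hi : (interior Q).Nonempty) (hu : IsOpen u)
    (hα : IsFlatForm Q u α) {L : B →L[ℝ] B} {c : B} (hLQ : ∀ x ∈ Q, L x + c ∈ Q)
    (hLu : ∀ x ∈ Q ∩ u, L x + c ∈ u) :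
    IsFlatForm Q u (fun z => (α (L z.1 + c, z.2)).compContinuousLinearMap (baseMap r L)) := by
  have heq : ∀ z : B × EuclideanSpace ℝ (Fin r), (L z.1 + c, z.2) = baseMap r L z + (c, 0) := by
    intro z; simp
  refine ⟨fun z hz => ?_, fun z hz => ?_, fun x hx => ?_⟩
  · refine ContDiffWithinAt.compContinuousLinearMap_alternating ?_ contDiffWithinAt_const
    refine ContDiffWithinAt.comp z (hα.smooth (L z.1 + c, z.2)
      ⟨⟨hLQ _ hz.1.1, mem_univ _⟩, ⟨hLu _ ⟨hz.1.1, hz.2.1⟩, mem_univ _⟩⟩) (by fun_prop) ?_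
    intro y hy
    exact ⟨⟨hLQ _ hy.1.1, mem_univ _⟩, ⟨hLu _ ⟨hy.1.1, hy.2.1⟩, mem_univ _⟩⟩
  · simp only [heq]
    have hm : baseMap r L z + (c, 0) ∈ (Q ×ˢ univ) ∩ (u ×ˢ univ) := by
      rw [← heq]
      exact ⟨⟨hLQ _ hz.1.1, mem_univ _⟩, ⟨hLu _ ⟨hz.1.1, hz.2.1⟩, mem_univ _⟩⟩
    rw [extDerivWithin_comp_affine (convex_prod_univ hQ) (interior_prod_univ_nonempty hi)
      (isOpen_prod_univ hu) (fun y hy => by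
        rw [← heq]
        exact ⟨hLQ _ hy.1, mem_univ _⟩) hα.smooth hz.1 hm.2, hα.closed _ hm]
    exact map_zero (ContinuousAlternatingMap.compContinuousLinearMapCLM (𝕜 := ℝ) (F := ℝ)
        (ι := Fin (k + 1)) (baseMap r L))
  · obtain ⟨R, hR⟩ := hα.support (L x + c) ⟨hLQ _ hx.1, hLu _ hx⟩
    refine ⟨R, ?_⟩
    have hcont : ContinuousWithinAt (fun x => L x + c) Q x := by fun_prop
    filter_upwards [(hcont.tendsto_nhdsWithin hLQ).eventually hR] with x' hx' y hy
    simp only [hx' y hy]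
    exact map_zero (ContinuousAlternatingMap.compContinuousLinearMapCLM (𝕜 := ℝ) (F := ℝ)
        (ι := Fin k) (baseMap r L))

end Ops

/-! ### Fibre integrals of flat forms of top degree -/

section TopDegree

variable {α β : B × EuclideanSpace ℝ (Fin r) → (B × EuclideanSpace ℝ (Fin r)) [⋀^Fin r]→L[ℝ] ℝ}

theorem IsFlatForm.integrable (hα : IsFlatForm Q u α) {x : B} (hx : x ∈ Q ∩ u) :
    Integrable fun y : EuclideanSpace ℝ (Fin r) =>
      α (x, y) fun j => (0, EuclideanSpace.single j 1) := by
  obtain ⟨R, hR⟩ := hα.support x hx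
  have hR' := hR.self_of_nhdsWithin hx.1
  have hcont : Continuous fun y : EuclideanSpace ℝ (Fin r) =>
      α (x, y) fun j => ((0 : B), EuclideanSpace.single j (1 : ℝ)) := by
    rw [← continuousOn_univ]
    refine (ContinuousAlternatingMap.apply ℝ (B × EuclideanSpace ℝ (Fin r)) ℝ
      fun j => (0, EuclideanSpace.single j 1)).continuous.comp_continuousOn ?_
    exact hα.smooth.continuousOn.comp (by fun_prop)
      (fun y _ => ⟨⟨hx.1, mem_univ _⟩, ⟨hx.2, mem_univ _⟩⟩)
  refine hcont.integrable_of_hasCompactSupport ?_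
  refine HasCompactSupport.of_support_subset_isCompact
    (isCompact_closedBall (0 : EuclideanSpace ℝ (Fin r)) R) ?_
  intro y hy
  by_contra hcon
  refine hy ?_
  rw [mem_closedBall_zero_iff, not_le] at hcon
  simp only [hR' y hcon]
  rfl

theorem flatInt_add (hα : IsFlatForm Q u α) (hβ : IsFlatForm Q u β) {x : B} (hx : x ∈ Q ∩ u) :
    flatInt (fun z => α z + β z) x = flatInt α x + flatInt β x :=
  integral_add (hα.integrable hx) (hβ.integrable hx)

theorem flatInt_sub (hα : IsFlatForm Q u α) (hβ : IsFlatForm Q u β) {x : B} (hx : x ∈ Q ∩ u) :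
    flatInt (fun z => α z - β z) x = flatInt α x - flatInt β x :=
  integral_sub (hα.integrable hx) (hβ.integrable hx)

theorem flatInt_pullback (α : B × EuclideanSpace ℝ (Fin r) →
    (B × EuclideanSpace ℝ (Fin r)) [⋀^Fin r]→L[ℝ] ℝ) (L : B →L[ℝ] B) (c x : B) :
    flatInt (fun z => (α (L z.1 + c, z.2)).compContinuousLinearMap (baseMap r L)) x =
      flatInt α (L x + c) := by
  unfold flatInt
  refine integral_congr_ae (Eventually.of_forall fun y => ?_)
  simp only [ContinuousAlternatingMap.compContinuousLinearMap_apply]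
  congr 1
  ext j <;> simp

/-- The restriction of forms to the fibres commutes with the exterior derivative. -/
theorem extDerivWithin_comp_inr (hu : IsOpen u)
    {β : B × EuclideanSpace ℝ (Fin r) → (B × EuclideanSpace ℝ (Fin r)) [⋀^Fin k]→L[ℝ] ℝ}
    (hβ : ContDiffOn ℝ ∞ β ((Q ×ˢ univ) ∩ (u ×ˢ univ))) {x : B} (hx : x ∈ Q ∩ u)
    (y : EuclideanSpace ℝ (Fin r)) :
    extDeriv (fun y => (β (x, y)).compContinuousLinearMap
      (ContinuousLinearMap.inr ℝ B (EuclideanSpace ℝ (Fin r)))) y =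
    (extDerivWithin β (Q ×ˢ univ) (x, y)).compContinuousLinearMap
      (ContinuousLinearMap.inr ℝ B (EuclideanSpace ℝ (Fin r))) := by
  have hf : ∀ y : EuclideanSpace ℝ (Fin r), fderiv ℝ (fun y : EuclideanSpace ℝ (Fin r) => (x, y)) y =
      ContinuousLinearMap.inr ℝ B (EuclideanSpace ℝ (Fin r)) := fun y =>
    (hasFDerivAt_prodMk_right x y).fderiv
  have h1 := extDerivWithin_pullback (f := fun y : EuclideanSpace ℝ (Fin r) => (x, y))
    (s := univ) (t := Q ×ˢ univ) (x := y) (r := ∞)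
    (ContDiffOn.hasFDerivWithinAt_of_convex (x := (x, y)) (isOpen_prod_univ hu) hβ
      ⟨⟨hx.1, mem_univ _⟩, ⟨hx.2, mem_univ _⟩⟩).differentiableWithinAt
    (by fun_prop) minSmoothness_two_le uniqueDiffOn_univ (by simp) (mem_univ _)
    (fun y _ => ⟨hx.1, mem_univ _⟩)
  simpa only [fderivWithin_univ, hf, extDerivWithin_univ] using h1

/-- Coordinates on `ℝʳ` preserve volume, and the fibre component of the base point `z` is removed by
translation. This links the integrals of the Poincaré lemma to `flatInt`. -/
theorem integral_fibre_eq_flatInt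
    (α : B × EuclideanSpace ℝ (Fin r) → (B × EuclideanSpace ℝ (Fin r)) [⋀^Fin r]→L[ℝ] ℝ)
    (z : B × EuclideanSpace ℝ (Fin r)) :
    ∫ t : Fin r → ℝ, α (z + ∑ a, t a • ((0 : B), EuclideanSpace.single a (1 : ℝ)))
      (fun j => (0, EuclideanSpace.single j 1)) = flatInt α z.1 := by
  unfold flatInt
  rw [← integral_add_left_eq_self _ z.2]
  have hmp := PiLp.volume_preserving_toLp (Fin r)
  have he := (MeasurableEquiv.toLp 2 (Fin r → ℝ)).measurableEmbedding
  rw [← hmp.integral_comp he]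
  refine integral_congr_ae (Eventually.of_forall fun t => ?_)
  have h1 : z + ∑ a, t a • ((0 : B), EuclideanSpace.single a (1 : ℝ)) =
      (z.1, z.2 + WithLp.toLp 2 t) := by
    ext
    · simp [Prod.fst_sum]
    · simp [Prod.snd_sum, Finset.sum_apply, Pi.single_apply]
  simp only [h1]

end TopDegree

/-- A crude triangle inequality, sufficient to turn the boxes of `FibreSupport` into the balls of
`IsFlatForm`. -/
theorem norm_le_of_coord_le {R : ℝ} (y : EuclideanSpace ℝ (Fin r)) (h : ∀ a, |y a| ≤ R) :
    ‖y‖ ≤ r * R := by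
  have h1 : y = ∑ a, y a • EuclideanSpace.single a (1 : ℝ) := by
    ext i
    simp [Finset.sum_apply, Pi.single_apply]
  rw [h1]
  refine (norm_sum_le _ _).trans ?_
  have : ∀ a ∈ Finset.univ, ‖y a • EuclideanSpace.single a (1 : ℝ)‖ ≤ R := fun a _ => by
    simpa [norm_smul] using h a
  simpa using Finset.sum_le_card_nsmul _ _ _ this

theorem lineDomain_fibre (hQ : Convex ℝ Q) (hi : (interior Q).Nonempty) (hu : IsOpen u)
    (a : Fin r) : LineDomain (Q ×ˢ univ) (u ×ˢ univ)
      ((0 : B), EuclideanSpace.single a (1 : ℝ)) where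
  convex := convex_prod_univ hQ
  interior_nonempty := interior_prod_univ_nonempty hi
  isOpen := isOpen_prod_univ hu
  add_mem := fun x hx t => by simpa using hx
  add_mem_open := fun x hx t => by simpa using hx

theorem sum_smul_fibre (t : Fin r → ℝ) :
    ∑ a, t a • ((0 : B), EuclideanSpace.single a (1 : ℝ)) = (0, WithLp.toLp 2 t) := by
  ext
  · simp [Prod.fst_sum]
  · simp [Prod.snd_sum, Finset.sum_apply, Pi.single_apply]

/-- Let `α` be a flat form of top degree whose integrals over the fibres vanish. Multiplying its
primitive by a function `ρ` on the base gives a closed form that agrees with `α` where `ρ = 1`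
and vanishes where `ρ = 0`, and that vanishes on the submanifolds on which `α` vanishes. -/
theorem IsFlatForm.exists_cutoff (hQ : Convex ℝ Q) (hi : (interior Q).Nonempty) (hu : IsOpen u)
    {α : B × EuclideanSpace ℝ (Fin r) → (B × EuclideanSpace ℝ (Fin r)) [⋀^Fin r]→L[ℝ] ℝ}
    (hα : IsFlatForm Q u α) (hint : ∀ x ∈ Q ∩ u, flatInt α x = 0) {ρ : B → ℝ}
    (hρ : ContDiff ℝ ∞ ρ) :
    ∃ η : B × EuclideanSpace ℝ (Fin r) → (B × EuclideanSpace ℝ (Fin r)) [⋀^Fin r]→L[ℝ] ℝ,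
      IsFlatForm Q u η ∧ (∀ x ∈ Q ∩ u, flatInt η x = 0) ∧
      (∀ x ∈ Q ∩ u, (∀ᶠ x' in 𝓝[Q] x, ρ x' = 1) → ∀ y, η (x, y) = α (x, y)) ∧
      (∀ x ∈ Q ∩ u, (∀ᶠ x' in 𝓝[Q] x, ρ x' = 0) → ∀ y, η (x, y) = 0) ∧
      ∀ (L : B →L[ℝ] B) (c : B), AffineRetraction Q L c →
        (∀ x ∈ Q ∩ u, L x + c = x → ∀ y,
          (α (x, y)).compContinuousLinearMap (baseMap r L) = 0) →
        (∀ x ∈ Q ∩ u, L x + c = x → ∀ y,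
          (η (x, y)).compContinuousLinearMap (baseMap r L) = 0) := by
  have hCO : ∀ {x : B} (_ : x ∈ Q ∩ u) (y : EuclideanSpace ℝ (Fin r)),
      (x, y) ∈ (Q ×ˢ univ) ∩ (u ×ˢ univ) := fun hx y =>
    ⟨⟨hx.1, mem_univ _⟩, ⟨hx.2, mem_univ _⟩⟩
  rcases r with _ | j
  -- In rank 0 the fibre is a point and the integral is the value, so `α` vanishes and is its own
  -- cut-off.
  · have hα0 : ∀ x ∈ Q ∩ u, ∀ y, α (x, y) = 0 := by
      intro x hx y
      have h1 := hint x hx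
      unfold flatInt at h1
      have h2 : (fun y' : EuclideanSpace ℝ (Fin 0) => α (x, y')
          fun j => ((0 : B), EuclideanSpace.single j (1 : ℝ))) = fun _ => α (x, y) fun j =>
            ((0 : B), EuclideanSpace.single j (1 : ℝ)) := by
        ext y'
        rw [Subsingleton.elim y' y]
      rw [h2, volume_euclideanSpace_eq_dirac, integral_dirac] at h1
      ext v
      rw [Subsingleton.elim v fun j => ((0 : B), EuclideanSpace.single j (1 : ℝ)), h1]
      rfl
    refine ⟨α, hα, hint, fun _ _ _ _ => rfl, fun x hx _ y => hα0 x hx y, fun L c _ h => h⟩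
  · set Z := EuclideanSpace ℝ (Fin (j + 1))
    set C : Set (B × EuclideanSpace ℝ (Fin (j + 1))) := Q ×ˢ univ
    set O : Set (B × EuclideanSpace ℝ (Fin (j + 1))) := u ×ˢ univ
    have hC : Convex ℝ C := convex_prod_univ hQ
    have hCi : (interior C).Nonempty := interior_prod_univ_nonempty hi
    have hO : IsOpen O := isOpen_prod_univ hu
    set e : Fin (j + 1) → B × EuclideanSpace ℝ (Fin (j + 1)) := fun a => ((0 : B), EuclideanSpace.single a (1 : ℝ)) with he
    have hes : ∀ t : Fin (j + 1) → ℝ, ∑ a, t a • e a = (0, WithLp.toLp 2 t) := sum_smul_fibre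
    have hfs : FibreSupport C O e α := by
      rintro ⟨x, y⟩ hz
      obtain ⟨R, hR⟩ := hα.support x ⟨hz.1.1, hz.2.1⟩
      refine ⟨R + ‖y‖ + 1, ?_⟩
      have h1 : Tendsto (Prod.fst : B × EuclideanSpace ℝ (Fin (j + 1)) → B) (𝓝[C] (x, y)) (𝓝[Q] x) :=
        continuousWithinAt_fst.tendsto_nhdsWithin fun z hz => hz.1
      have h2 : ∀ᶠ z in 𝓝[C] (x, y), ‖z.2‖ < ‖y‖ + 1 := by
        have : ContinuousWithinAt (fun z : B × EuclideanSpace ℝ (Fin (j + 1)) => ‖z.2‖) C (x, y) := by fun_prop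
        exact this.eventually (Iio_mem_nhds (by simp))
      filter_upwards [h1.eventually hR, h2] with z hz1 hz2 t ⟨a, ha⟩
      rw [hes]
      have h3 : z + ((0 : B), WithLp.toLp 2 t) = (z.1, z.2 + WithLp.toLp 2 t) := by
        ext <;> simp
      rw [h3]
      refine hz1 _ ?_
      have h4 : |t a| ≤ ‖(WithLp.toLp 2 t : EuclideanSpace ℝ (Fin (j + 1)))‖ := by
        have := PiLp.norm_apply_le (WithLp.toLp 2 t : EuclideanSpace ℝ (Fin (j + 1))) a
        simpa using this
      have h5 := norm_sub_le (z.2 + (WithLp.toLp 2 t : EuclideanSpace ℝ (Fin (j + 1)))) z.2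
      rw [add_sub_cancel_left] at h5
      linarith
    -- With the identity as projection, being basic is an empty condition.
    obtain ⟨β, hβc, hβd, hβs, -, hβv⟩ := exists_primitive_of_integral_eq_zero (C := C) (O := O) j e
      (fun a => (EuclideanSpace.proj a).comp (ContinuousLinearMap.snd ℝ B (EuclideanSpace ℝ (Fin (j + 1)))))
      (ContinuousLinearMap.id ℝ _) (fun a => lineDomain_fibre hQ hi hu a)
      (fun a b => by simp [he, PiLp.single_apply]) (fun x hx => hx) (fun x hx => hx) (fun _ => rfl)
      (fun _ _ => rfl) (fun _ => rfl) α hα.smooth hα.closed hfs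
      (fun x _ => by ext v; rfl)
      (fun z hz => by
        have := integral_fibre_eq_flatInt α z
        rw [hint z.1 ⟨hz.1.1, hz.2.1⟩] at this
        exact this)
    have hρ' : ContDiff ℝ ∞ fun z : B × EuclideanSpace ℝ (Fin (j + 1)) => ρ z.1 := hρ.comp contDiff_fst
    have hρβ : ContDiffOn ℝ ∞ (fun z => ρ z.1 • β z) (C ∩ O) := hρ'.contDiffOn.smul hβc
    -- On a fibre `ρ` is constant, so `d(ρβ)` restricts to `ρ(x)` times the restriction of `dβ = α`.
    -- The term `dρ ∧ β` contributes nothing to fibre integrals.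
    have hηinr : ∀ x ∈ Q ∩ u, ∀ y,
        (extDerivWithin (fun z => ρ z.1 • β z) C (x, y)).compContinuousLinearMap
          (ContinuousLinearMap.inr ℝ B (EuclideanSpace ℝ (Fin (j + 1)))) =
        ρ x • (α (x, y)).compContinuousLinearMap (ContinuousLinearMap.inr ℝ B (EuclideanSpace ℝ (Fin (j + 1)))) := by
      intro x hx y
      rw [← extDerivWithin_comp_inr hu hρβ hx y, ← hβd _ (hCO hx y),
        ← extDerivWithin_comp_inr hu hβc hx y]
      exact extDeriv_smul (ρ x) fun y => (β (x, y)).compContinuousLinearMap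
        (ContinuousLinearMap.inr ℝ B (EuclideanSpace ℝ (Fin (j + 1))))
    have hfst : ∀ x y, Tendsto (Prod.fst : B × EuclideanSpace ℝ (Fin (j + 1)) → B) (𝓝[C] (x, y)) (𝓝[Q] x) := fun x y =>
      continuousWithinAt_fst.tendsto_nhdsWithin fun z hz => hz.1
    refine ⟨extDerivWithin (fun z => ρ z.1 • β z) C,
      ⟨contDiffOn_extDerivWithin hC hCi hO hρβ, fun z hz =>
        extDerivWithin_extDerivWithin_of_convex hC hCi hO hρβ hz, ?_⟩, ?_, ?_, ?_, ?_⟩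
    · intro x hx
      -- The bound at the zero vector covers the whole fibre, because the translations by fibre
      -- vectors reach every point of it.
      obtain ⟨R, hR⟩ := hβs (x, 0) (hCO hx 0)
      have h1 : Tendsto (fun x' : B => (x', (0 : EuclideanSpace ℝ (Fin (j + 1))))) (𝓝[Q] x) (𝓝[C] (x, 0)) := by
        have : ContinuousWithinAt (fun x' : B => (x', (0 : EuclideanSpace ℝ (Fin (j + 1))))) Q x := by fun_prop
        exact this.tendsto_nhdsWithin fun z hz => ⟨hz, mem_univ _⟩
      have h2 : ∀ᶠ x' in 𝓝[Q] x, ∀ y : EuclideanSpace ℝ (Fin (j + 1)), (↑(j + 1) : ℝ) * R < ‖y‖ → β (x', y) = 0 := by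
        filter_upwards [h1.eventually hR] with x' hx' y hy
        have h3 := hx' (fun a => y a) (by
          by_contra! hcon
          exact absurd (norm_le_of_coord_le y hcon) (not_le.2 hy))
        rw [hes] at h3
        have h4 : ((x', (0 : EuclideanSpace ℝ (Fin (j + 1)))) + (0, WithLp.toLp 2 fun a => y a) : B × EuclideanSpace ℝ (Fin (j + 1))) = (x', y) := by
          ext <;> simp
        rwa [h4] at h3
      refine ⟨(↑(j + 1) : ℝ) * R, ?_⟩
      filter_upwards [eventually_eventually_nhdsWithin.2 h2, self_mem_nhdsWithin] with x' hx' hx'Q y hy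
      have h3 : (fun z : B × EuclideanSpace ℝ (Fin (j + 1)) => ρ z.1 • β z) =ᶠ[𝓝[C] (x', y)] fun _ => 0 := by
        have h4 : ∀ᶠ z : B × EuclideanSpace ℝ (Fin (j + 1)) in 𝓝[C] (x', y), (↑(j + 1) : ℝ) * R < ‖z.2‖ := by
          have : ContinuousWithinAt (fun z : B × EuclideanSpace ℝ (Fin (j + 1)) => ‖z.2‖) C (x', y) := by fun_prop
          exact this.eventually (Ioi_mem_nhds hy)
        filter_upwards [(hfst x' y).eventually hx', h4] with z hz hz'
        rw [hz z.2 hz', smul_zero]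
      rw [h3.extDerivWithin_eq_of_mem ⟨hx'Q, mem_univ _⟩, extDerivWithin_zero]
    · intro x hx
      have h1 : flatInt (extDerivWithin (fun z => ρ z.1 • β z) C) x = ρ x * flatInt α x := by
        unfold flatInt
        rw [← integral_const_mul]
        refine integral_congr_ae (Eventually.of_forall fun y => ?_)
        have := congrArg (fun A => A fun j => EuclideanSpace.single j (1 : ℝ)) (hηinr x hx y)
        exact this
      rw [h1, hint x hx, mul_zero]
    · intro x hx hρ1 y
      rw [← hβd _ (hCO hx y)]
      refine Filter.EventuallyEq.extDerivWithin_eq_of_mem ?_ ⟨hx.1, mem_univ _⟩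
      filter_upwards [(hfst x y).eventually hρ1] with z hz
      rw [hz, one_smul]
    · intro x hx hρ0 y
      have h3 : (fun z : B × EuclideanSpace ℝ (Fin (j + 1)) => ρ z.1 • β z) =ᶠ[𝓝[C] (x, y)] fun _ => 0 := by
        filter_upwards [(hfst x y).eventually hρ0] with z hz
        rw [hz, zero_smul]
      rw [h3.extDerivWithin_eq_of_mem ⟨hx.1, mem_univ _⟩, extDerivWithin_zero]
    · intro L c hL hv x hx hxL y
      -- The retraction of the base times the identity fixes the fibre directions, as the Poincaré
      -- lemma requires.
      have hL' : AffineRetraction C (baseMap (j + 1) L) (c, 0) := by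
        refine ⟨fun z hz => ⟨by simpa using hL.mem z.1 hz.1, mem_univ _⟩, fun z => ?_⟩
        have := hL.idem z.1
        ext <;> simp_all
      have hvan : VanishesOn C O (baseMap (j + 1) L) (c, 0) α := by
        rintro ⟨x', y'⟩ hz hz'
        refine hv x' ⟨hz.1.1, hz.2.1⟩ ?_ y'
        simpa using congrArg Prod.fst hz'
      have hβ' := hβv _ _ hL' (fun a => by simp [he]) hvan
      refine VanishesOn.extDerivWithin hC hCi hO hL' hρβ (fun z hz hzL => ?_) (x, y) (hCO hx y)
        (by simp [hxL])
      change ρ z.1 • (β z).compContinuousLinearMap _ = 0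
      rw [hβ' z hz hzL, smul_zero]

end Flat

/-! ### Extension of Thom forms from coordinate subspaces -/

section FlatExtension

variable {B : Type*} [NormedAddCommGroup B] [NormedSpace ℝ B] {r : ℕ} {Q u : Set B}

variable (r) in
/-- The volume form of `ℝʳ`. -/
def fibreVolume : EuclideanSpace ℝ (Fin r) [⋀^Fin r]→L[ℝ] ℝ :=
  { (EuclideanSpace.basisFun (Fin r) ℝ).toBasis.det with
    cont := by
      change Continuous fun v : Fin r → EuclideanSpace ℝ (Fin r) =>
        (EuclideanSpace.basisFun (Fin r) ℝ).toBasis.det v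
      simp only [Module.Basis.det_apply]
      refine Continuous.matrix_det (continuous_pi fun i => continuous_pi fun j => ?_)
      simp only [Module.Basis.toMatrix_apply, OrthonormalBasis.coe_toBasis_repr_apply,
        EuclideanSpace.basisFun_repr]
      fun_prop }

theorem fibreVolume_single :
    fibreVolume r (fun j => EuclideanSpace.single j (1 : ℝ)) = 1 := by
  have h := (EuclideanSpace.basisFun (Fin r) ℝ).toBasis.det_self
  have h2 : ⇑(EuclideanSpace.basisFun (Fin r) ℝ).toBasis =
      fun j => EuclideanSpace.single j (1 : ℝ) := by
    ext j
    simp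
  rw [h2] at h
  exact h

theorem eq_zero_of_degree_gt (A : EuclideanSpace ℝ (Fin r) [⋀^Fin (r + 1)]→L[ℝ] ℝ) : A = 0 := by
  ext v
  refine AlternatingMap.map_linearDependent A.toAlternatingMap v fun h => ?_
  have := h.fintype_card_le_finrank
  simp at this

/-- The product Thom form on the trivial bundle. -/
theorem exists_product_flatForm (hQ : Convex ℝ Q) (hi : (interior Q).Nonempty) (ε : ℝ) :
    ∃ σ : B × EuclideanSpace ℝ (Fin r) → (B × EuclideanSpace ℝ (Fin r)) [⋀^Fin r]→L[ℝ] ℝ,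
      IsFlatForm Q u σ ∧ ∀ x, flatInt σ x = ε := by
  -- The volume form times a bump function of integral `ε`, pulled back from the fibre.
  let f : ContDiffBump (0 : EuclideanSpace ℝ (Fin r)) := ⟨1, 2, by norm_num, by norm_num⟩
  let g : EuclideanSpace ℝ (Fin r) → EuclideanSpace ℝ (Fin r) [⋀^Fin r]→L[ℝ] ℝ :=
    fun y => (ε * f.normed volume y) • fibreVolume r
  have hg : ContDiff ℝ ∞ g := (contDiff_const.mul f.contDiff_normed).smul contDiff_const
  refine ⟨fun z => (g z.2).compContinuousLinearMap (ContinuousLinearMap.snd ℝ B _),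
    ⟨fun z _ => ?_, fun z hz => ?_, fun x _ => ⟨2, ?_⟩⟩, fun x => ?_⟩
  · exact ContDiffWithinAt.compContinuousLinearMap_alternating
      (hg.comp contDiff_snd).contDiffWithinAt contDiffWithinAt_const
  · have hu := uniqueDiffOn_convex (convex_prod_univ (r := r) hQ) (interior_prod_univ_nonempty hi)
    have h1 := extDerivWithin_pullback
      (f := (Prod.snd : B × EuclideanSpace ℝ (Fin r) → _)) (t := univ) (x := z) (r := ∞)
      (hg.differentiable (by simp) z.2).differentiableWithinAt contDiffWithinAt_snd
      minSmoothness_two_le hu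
      (mem_closure_interior_of_convex (convex_prod_univ hQ) (interior_prod_univ_nonempty hi) hz.1)
      hz.1 (fun _ _ => mem_univ _)
    -- Closed for reasons of degree: an `(r + 1)`-form on `ℝʳ` is zero.
    rw [eq_zero_of_degree_gt (extDerivWithin g univ z.2)] at h1
    refine Eq.trans ?_ (h1.trans (map_zero
      (ContinuousAlternatingMap.compContinuousLinearMapCLM (𝕜 := ℝ) (F := ℝ)
        (ι := Fin (r + 1)) _)))
    refine extDerivWithin_congr (fun y hy => ?_) ?_
    · rw [fderivWithin_snd (hu y hy)]
    · rw [fderivWithin_snd (hu z hz.1)]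
  · refine Eventually.of_forall fun x' y hy => ?_
    have : f.normed volume y = 0 := by
      rw [← Function.notMem_support, f.support_normed_eq, mem_ball_zero_iff, not_lt]
      exact hy.le
    simp only [g, this, mul_zero, zero_smul]
    rfl
  · have h1 : ∀ y : EuclideanSpace ℝ (Fin r), (g y).compContinuousLinearMap
        (ContinuousLinearMap.snd ℝ B (EuclideanSpace ℝ (Fin r)))
        (fun j => ((0 : B), EuclideanSpace.single j (1 : ℝ))) = ε * f.normed volume y := by
      intro y
      have : (g y).compContinuousLinearMap
        (ContinuousLinearMap.snd ℝ B (EuclideanSpace ℝ (Fin r)))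
        (fun j => ((0 : B), EuclideanSpace.single j (1 : ℝ))) = (ε * f.normed volume y) *
          fibreVolume r (fun j => EuclideanSpace.single j (1 : ℝ)) := rfl
      rw [this, fibreVolume_single, mul_one]
    simp only [flatInt, h1]
    rw [integral_const_mul, f.integral_normed, mul_one]

theorem compContinuousLinearMap_baseMap_comp {k : ℕ}
    (A : (B × EuclideanSpace ℝ (Fin r)) [⋀^Fin k]→L[ℝ] ℝ) (L L' : B →L[ℝ] B) :
    (A.compContinuousLinearMap (baseMap r L)).compContinuousLinearMap (baseMap r L') =
      A.compContinuousLinearMap (baseMap r (L.comp L')) := rfl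

/-- Thom forms on coordinate subspaces that agree on the intersections have a common extension. -/
theorem exists_flat_extension (hQ : Convex ℝ Q) (hi : (interior Q).Nonempty) (hu : IsOpen u)
    {ι : Type*} (s : Finset ι) (L : ι → B →L[ℝ] B) (c : ι → B)
    (t : ι → B × EuclideanSpace ℝ (Fin r) → (B × EuclideanSpace ℝ (Fin r)) [⋀^Fin r]→L[ℝ] ℝ)
    (ε : ℝ) (hL : ∀ i ∈ s, AffineRetraction Q (L i) (c i))
    (hLu : ∀ i ∈ s, ∀ x ∈ Q ∩ u, L i x + c i ∈ u)
    (hcomm : ∀ i ∈ s, ∀ j ∈ s, ∀ x, L i (L j x + c j) + c i = L j (L i x + c i) + c j)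
    (ht : ∀ i ∈ s, IsFlatForm Q u fun z =>
      (t i (L i z.1 + c i, z.2)).compContinuousLinearMap (baseMap r (L i)))
    (hint : ∀ i ∈ s, ∀ x ∈ Q ∩ u, flatInt (fun z =>
      (t i (L i z.1 + c i, z.2)).compContinuousLinearMap (baseMap r (L i))) x = ε)
    (hcompat : ∀ i ∈ s, ∀ j ∈ s, ∀ x ∈ Q ∩ u, L i x + c i = x → L j x + c j = x → ∀ y,
      (t i (x, y)).compContinuousLinearMap (baseMap r ((L i).comp (L j))) =
        (t j (x, y)).compContinuousLinearMap (baseMap r ((L i).comp (L j)))) :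
    ∃ σ : B × EuclideanSpace ℝ (Fin r) → (B × EuclideanSpace ℝ (Fin r)) [⋀^Fin r]→L[ℝ] ℝ,
      IsFlatForm Q u σ ∧ (∀ x ∈ Q ∩ u, flatInt σ x = ε) ∧
      ∀ i ∈ s, ∀ x ∈ Q ∩ u, L i x + c i = x → ∀ y,
        (σ (x, y)).compContinuousLinearMap (baseMap r (L i)) =
          (t i (x, y)).compContinuousLinearMap (baseMap r (L i)) := by
  classical
  induction s using Finset.induction_on with
  | empty =>
    obtain ⟨σ, h1, h2⟩ := exists_product_flatForm (r := r) (u := u) hQ hi ε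
    exact ⟨σ, h1, fun x _ => h2 x, by simp⟩
  | insert i s his ih =>
    obtain ⟨σ, hσ, hσi, hσt⟩ := ih (fun j hj => hL j (Finset.mem_insert_of_mem hj))
      (fun j hj => hLu j (Finset.mem_insert_of_mem hj))
      (fun j hj l hl => hcomm j (Finset.mem_insert_of_mem hj) l (Finset.mem_insert_of_mem hl))
      (fun j hj => ht j (Finset.mem_insert_of_mem hj))
      (fun j hj => hint j (Finset.mem_insert_of_mem hj))
      (fun j hj l hl => hcompat j (Finset.mem_insert_of_mem hj) l (Finset.mem_insert_of_mem hl))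
    have hi' := Finset.mem_insert_self i s
    have hpull := hσ.pullback hQ hi hu (L := L i) (c := c i) (hL i hi').mem (hLu i hi')
    -- The linear parts commute because the affine maps do; compare the affine identity at `x` with
    -- that at 0.
    have hLcomm : ∀ j ∈ insert i s, (L i).comp (L j) = (L j).comp (L i) := by
      intro j hj
      ext x
      have h1 := hcomm i hi' j hj x
      have h0 := hcomm i hi' j hj 0
      simp only [map_add, map_zero, zero_add] at h1 h0
      simp only [ContinuousLinearMap.comp_apply]
      have h2 : L i (L j x) + (L i (c j) + c i) = L j (L i x) + (L j (c i) + c j) := by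
        rw [← add_assoc, ← add_assoc, h1]
      rw [h0] at h2
      exact add_right_cancel h2
    have hidem : (L i).comp (L i) = L i := by
      ext x
      have h1 := (hL i hi').idem x
      have h0 := (hL i hi').idem 0
      simp only [map_add, map_zero, zero_add] at h1 h0
      simp only [ContinuousLinearMap.comp_apply]
      have h2 : L i (L i x) + (L i (c i) + c i) = L i x + c i := by rw [← add_assoc, h1]
      rw [h0] at h2
      exact add_right_cancel h2
    -- With `A_i` the `i`-th retraction, the new form is `σ + A_i^*(t_i - σ)`.
    refine ⟨fun z => σ z + ((t i (L i z.1 + c i, z.2)).compContinuousLinearMap (baseMap r (L i)) -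
      (σ (L i z.1 + c i, z.2)).compContinuousLinearMap (baseMap r (L i))),
      hσ.add hQ hi hu ((ht i hi').sub hQ hi hu hpull), ?_, ?_⟩
    · intro x hx
      rw [flatInt_add hσ ((ht i hi').sub hQ hi hu hpull) hx, flatInt_sub (ht i hi') hpull hx,
        hint i hi' x hx, flatInt_pullback, hσi x hx,
        hσi _ ⟨(hL i hi').mem x hx.1, hLu i hi' x hx⟩]
      ring
    · intro j hj x hx hjx y
      have hsub : ∀ (A A' A'' : (B × EuclideanSpace ℝ (Fin r)) [⋀^Fin r]→L[ℝ] ℝ),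
          (A + (A'.compContinuousLinearMap (baseMap r (L i)) -
            A''.compContinuousLinearMap (baseMap r (L i)))).compContinuousLinearMap
              (baseMap r (L j)) = A.compContinuousLinearMap (baseMap r (L j)) +
            (A'.compContinuousLinearMap (baseMap r ((L i).comp (L j))) -
              A''.compContinuousLinearMap (baseMap r ((L i).comp (L j)))) := fun _ _ _ => rfl
      rw [hsub]
      simp only
      -- Over the new subspace `A_i` is the identity and `σ` cancels. Over an old one, `A_i x` lies
      -- in both subspaces because the retractions commute; there `t_i` and `σ` both restrict to
      -- `t_j`, so the correction vanishes.
      rcases Finset.mem_insert.1 hj with rfl | hjs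
      · rw [hjx, hidem]
        abel
      · set x' := L i x + c i with hx'
        have hx'm : x' ∈ Q ∩ u := ⟨(hL i hi').mem x hx.1, hLu i hi' x hx⟩
        have h1 : L i x' + c i = x' := (hL i hi').idem x
        have h2 : L j x' + c j = x' := by
          rw [hx', ← hcomm i hi' j hj x, hjx]
        rw [hσt j hjs x hx hjx y, hcompat i hi' j hj x' hx'm h1 h2 y, hLcomm j hj,
          ← compContinuousLinearMap_baseMap_comp, ← compContinuousLinearMap_baseMap_comp,
          hσt j hjs x' hx'm h2 y, sub_self, add_zero]

end FlatExtension

/-! ### Calculus of forms on manifolds -/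

section ManifoldForms

variable {V : Type*} [NormedAddCommGroup V] [NormedSpace ℝ V]
  {H : Type*} [TopologicalSpace H] {J : ModelWithCorners ℝ V H}
  {N : Type*} [TopologicalSpace N] [ChartedSpace H N]
  {W : Type*} [NormedAddCommGroup W] [NormedSpace ℝ W] {k : ℕ}

/-- The pullback of a form under a map from a subset of a vector space. -/
def pull (s : Set W) (f : W → N) (α : Form J (N := N) k) (z : W) : W [⋀^Fin k]→L[ℝ] ℝ :=
  (α (f z)).compContinuousLinearMap (mfderivWithin 𝓘(ℝ, W) J f s z)

/-- Smoothness of a form at a point. -/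
def SmoothAt (α : Form J (N := N) k) (x : N) : Prop :=
  ContDiffWithinAt ℝ ∞ (α.inChart x) (range J) (extChartAt J x x)

theorem extChartAt_mem_range (x y : N) : extChartAt J x y ∈ range J := mem_range_self _

/-- A subset of a vector space on which derivatives are well behaved. -/
structure IsRegularDomain (s : Set W) : Prop where
  uniqueDiffOn : UniqueDiffOn ℝ s
  subset_closure : s ⊆ closure (interior s)

theorem isRegularDomain_of_convex {s : Set W} (hs : Convex ℝ s) (hi : (interior s).Nonempty) :
    IsRegularDomain s :=
  ⟨uniqueDiffOn_convex hs hi, fun _ hx => mem_closure_interior_of_convex hs hi hx⟩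

theorem isRegularDomain_range : IsRegularDomain (range J) :=
  ⟨J.uniqueDiffOn, J.range_subset_closure_interior⟩

variable [IsManifold J ∞ N] {s : Set W} {f : W → N} {α β : Form J (N := N) k} {z : W} {x : N}

/-- The chain rule for `f` written as inverse chart after chart after `f`. The chart need only
contain `f z`, so one chart serves all nearby points. -/
theorem pull_eq_of_mem_source (hs : UniqueDiffWithinAt ℝ s z)
    (hf : MDifferentiableWithinAt 𝓘(ℝ, W) J f s z) (hx : f z ∈ (extChartAt J x).source) :
    pull s f α z = (α.inChart x (extChartAt J x (f z))).compContinuousLinearMap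
      (fderivWithin ℝ (extChartAt J x ∘ f) s z) := by
  have hsym : (extChartAt J x).symm (extChartAt J x (f z)) = f z := (extChartAt J x).left_inv hx
  have he : MDifferentiableAt J 𝓘(ℝ, V) (extChartAt J x) (f z) :=
    mdifferentiableAt_extChartAt (by rwa [extChartAt_source] at hx)
  have hef : MDifferentiableWithinAt 𝓘(ℝ, W) 𝓘(ℝ, V) (extChartAt J x ∘ f) s z :=
    he.comp_mdifferentiableWithinAt z hf
  have hg : MDifferentiableWithinAt 𝓘(ℝ, V) J (extChartAt J x).symm (range J)
      ((extChartAt J x ∘ f) z) :=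
    mdifferentiableWithinAt_extChartAt_symm ((extChartAt J x).map_source hx)
  have h1 := mfderivWithin_comp z hg hef (fun y _ => extChartAt_mem_range x (f y))
    hs.uniqueMDiffWithinAt
  rw [mfderivWithin_eq_fderivWithin] at h1
  have h2 : mfderivWithin 𝓘(ℝ, W) J ((extChartAt J x).symm ∘ (extChartAt J x ∘ f)) s z =
      mfderivWithin 𝓘(ℝ, W) J f s z := by
    refine Filter.EventuallyEq.mfderivWithin_eq ?_ hsym
    filter_upwards [hf.continuousWithinAt (extChartAt_source_mem_nhds' hx)] with y hy
    exact (extChartAt J x).left_inv hy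
  have h3 : ∀ (p q : N) (hpq : p = q) (D : W →L[ℝ] V), (α p).compContinuousLinearMap D =
      (α q).compContinuousLinearMap D := by
    intro p q hpq D
    subst hpq
    rfl
  unfold pull Form.inChart
  rw [← h2, h1]
  exact h3 _ _ hsym.symm ((mfderivWithin 𝓘(ℝ, V) J (extChartAt J x).symm (range J)
    (extChartAt J x (f z))).comp (fderivWithin ℝ (extChartAt J x ∘ f) s z))

theorem pull_eventuallyEq (hs : UniqueDiffOn ℝ s) (hz : z ∈ s)
    (hf : ContMDiffWithinAt 𝓘(ℝ, W) J ∞ f s z) :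
    pull s f α =ᶠ[𝓝[s] z] fun y => (α.inChart (f z) (extChartAt J (f z) (f y))).compContinuousLinearMap
      (fderivWithin ℝ (extChartAt J (f z) ∘ f) s y) := by
  have h1 : ContMDiffWithinAt 𝓘(ℝ, W) J 1 f s z := hf.of_le (by simp)
  have h2 := (contMDiffWithinAt_iff_contMDiffWithinAt_nhdsWithin (by simp)).1 h1
  rw [insert_eq_of_mem hz] at h2
  filter_upwards [h2, hf.continuousWithinAt (extChartAt_source_mem_nhds (I := J) (f z)),
    self_mem_nhdsWithin] with y hy hy' hys
  exact pull_eq_of_mem_source (hs y hys) (hy.mdifferentiableWithinAt (by simp)) hy'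

theorem contDiffWithinAt_extChartAt_comp (hf : ContMDiffWithinAt 𝓘(ℝ, W) J ∞ f s z) :
    ContDiffWithinAt ℝ ∞ (extChartAt J (f z) ∘ f) s z :=
  contMDiffWithinAt_iff_contDiffWithinAt.1
    ((contMDiffAt_extChartAt' (mem_chart_source H (f z))).comp_contMDiffWithinAt z hf)

theorem contDiffWithinAt_pull (hs : UniqueDiffOn ℝ s) (hz : z ∈ s)
    (hf : ContMDiffWithinAt 𝓘(ℝ, W) J ∞ f s z) (hα : SmoothAt α (f z)) :
    ContDiffWithinAt ℝ ∞ (pull s f α) s z := by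
  have h1 := contDiffWithinAt_extChartAt_comp hf
  refine ContDiffWithinAt.congr_of_eventuallyEq ?_ (pull_eventuallyEq hs hz hf)
    ((pull_eventuallyEq hs hz hf).self_of_nhdsWithin hz)
  exact ContDiffWithinAt.compContinuousLinearMap_alternating
    (ContDiffWithinAt.comp (g := α.inChart (f z)) (f := extChartAt J (f z) ∘ f) (t := range J)
      z hα h1 fun y _ => extChartAt_mem_range (f z) (f y))
    (h1.fderivWithin_right hs (by simp) hz)

/-- `Form.d` at `f z` is computed in the chart at `f z`. In this chart the pullback becomes one
between vector spaces, where `d` is known to be natural. -/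
theorem extDerivWithin_pull (hs : IsRegularDomain s) (hz : z ∈ s)
    (hf : ContMDiffWithinAt 𝓘(ℝ, W) J ∞ f s z) (hα : SmoothAt α (f z)) :
    extDerivWithin (pull s f α) s z = pull s f α.d z := by
  have h1 := contDiffWithinAt_extChartAt_comp hf
  rw [(pull_eventuallyEq hs.uniqueDiffOn hz hf).extDerivWithin_eq_of_mem hz]
  have h2 := extDerivWithin_pullback (f := extChartAt J (f z) ∘ f) (t := range J) (x := z)
    (hα.differentiableWithinAt (by simp)) h1 minSmoothness_two_le hs.uniqueDiffOn
    (hs.subset_closure hz) hz (fun y _ => extChartAt_mem_range (f z) (f y))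
  have h3 := mfderiv_comp_mfderivWithin (I := 𝓘(ℝ, W)) (I' := J) (I'' := 𝓘(ℝ, V)) z
    (mdifferentiableAt_extChartAt (I := J) (mem_chart_source H (f z)))
    (hf.mdifferentiableWithinAt (by simp)) (hs.uniqueDiffOn z hz).uniqueMDiffWithinAt
  rw [mfderivWithin_eq_fderivWithin] at h3
  refine h2.trans ?_
  rw [h3]
  rfl

theorem contMDiffWithinAt_symm_self (x : N) :
    ContMDiffWithinAt 𝓘(ℝ, V) J ∞ (extChartAt J x).symm (range J) (extChartAt J x x) :=
  contMDiffWithinAt_extChartAt_symm_range x (mem_extChartAt_target x)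

/-- The expression of a form in any preferred chart is its pullback under the inverse chart, so
smoothness at each point in the chart of that point suffices. -/
theorem isSmooth_iff : α.IsSmooth ↔ ∀ x, SmoothAt α x := by
  refine ⟨fun h x => ?_, fun h x₀ y hy => ?_⟩
  · exact (h x _ (mem_extChartAt_target x)).mono_of_mem_nhdsWithin
      (extChartAt_target_mem_nhdsWithin x)
  · exact (contDiffWithinAt_pull J.uniqueDiffOn (extChartAt_target_subset_range x₀ hy)
      (contMDiffWithinAt_extChartAt_symm_range x₀ hy) (h _)).mono
      (extChartAt_target_subset_range x₀)

/-- Forms that agree near `x`. -/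
theorem inChart_eventuallyEq (h : ∀ᶠ y in 𝓝 x, α y = β y) :
    α.inChart x =ᶠ[𝓝[range J] extChartAt J x x] β.inChart x := by
  have h1 : Tendsto (extChartAt J x).symm (𝓝[range J] extChartAt J x x) (𝓝 x) := by
    have := (contMDiffWithinAt_symm_self (J := J) x).continuousWithinAt.tendsto
    rwa [extChartAt_to_inv] at this
  filter_upwards [h1.eventually h] with y hy
  simp only [Form.inChart, hy]

theorem SmoothAt.congr (hα : SmoothAt α x) (h : ∀ᶠ y in 𝓝 x, α y = β y) : SmoothAt β x :=
  ContDiffWithinAt.congr_of_eventuallyEq hα (inChart_eventuallyEq h).symm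
    ((inChart_eventuallyEq h).symm.self_of_nhdsWithin (extChartAt_mem_range x x))

theorem d_congr (h : ∀ᶠ y in 𝓝 x, α y = β y) : α.d x = β.d x := by
  unfold Form.d
  rw [(inChart_eventuallyEq h).extDerivWithin_eq_of_mem (extChartAt_mem_range x x)]

theorem d_eq_zero_of_extDerivWithin (h : extDerivWithin (α.inChart x) (range J) (extChartAt J x x) = 0) :
    α.d x = 0 := by
  unfold Form.d
  rw [h]
  exact map_zero (ContinuousAlternatingMap.compContinuousLinearMapCLM (𝕜 := ℝ) (F := ℝ)
    (ι := Fin (k + 1)) (mfderiv J 𝓘(ℝ, V) (extChartAt J x) x))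

theorem pull_zero (h : α (f z) = 0) : pull s f α z = 0 := by
  unfold pull
  rw [h]
  exact map_zero (ContinuousAlternatingMap.compContinuousLinearMapCLM (𝕜 := ℝ) (F := ℝ)
    (ι := Fin k) (mfderivWithin 𝓘(ℝ, W) J f s z))

/-- The pullback to a manifold of a form on a vector space. -/
def ofFlat (Θ : N → W) (a : W → W [⋀^Fin k]→L[ℝ] ℝ) : Form J (N := N) k := fun x =>
  (a (Θ x)).compContinuousLinearMap (mfderiv J 𝓘(ℝ, W) Θ x)

theorem pull_ofFlat {Y : Type*} [NormedAddCommGroup Y] [NormedSpace ℝ Y] {Θ : N → Y}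
    {a : Y → Y [⋀^Fin k]→L[ℝ] ℝ} (hΘ : MDifferentiableAt J 𝓘(ℝ, Y) Θ (f z))
    (hf : MDifferentiableWithinAt 𝓘(ℝ, W) J f s z) (hs : UniqueDiffWithinAt ℝ s z) :
    pull s f (ofFlat (J := J) Θ a) z =
      (a (Θ (f z))).compContinuousLinearMap (fderivWithin ℝ (Θ ∘ f) s z) := by
  have h := mfderiv_comp_mfderivWithin z hΘ hf hs.uniqueMDiffWithinAt
  rw [mfderivWithin_eq_fderivWithin] at h
  rw [h]
  rfl

theorem pull_ofFlat_eq_self {Θ : N → W} {a : W → W [⋀^Fin k]→L[ℝ] ℝ}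
    (hΘ : MDifferentiableAt J 𝓘(ℝ, W) Θ (f z))
    (hf : MDifferentiableWithinAt 𝓘(ℝ, W) J f s z) (hs : UniqueDiffWithinAt ℝ s z) (hz : z ∈ s)
    (h : ∀ᶠ y in 𝓝[s] z, Θ (f y) = y) : pull s f (ofFlat (J := J) Θ a) z = a z := by
  have h' : (Θ ∘ f) =ᶠ[𝓝[s] z] id := h
  rw [pull_ofFlat hΘ hf hs, h'.fderivWithin_eq (h.self_of_nhdsWithin hz), fderivWithin_id hs,
    h.self_of_nhdsWithin hz]
  rfl

/-- Together with `pull_ofFlat_eq_self` this makes `pull` and `ofFlat` inverse to each other; the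
two maps need to be inverse only near the point. -/
theorem ofFlat_pull_eq_self {Θ : N → W} (hΘ : MDifferentiableAt J 𝓘(ℝ, W) Θ x)
    (hf : MDifferentiableWithinAt 𝓘(ℝ, W) J f s (Θ x)) (hΘs : ∀ᶠ y in 𝓝 x, Θ y ∈ s)
    (h : ∀ᶠ y in 𝓝 x, f (Θ y) = y) : ofFlat Θ (pull s f α) x = α x := by
  have h1 := mfderivWithin_comp_of_preimage_mem_nhdsWithin (s := univ) x hf
    hΘ.mdifferentiableWithinAt (by rwa [nhdsWithin_univ]) (uniqueMDiffWithinAt_univ J)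
  have h2 : mfderivWithin J J (f ∘ Θ) univ x = ContinuousLinearMap.id ℝ _ := by
    have h' : (f ∘ Θ) =ᶠ[𝓝 x] id := h
    rw [mfderivWithin_univ, h'.mfderiv_eq, mfderiv_id]
  rw [h2, mfderivWithin_univ] at h1
  have h3 : ∀ (p q : N) (hpq : p = q) (D : V →L[ℝ] V), (α p).compContinuousLinearMap D =
      (α q).compContinuousLinearMap D := by
    intro p q hpq D
    subst hpq
    rfl
  have h4 : ofFlat Θ (pull s f α) x = (α (f (Θ x))).compContinuousLinearMap
      ((mfderivWithin 𝓘(ℝ, W) J f s (Θ x)).comp (mfderiv J 𝓘(ℝ, W) Θ x)) := rfl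
  rw [h4, ← h1]
  exact h3 _ _ h.self_of_nhds (ContinuousLinearMap.id ℝ V)

theorem inChart_ofFlat_eventuallyEq {Θ : N → W} {a : W → W [⋀^Fin k]→L[ℝ] ℝ}
    (hΘ : ContMDiffAt J 𝓘(ℝ, W) ∞ Θ x) :
    (ofFlat (J := J) Θ a).inChart x =ᶠ[𝓝[range J] extChartAt J x x] fun y =>
      (a ((Θ ∘ (extChartAt J x).symm) y)).compContinuousLinearMap
        (fderivWithin ℝ (Θ ∘ (extChartAt J x).symm) (range J) y) := by
  have h1 : Tendsto (extChartAt J x).symm (𝓝[range J] extChartAt J x x) (𝓝 x) := by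
    have := (contMDiffWithinAt_symm_self (J := J) x).continuousWithinAt.tendsto
    rwa [extChartAt_to_inv] at this
  have h2 : ∀ᶠ y in 𝓝 x, ContMDiffAt J 𝓘(ℝ, W) 1 Θ y := by
    have h2 : ContMDiffWithinAt J 𝓘(ℝ, W) 1 Θ univ x := (hΘ.of_le (by simp))
    have := (contMDiffWithinAt_iff_contMDiffWithinAt_nhdsWithin (by simp)).1 h2
    rw [insert_eq_of_mem (mem_univ x), nhdsWithin_univ] at this
    exact this
  filter_upwards [h1.eventually h2, extChartAt_target_mem_nhdsWithin (I := J) x] with y hy hy'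
  exact pull_ofFlat (hy.mdifferentiableAt (by simp))
    (mdifferentiableWithinAt_extChartAt_symm hy')
    (J.uniqueDiffOn y (extChartAt_target_subset_range x hy'))

theorem contDiffWithinAt_comp_symm {Θ : N → W} (hΘ : ContMDiffAt J 𝓘(ℝ, W) ∞ Θ x) :
    ContDiffWithinAt ℝ ∞ (Θ ∘ (extChartAt J x).symm) (range J) (extChartAt J x x) := by
  rw [← contMDiffWithinAt_iff_contDiffWithinAt]
  refine ContMDiffAt.comp_contMDiffWithinAt _ ?_ (contMDiffWithinAt_symm_self x)
  rwa [extChartAt_to_inv]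

/-- `Θ` takes values in `s`, the model domain with corners, so it is enough that `a` is smooth up to
the boundary of `s`. -/
theorem smoothAt_ofFlat {Θ : N → W} {a : W → W [⋀^Fin k]→L[ℝ] ℝ}
    (hΘ : ContMDiffAt J 𝓘(ℝ, W) ∞ Θ x) (hΘs : ∀ y, Θ y ∈ s)
    (ha : ContDiffWithinAt ℝ ∞ a s (Θ x)) : SmoothAt (ofFlat (J := J) Θ a) x := by
  have h1 := contDiffWithinAt_comp_symm hΘ
  have h2 : (Θ ∘ (extChartAt J x).symm) (extChartAt J x x) = Θ x := by simp
  refine ContDiffWithinAt.congr_of_eventuallyEq ?_ (inChart_ofFlat_eventuallyEq hΘ)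
    ((inChart_ofFlat_eventuallyEq hΘ).self_of_nhdsWithin (extChartAt_mem_range x x))
  refine ContDiffWithinAt.compContinuousLinearMap_alternating (ContDiffWithinAt.comp _
    (t := s) (by rwa [h2]) h1 fun y _ => hΘs _)
    (h1.fderivWithin_right J.uniqueDiffOn (by simp) (extChartAt_mem_range x x))

theorem d_ofFlat_eq_zero {Θ : N → W} {a : W → W [⋀^Fin k]→L[ℝ] ℝ}
    (hΘ : ContMDiffAt J 𝓘(ℝ, W) ∞ Θ x) (hΘs : ∀ y, Θ y ∈ s)
    (ha : DifferentiableWithinAt ℝ a s (Θ x)) (hd : extDerivWithin a s (Θ x) = 0) :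
    (ofFlat (J := J) Θ a).d x = 0 := by
  have h1 := contDiffWithinAt_comp_symm hΘ
  have h2 : (Θ ∘ (extChartAt J x).symm) (extChartAt J x x) = Θ x := by simp
  refine d_eq_zero_of_extDerivWithin ?_
  rw [(inChart_ofFlat_eventuallyEq hΘ).extDerivWithin_eq_of_mem (extChartAt_mem_range x x),
    extDerivWithin_pullback (t := s) (by rwa [h2]) h1 minSmoothness_two_le J.uniqueDiffOn
      (isRegularDomain_range.subset_closure (extChartAt_mem_range x x)) (extChartAt_mem_range x x)
      (fun y _ => hΘs _), h2, hd]
  exact map_zero (ContinuousAlternatingMap.compContinuousLinearMapCLM (𝕜 := ℝ) (F := ℝ)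
    (ι := Fin (k + 1)) _)

end ManifoldForms

/-! ### Tangent spaces of subsets -/

section Tangent

variable {V : Type*} [NormedAddCommGroup V] [NormedSpace ℝ V]
  {H : Type*} [TopologicalSpace H] {J : ModelWithCorners ℝ V H}
  {N : Type*} [TopologicalSpace N] [ChartedSpace H N]
  {V' : Type*} [NormedAddCommGroup V'] [NormedSpace ℝ V']
  {H' : Type*} [TopologicalSpace H'] {J' : ModelWithCorners ℝ V' H'}
  {N' : Type*} [TopologicalSpace N'] [ChartedSpace H' N']
  {W : Type*} [NormedAddCommGroup W] [NormedSpace ℝ W]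

theorem tangentConeAt_subset_of_mem_nhdsWithin {A A' : Set W} {x : W} (h : A' ∈ 𝓝[A] x) :
    tangentConeAt ℝ A x ⊆ tangentConeAt ℝ A' x :=
  tangentConeAt_mono_nhds (le_inf inf_le_left (le_principal_iff.2 h))

/-- The derivative of a map into `S` takes values in the tangent space of `S`. -/
theorem mfderivWithin_mem_tangentSub [FiniteDimensional ℝ V] {s : Set W} {f : W → N} {z : W}
    (hs : UniqueDiffWithinAt ℝ s z) (hf : MDifferentiableWithinAt 𝓘(ℝ, W) J f s z)
    {S : Set N} (hS : ∀ᶠ y in 𝓝[s] z, f y ∈ S) (w : W) :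
    mfderivWithin 𝓘(ℝ, W) J f s z w ∈ tangentSub J S (f z) := by
  have h1 : HasFDerivWithinAt (extChartAt J (f z) ∘ f) (mfderivWithin 𝓘(ℝ, W) J f s z : W →L[ℝ] V)
      s z := by
    have := hf.hasMFDerivWithinAt.2
    simpa only [writtenInExtChartAt, extChartAt_model_space_eq_id, PartialEquiv.refl_symm,
      PartialEquiv.refl_coe, Function.comp_id, preimage_id_eq, id_eq, modelWithCornersSelf_coe,
      range_id, inter_univ] using this
  set P : Submodule ℝ V := Submodule.span ℝ (tangentConeAt ℝ
    (extChartAt J (f z) '' (S ∩ (extChartAt J (f z)).source)) (extChartAt J (f z) (f z)))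
  change (mfderivWithin 𝓘(ℝ, W) J f s z : W →L[ℝ] V) w ∈ P
  set s' : Set W := {y ∈ s | f y ∈ S ∩ (extChartAt J (f z)).source}
  have hs' : s' ∈ 𝓝[s] z := by
    filter_upwards [hS, hf.continuousWithinAt (extChartAt_source_mem_nhds (I := J) (f z)),
      self_mem_nhdsWithin] with y h1 h2 h3
    exact ⟨h3, h1, h2⟩
  have h2 := (h1.mono (sep_subset _ _ : s' ⊆ s)).mapsTo_tangent_cone
  have h3 : ∀ w ∈ tangentConeAt ℝ s z, (mfderivWithin 𝓘(ℝ, W) J f s z : W →L[ℝ] V) w ∈ P := by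
    intro w hw
    refine Submodule.subset_span (tangentConeAt_mono ?_
      (h2 (tangentConeAt_subset_of_mem_nhdsWithin hs' hw)))
    rintro _ ⟨y, hy, rfl⟩
    exact ⟨f y, hy.2, rfl⟩
  have h4 : Submodule.span ℝ (tangentConeAt ℝ s z) ≤ P.comap
      (mfderivWithin 𝓘(ℝ, W) J f s z : W →L[ℝ] V).toLinearMap := Submodule.span_le.2 h3
  -- The tangent cone of `s` spans only a dense subspace. The target subspace is closed by finite
  -- dimension, so the inclusion extends to all vectors.
  have h5 : IsClosed ((mfderivWithin 𝓘(ℝ, W) J f s z : W →L[ℝ] V) ⁻¹' (P : Set V)) :=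
    P.closed_of_finiteDimensional.preimage
      (mfderivWithin 𝓘(ℝ, W) J f s z : W →L[ℝ] V).continuous
  exact closure_minimal h4 h5 (hs.dense_tangentConeAt w)

/-- The derivative of a function that is constant on `S` vanishes on the tangent space of `S`. -/
theorem mfderiv_eq_zero_of_mem_tangentSub {h : N → W} {p : N} (hp : MDifferentiableAt J 𝓘(ℝ, W) h p)
    {S : Set N} (hS : ∀ᶠ q in 𝓝[S] p, h q = h p) {w : TangentSpace J p}
    (hw : w ∈ tangentSub J S p) : mfderiv J 𝓘(ℝ, W) h p w = 0 := by
  obtain ⟨D, hD⟩ : ∃ D : V →L[ℝ] W, D = mfderiv J 𝓘(ℝ, W) h p := ⟨_, rfl⟩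
  have h1 : HasFDerivWithinAt (h ∘ (extChartAt J p).symm) D
      (range J) (extChartAt J p p) := by
    have : HasFDerivWithinAt (writtenInExtChartAt J 𝓘(ℝ, W) p h) D (range J)
        (extChartAt J p p) := by
      rw [hD]
      exact hp.hasMFDerivAt.2
    simpa only [writtenInExtChartAt, extChartAt_model_space_eq_id,
      PartialEquiv.refl_coe, Function.id_comp] using this
  set A : Set V := extChartAt J p '' (S ∩ (extChartAt J p).source)
  have hA : A ⊆ range J := by
    rintro _ ⟨q, -, rfl⟩
    exact extChartAt_mem_range p q
  have h2 : HasFDerivWithinAt (h ∘ (extChartAt J p).symm) (0 : V →L[ℝ] W) A (extChartAt J p p) := by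
    refine HasFDerivWithinAt.congr_of_eventuallyEq (hasFDerivWithinAt_const (h p) _ _) ?_ (by simp)
    have h3 : Tendsto (extChartAt J p).symm (𝓝[A] extChartAt J p p) (𝓝[S] p) := by
      refine tendsto_nhdsWithin_iff.2 ⟨?_, ?_⟩
      · have := continuousAt_extChartAt_symm (I := J) p
        have := this.tendsto
        rw [extChartAt_to_inv] at this
        exact this.mono_left nhdsWithin_le_nhds
      · filter_upwards [self_mem_nhdsWithin] with y hy
        obtain ⟨q, hq, rfl⟩ := hy
        rw [(extChartAt J p).left_inv hq.2]
        exact hq.1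
    exact h3.eventually hS
  -- Along the image of `S` both `D` and 0 are derivatives of the function, so they agree on the
  -- tangent cone.
  have h3 := (h1.mono hA).unique_on h2
  have h4 : Submodule.span ℝ (tangentConeAt ℝ A (extChartAt J p p)) ≤
      LinearMap.ker D.toLinearMap := Submodule.span_le.2 fun x hx => h3 hx
  rw [← hD]
  exact h4 hw

/-- The derivative of a map from `S` to `S'` maps the tangent spaces to each other. -/
theorem mfderiv_mem_tangentSub {f : N → N'} {p : N} (hf : MDifferentiableAt J J' f p)
    {S : Set N} {S' : Set N'} (hS : ∀ q ∈ S, f q ∈ S') {w : TangentSpace J p}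
    (hw : w ∈ tangentSub J S p) : mfderiv J J' f p w ∈ tangentSub J' S' (f p) := by
  have h1 : HasFDerivWithinAt (extChartAt J' (f p) ∘ f ∘ (extChartAt J p).symm)
      (mfderiv J J' f p : V →L[ℝ] V') (range J) (extChartAt J p p) := hf.hasMFDerivAt.2
  set A : Set V := extChartAt J p '' (S ∩ (extChartAt J p).source)
  set A' : Set V := extChartAt J p '' (S ∩ (extChartAt J p).source ∩
    f ⁻¹' (extChartAt J' (f p)).source)
  have hA' : A' ⊆ range J := by
    rintro _ ⟨q, -, rfl⟩
    exact extChartAt_mem_range p q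
  have hAA : A' ∈ 𝓝[A] (extChartAt J p p) := by
    have h3 : Tendsto (extChartAt J p).symm (𝓝[A] extChartAt J p p) (𝓝 p) := by
      have := (continuousAt_extChartAt_symm (I := J) p).tendsto
      rw [extChartAt_to_inv] at this
      exact this.mono_left nhdsWithin_le_nhds
    filter_upwards [h3.eventually (hf.continuousAt (extChartAt_source_mem_nhds (I := J') (f p))),
      self_mem_nhdsWithin] with y hy hyA
    obtain ⟨q, hq, rfl⟩ := hyA
    rw [(extChartAt J p).left_inv hq.2] at hy
    exact ⟨q, ⟨hq, hy⟩, rfl⟩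
  have h2 := (h1.mono hA').mapsTo_tangent_cone
  set P : Submodule ℝ V' := Submodule.span ℝ (tangentConeAt ℝ
    (extChartAt J' (f p) '' (S' ∩ (extChartAt J' (f p)).source)) (extChartAt J' (f p) (f p)))
  have h5 : Submodule.span ℝ (tangentConeAt ℝ A (extChartAt J p p)) ≤
      P.comap (mfderiv J J' f p : V →L[ℝ] V').toLinearMap := by
    refine Submodule.span_le.2 fun x hx => ?_
    have h3 := h2 (tangentConeAt_subset_of_mem_nhdsWithin hAA hx)
    have h4 : (extChartAt J' (f p) ∘ f ∘ (extChartAt J p).symm) (extChartAt J p p) =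
        extChartAt J' (f p) (f p) := by simp
    rw [h4] at h3
    refine Submodule.subset_span (tangentConeAt_mono ?_ h3)
    rintro _ ⟨_, ⟨q, hq, rfl⟩, rfl⟩
    refine ⟨f q, ⟨hS q hq.1.1, hq.2⟩, ?_⟩
    simp only [Function.comp_apply, (extChartAt J p).left_inv hq.1.2]
  exact h5 hw

end Tangent

/-! ### Charts of the total space of a vector bundle -/

section BundleChart

/-- The euclidean space of dimension `n`. -/
abbrev Euc (n : ℕ) : Type := EuclideanSpace ℝ (Fin n)

/-- The model with corners of manifolds with corners of dimension `n`. -/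
abbrev Quad (n : ℕ) : ModelWithCorners ℝ (Euc n) (EuclideanQuadrant n) :=
  modelWithCornersEuclideanQuadrant n

variable {n r : ℕ} {M : Type*} [TopologicalSpace M] [ChartedSpace (EuclideanQuadrant n) M]
  {E : M → Type*} [TopologicalSpace (TotalSpace (EuclideanSpace ℝ (Fin r)) E)]
  [∀ p, TopologicalSpace (E p)] [FiberBundle (EuclideanSpace ℝ (Fin r)) E]

/-- The product of a chart of the base and the fibre coordinate of a trivialization. -/
def bundleChart (φ : OpenPartialHomeomorph M (EuclideanQuadrant n))
    (e : Trivialization (Euc r) (π (Euc r) E)) (v : TotalSpace (Euc r) E) : Euc n × Euc r :=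
  (φ.extend (Quad n) v.proj, (e v).2)

/-- The inverse of `bundleChart`. -/
def bundleParam (φ : OpenPartialHomeomorph M (EuclideanQuadrant n))
    (e : Trivialization (Euc r) (π (Euc r) E)) (z : Euc n × Euc r) : TotalSpace (Euc r) E :=
  e.toOpenPartialHomeomorph.symm ((φ.extend (Quad n)).symm z.1, z.2)

/-- An open set whose intersection with the quadrant is the image under `φ` of the base set of
the trivialization `e`. -/
def chartDomain (φ : OpenPartialHomeomorph M (EuclideanQuadrant n))
    (e : Trivialization (Euc r) (π (Euc r) E)) : Set (Euc n) :=
  (modelWithCornersEuclideanQuadrant n).symm ⁻¹' (φ.target ∩ φ.symm ⁻¹' e.baseSet)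

variable {φ : OpenPartialHomeomorph M (EuclideanQuadrant n)} {e : Trivialization (Euc r) (π (Euc r) E)}
  {x : Euc n} {z : Euc n × Euc r} {p : M} {v : TotalSpace (Euc r) E}

theorem isOpen_chartDomain : IsOpen (chartDomain φ e) :=
  (φ.isOpen_inter_preimage_symm e.open_baseSet).preimage (Quad n).continuous_symm

theorem mem_target_of_mem_chartDomain (hx : x ∈ range (Quad n) ∩ chartDomain φ e) :
    x ∈ (φ.extend (Quad n)).target := by
  rw [φ.extend_target]
  exact ⟨hx.2.1, hx.1⟩

theorem symm_mem_source (hx : x ∈ range (Quad n) ∩ chartDomain φ e) :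
    (φ.extend (Quad n)).symm x ∈ φ.source := by
  have := (φ.extend (Quad n)).map_target (mem_target_of_mem_chartDomain hx)
  rwa [φ.extend_source] at this

theorem symm_mem_baseSet (hx : x ∈ range (Quad n) ∩ chartDomain φ e) :
    (φ.extend (Quad n)).symm x ∈ e.baseSet := hx.2.2

theorem extend_symm_eq (hx : x ∈ range (Quad n) ∩ chartDomain φ e) :
    φ.extend (Quad n) ((φ.extend (Quad n)).symm x) = x :=
  (φ.extend (Quad n)).right_inv (mem_target_of_mem_chartDomain hx)

theorem extend_mem (hp : p ∈ φ.source) (hpe : p ∈ e.baseSet) :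
    φ.extend (Quad n) p ∈ range (Quad n) ∩ chartDomain φ e := by
  refine ⟨mem_range_self _, ?_⟩
  have h1 : (Quad n).symm (φ.extend (Quad n) p) = φ p := by
    rw [φ.extend_coe]
    exact (Quad n).left_inv _
  refine ⟨?_, ?_⟩ <;> rw [h1]
  · exact φ.map_source hp
  · change φ.symm (φ p) ∈ e.baseSet
    rwa [φ.left_inv hp]

theorem proj_bundleParam (hz : z.1 ∈ range (Quad n) ∩ chartDomain φ e) :
    (bundleParam φ e z).proj = (φ.extend (Quad n)).symm z.1 :=
  e.proj_symm_apply' (symm_mem_baseSet hz)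

theorem bundleChart_bundleParam (hz : z.1 ∈ range (Quad n) ∩ chartDomain φ e) :
    bundleChart φ e (bundleParam φ e z) = z := by
  unfold bundleChart
  rw [proj_bundleParam hz, extend_symm_eq hz]
  unfold bundleParam
  rw [e.apply_symm_apply' (symm_mem_baseSet hz)]

theorem bundleParam_bundleChart (hv : v.proj ∈ φ.source) (hve : v.proj ∈ e.baseSet) :
    bundleParam φ e (bundleChart φ e v) = v := by
  unfold bundleParam bundleChart
  rw [φ.extend_left_inv hv]
  exact e.symm_apply_mk_proj (e.mem_source.2 hve)

theorem bundleChart_mem (v : TotalSpace (Euc r) E) :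
    bundleChart φ e v ∈ range (Quad n) ×ˢ (univ : Set (Euc r)) := ⟨mem_range_self _, mem_univ _⟩

variable [∀ p, AddCommGroup (E p)] [∀ p, Module ℝ (E p)]
  [VectorBundle ℝ (Euc r) E] [IsManifold (Quad n) ∞ M] [ContMDiffVectorBundle ∞ (Euc r) E (Quad n)]

theorem contMDiffAt_bundleChart (hφ : φ ∈ IsManifold.maximalAtlas (Quad n) ∞ M)
    [MemTrivializationAtlas e] (hv : v.proj ∈ φ.source) (hve : v.proj ∈ e.baseSet) :
    ContMDiffAt (totalModel n r) 𝓘(ℝ, Euc n × Euc r) ∞ (bundleChart φ e) v := by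
  refine ContMDiffAt.prodMk_space ?_ ?_
  · have h1 : ContMDiffAt (Quad n) 𝓘(ℝ, Euc n) ∞ (φ.extend (Quad n)) v.proj :=
      φ.contMDiffAt_extend hφ hv
    exact h1.comp v (contMDiffAt_proj E)
  · have h1 := (e.contMDiffOn (n := ∞) (IB := (Quad n))).contMDiffAt
      (e.open_source.mem_nhds (e.mem_source.2 hve))
    exact contMDiffAt_snd.comp v h1

theorem contMDiffWithinAt_extend_symm (hφ : φ ∈ IsManifold.maximalAtlas (Quad n) ∞ M)
    (hx : x ∈ range (Quad n) ∩ chartDomain φ e) :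
    ContMDiffWithinAt 𝓘(ℝ, Euc n) (Quad n) ∞ (φ.extend (Quad n)).symm (range (Quad n)) x := by
  have h1 := contMDiffOn_extend_symm hφ
  have h2 : ((Quad n) : EuclideanQuadrant n → Euc n) '' φ.target ∈ 𝓝[range (Quad n)] x := by
    rw [← φ.extend_target', φ.extend_target]
    refine inter_mem ?_ self_mem_nhdsWithin
    exact mem_nhdsWithin_of_mem_nhds
      ((φ.open_target.preimage (Quad n).continuous_symm).mem_nhds hx.2.1)
  refine (h1 x ?_).mono_of_mem_nhdsWithin h2
  rw [← φ.extend_target']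
  exact mem_target_of_mem_chartDomain hx

theorem contMDiffWithinAt_bundleParam (hφ : φ ∈ IsManifold.maximalAtlas (Quad n) ∞ M)
    [MemTrivializationAtlas e] (hz : z.1 ∈ range (Quad n) ∩ chartDomain φ e) :
    ContMDiffWithinAt 𝓘(ℝ, Euc n × Euc r) (totalModel n r) ∞ (bundleParam φ e)
      (range (Quad n) ×ˢ univ) z := by
  have h1 : ContMDiffWithinAt 𝓘(ℝ, Euc n × Euc r) (totalModel n r) ∞
      (fun z : Euc n × Euc r => ((φ.extend (Quad n)).symm z.1, z.2)) (range (Quad n) ×ˢ univ) z := by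
    refine ContMDiffWithinAt.prodMk ?_ ?_
    · refine ContMDiffWithinAt.comp (I' := 𝓘(ℝ, Euc n)) z (t := range (Quad n))
        (contMDiffWithinAt_extend_symm hφ hz) ?_ (fun y hy => hy.1)
      exact contMDiffWithinAt_iff_contDiffWithinAt.2 contDiffWithinAt_fst
    · exact contMDiffWithinAt_iff_contDiffWithinAt.2 contDiffWithinAt_snd
  have h2 := (e.contMDiffOn_symm (n := ∞) (IB := (Quad n))).contMDiffAt (x := ((φ.extend (Quad n)).symm z.1, z.2))
    (e.open_target.mem_nhds (by
      rw [e.target_eq]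
      exact ⟨symm_mem_baseSet hz, mem_univ _⟩))
  exact h2.comp_contMDiffWithinAt z h1

end BundleChart

/-! ### Forms on the total space in charts -/

section Conversion

variable {n r : ℕ} {M : Type*} [TopologicalSpace M] [ChartedSpace (EuclideanQuadrant n) M]
  {E : M → Type*} [TopologicalSpace (TotalSpace (EuclideanSpace ℝ (Fin r)) E)]
  [∀ p, TopologicalSpace (E p)] [FiberBundle (EuclideanSpace ℝ (Fin r)) E]
  [∀ p, AddCommGroup (E p)] [∀ p, Module ℝ (E p)]
  [VectorBundle ℝ (Euc r) E] [IsManifold (Quad n) ∞ M] [ContMDiffVectorBundle ∞ (Euc r) E (Quad n)]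
  {φ : OpenPartialHomeomorph M (EuclideanQuadrant n)} {e : Trivialization (Euc r) (π (Euc r) E)}
  [MemTrivializationAtlas e] {k : ℕ}

/-- The expression in coordinates of a form on the total space. -/
def toFlat (φ : OpenPartialHomeomorph M (EuclideanQuadrant n))
    (e : Trivialization (Euc r) (π (Euc r) E)) (α : BundleForm n r E k) :
    Euc n × Euc r → (Euc n × Euc r) [⋀^Fin k]→L[ℝ] ℝ :=
  pull (range (Quad n) ×ˢ univ) (bundleParam φ e) α

theorem isRegularDomain_quad : IsRegularDomain (range (Quad n) ×ˢ (univ : Set (Euc r))) :=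
  isRegularDomain_of_convex (convex_prod_univ (Quad n).convex_range)
    (interior_prod_univ_nonempty (Quad n).nonempty_interior)

theorem tendsto_extend_symm {x : Euc n} (hx : x ∈ range (Quad n) ∩ chartDomain φ e) :
    Tendsto (φ.extend (Quad n)).symm (𝓝[range (Quad n)] x) (𝓝 ((φ.extend (Quad n)).symm x)) :=
  (φ.continuousAt_extend_symm' (mem_target_of_mem_chartDomain hx)).mono_left nhdsWithin_le_nhds

theorem eventually_mem_chartDomain {x : Euc n} (hx : x ∈ range (Quad n) ∩ chartDomain φ e) :
    ∀ᶠ x' in 𝓝[range (Quad n)] x, x' ∈ range (Quad n) ∩ chartDomain φ e := by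
  filter_upwards [self_mem_nhdsWithin, mem_nhdsWithin_of_mem_nhds
    (isOpen_chartDomain.mem_nhds hx.2)] with x' h1 h2
  exact ⟨h1, h2⟩

/-- In the chart `φ` the subset `S` is, near `p`, the image of the affine retraction `x ↦ L x + c`. -/
def IsCutBy (φ : OpenPartialHomeomorph M (EuclideanQuadrant n)) (S : Set M)
    (L : Euc n →L[ℝ] Euc n) (c : Euc n) (p : M) : Prop :=
  ∀ᶠ q in 𝓝 p, (q ∈ S ↔ L (φ.extend (Quad n) q) + c = φ.extend (Quad n) q)

variable {S : Set M} {L : Euc n →L[ℝ] Euc n} {c : Euc n}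

/-- Precompose with the retraction `A`. The projection to `M` then takes values in `S`, so its
derivative is tangent to `S`, and at the fixed point `z` the derivative of `A` is `baseMap r L`. -/
theorem mfderivWithin_bundleParam_mem_tangentOver (hφ : φ ∈ IsManifold.maximalAtlas (Quad n) ∞ M)
    (hL : AffineRetraction (range (Quad n)) L c) {z : Euc n × Euc r}
    (hz : z.1 ∈ range (Quad n) ∩ chartDomain φ e) (hLz : L z.1 + c = z.1)
    (hS : IsCutBy φ S L c ((φ.extend (Quad n)).symm z.1)) (w : Euc n × Euc r) :
    mfderivWithin 𝓘(ℝ, Euc n × Euc r) (totalModel n r) (bundleParam φ e)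
      (range (Quad n) ×ˢ univ) z (baseMap r L w) ∈
        tangentOver (n := n) S (bundleParam φ e z) := by
  set C : Set (Euc n × Euc r) := range (Quad n) ×ˢ univ
  set A : Euc n × Euc r → Euc n × Euc r := fun z => (L z.1 + c, z.2) with hA
  have hAz : A z = z := by simp [hA, hLz]
  have hzC : z ∈ C := ⟨hz.1, mem_univ _⟩
  have hAC : MapsTo A C C := fun z hz => ⟨hL.mem _ hz.1, mem_univ _⟩
  have hu := (isRegularDomain_quad (n := n) (r := r)).uniqueDiffOn z hzC
  have hAd : HasFDerivWithinAt A (baseMap r L) C z := by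
    have h1 : HasFDerivWithinAt (fun z : Euc n × Euc r => baseMap r L z + (c, 0)) (baseMap r L) C z :=
      ((baseMap r L).hasFDerivWithinAt).add_const _
    have h2 : A = fun z : Euc n × Euc r => baseMap r L z + (c, 0) := by
      ext1 z
      simp [hA]
    rwa [h2]
  have hAm : MDifferentiableWithinAt 𝓘(ℝ, Euc n × Euc r) 𝓘(ℝ, Euc n × Euc r) A C z :=
    hAd.differentiableWithinAt.mdifferentiableWithinAt
  have hpar : MDifferentiableWithinAt 𝓘(ℝ, Euc n × Euc r) (totalModel n r) (bundleParam φ e) C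
      (A z) := by
    rw [hAz]
    exact (contMDiffWithinAt_bundleParam hφ hz).mdifferentiableWithinAt (by simp)
  have hproj : MDifferentiableAt (totalModel n r) (Quad n)
      (TotalSpace.proj : TotalSpace (Euc r) E → M) (bundleParam φ e (A z)) :=
    (contMDiffAt_proj (n := ∞) E).mdifferentiableAt (by simp)
  have hcomp : MDifferentiableWithinAt 𝓘(ℝ, Euc n × Euc r) (totalModel n r)
      (bundleParam φ e ∘ A) C z := hpar.comp z hAm hAC
  have h1 := mfderiv_comp_mfderivWithin z (g := (TotalSpace.proj : TotalSpace (Euc r) E → M))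
    hproj hcomp hu.uniqueMDiffWithinAt
  have h2 := mfderivWithin_comp z hpar hAm hAC hu.uniqueMDiffWithinAt
  have hev : ∀ᶠ y in 𝓝[C] z, (TotalSpace.proj ∘ bundleParam φ e ∘ A) y ∈ S := by
    have ht : Tendsto (fun y => (A y).1) (𝓝[C] z) (𝓝[range (Quad n)] z.1) := by
      have h3 : ContinuousWithinAt (fun y => (A y).1) C z :=
        continuous_fst.continuousAt.comp_continuousWithinAt hAd.continuousWithinAt
      have h4 := h3.tendsto_nhdsWithin (t := range (Quad n)) fun y hy => (hAC hy).1
      simpa only [hAz] using h4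
    filter_upwards [ht.eventually (eventually_mem_chartDomain hz),
      ht.eventually ((tendsto_extend_symm hz).eventually hS)] with y hy1 hy2
    simp only [Function.comp_apply, proj_bundleParam hy1]
    rw [hy2, extend_symm_eq hy1]
    exact hL.idem y.1
  have h3 := mfderivWithin_mem_tangentSub (J := Quad n) hu
    (hproj.comp_mdifferentiableWithinAt z hcomp) hev w
  rw [h1, h2, mfderivWithin_eq_fderivWithin, hAd.fderivWithin hu] at h3
  refine @Eq.subst _ (fun z₀ : Euc n × Euc r => mfderivWithin 𝓘(ℝ, Euc n × Euc r) (totalModel n r)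
    (bundleParam φ e) C z₀ (baseMap r L w) ∈ tangentOver (n := n) S (bundleParam φ e z₀))
    _ _ hAz h3

/-- On `S` the function `(L - id) ∘ φ` has the constant value `-c`. Its differential kills vectors
tangent to `S`, so `L` fixes their coordinates. -/
theorem baseMap_mfderiv_bundleChart (hφ : φ ∈ IsManifold.maximalAtlas (Quad n) ∞ M)
    {v : TotalSpace (Euc r) E} (hv : v.proj ∈ φ.source) (hve : v.proj ∈ e.baseSet)
    (hvS : v.proj ∈ S) (hS : IsCutBy φ S L c v.proj) {w : TangentSpace (totalModel n r) v}
    (hw : w ∈ tangentOver (n := n) S v) :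
    baseMap r L (mfderiv (totalModel n r) 𝓘(ℝ, Euc n × Euc r) (bundleChart φ e) v w) =
      mfderiv (totalModel n r) 𝓘(ℝ, Euc n × Euc r) (bundleChart φ e) v w := by
  have hφm : MDifferentiableAt (Quad n) 𝓘(ℝ, Euc n) (φ.extend (Quad n)) v.proj :=
    (φ.contMDiffAt_extend hφ hv).mdifferentiableAt (by simp)
  have hproj : MDifferentiableAt (totalModel n r) (Quad n)
      (TotalSpace.proj : TotalSpace (Euc r) E → M) v :=
    (contMDiffAt_proj (n := ∞) E).mdifferentiableAt (by simp)
  have hch : MDifferentiableAt (totalModel n r) 𝓘(ℝ, Euc n × Euc r) (bundleChart φ e) v :=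
    (contMDiffAt_bundleChart hφ hv hve).mdifferentiableAt (by simp)
  have h1 := mfderiv_comp v (g := φ.extend (Quad n)) hφm hproj
  have hfst : MDifferentiableAt 𝓘(ℝ, Euc n × Euc r) 𝓘(ℝ, Euc n)
      (ContinuousLinearMap.fst ℝ (Euc n) (Euc r)) (bundleChart φ e v) :=
    (ContinuousLinearMap.fst ℝ (Euc n) (Euc r)).differentiableAt.mdifferentiableAt
  have h2 := mfderiv_comp v hfst hch
  have h12 : (ContinuousLinearMap.fst ℝ (Euc n) (Euc r)) ∘ bundleChart φ e =
      φ.extend (Quad n) ∘ (TotalSpace.proj : TotalSpace (Euc r) E → M) := rfl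
  rw [h12, h1, mfderiv_eq_fderiv, ContinuousLinearMap.fderiv] at h2
  set ℓ : Euc n →L[ℝ] Euc n := L - ContinuousLinearMap.id ℝ _ with hℓ
  have hℓm : MDifferentiableAt 𝓘(ℝ, Euc n) 𝓘(ℝ, Euc n) ℓ (φ.extend (Quad n) v.proj) :=
    ℓ.differentiableAt.mdifferentiableAt
  have h3 := mfderiv_comp v.proj hℓm hφm
  have h4 : mfderiv (Quad n) 𝓘(ℝ, Euc n) (ℓ ∘ φ.extend (Quad n)) v.proj
      (mfderiv (totalModel n r) (Quad n) (TotalSpace.proj : TotalSpace (Euc r) E → M) v w) = 0 := by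
    refine mfderiv_eq_zero_of_mem_tangentSub (hℓm.comp v.proj hφm) (S := S) ?_ hw
    have h5 : ∀ q, L (φ.extend (Quad n) q) + c = φ.extend (Quad n) q →
        (ℓ ∘ φ.extend (Quad n)) q = -c := by
      intro q hq
      simp only [hℓ, Function.comp_apply, sub_apply, ContinuousLinearMap.id_apply]
      nth_rewrite 2 [← hq]
      abel
    rw [h5 v.proj (hS.self_of_nhds.1 hvS)]
    filter_upwards [nhdsWithin_le_nhds hS, self_mem_nhdsWithin] with q hq hqS
    exact h5 q (hq.1 hqS)
  rw [h3, mfderiv_eq_fderiv, ContinuousLinearMap.fderiv] at h4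
  have h6 := congrArg (fun D => D w) h2
  have h7 : ℓ ((mfderiv (totalModel n r) 𝓘(ℝ, Euc n × Euc r) (bundleChart φ e) v w :
      Euc n × Euc r).1) = 0 := by
    refine Eq.trans (congrArg ℓ h6.symm) h4
  have h8 : L ((mfderiv (totalModel n r) 𝓘(ℝ, Euc n × Euc r) (bundleChart φ e) v w :
      Euc n × Euc r).1) = (mfderiv (totalModel n r) 𝓘(ℝ, Euc n × Euc r) (bundleChart φ e) v w :
      Euc n × Euc r).1 := sub_eq_zero.1 h7
  exact Prod.ext h8 rfl

theorem ofFlat_toFlat (hφ : φ ∈ IsManifold.maximalAtlas (Quad n) ∞ M) (α : BundleForm n r E k)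
    {v : TotalSpace (Euc r) E} (hv : v.proj ∈ φ.source) (hve : v.proj ∈ e.baseSet) :
    ofFlat (bundleChart φ e) (toFlat φ e α) v = α v := by
  refine ofFlat_pull_eq_self ((contMDiffAt_bundleChart hφ hv hve).mdifferentiableAt (by simp))
    ((contMDiffWithinAt_bundleParam hφ (extend_mem hv hve)).mdifferentiableWithinAt (by simp))
    (Eventually.of_forall bundleChart_mem) ?_
  have hopen : IsOpen ((TotalSpace.proj : TotalSpace (Euc r) E → M) ⁻¹' (φ.source ∩ e.baseSet)) :=
    (φ.open_source.inter e.open_baseSet).preimage (FiberBundle.continuous_proj (Euc r) E)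
  filter_upwards [hopen.mem_nhds ⟨hv, hve⟩] with v' hv'
  exact bundleParam_bundleChart hv'.1 hv'.2

theorem toFlat_ofFlat (hφ : φ ∈ IsManifold.maximalAtlas (Quad n) ∞ M)
    (a : Euc n × Euc r → (Euc n × Euc r) [⋀^Fin k]→L[ℝ] ℝ) {z : Euc n × Euc r}
    (hz : z.1 ∈ range (Quad n) ∩ chartDomain φ e) :
    toFlat φ e (ofFlat (bundleChart φ e) a) z = a z := by
  have hzC : z ∈ range (Quad n) ×ˢ (univ : Set (Euc r)) := ⟨hz.1, mem_univ _⟩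
  refine pull_ofFlat_eq_self ?_
    ((contMDiffWithinAt_bundleParam hφ hz).mdifferentiableWithinAt (by simp))
    (isRegularDomain_quad.uniqueDiffOn z hzC) hzC ?_
  · refine (contMDiffAt_bundleChart hφ ?_ ?_).mdifferentiableAt (by simp)
    · rw [proj_bundleParam hz]
      exact symm_mem_source hz
    · rw [proj_bundleParam hz]
      exact symm_mem_baseSet hz
  · have h1 : Tendsto Prod.fst (𝓝[range (Quad n) ×ˢ (univ : Set (Euc r))] z)
        (𝓝[range (Quad n)] z.1) := continuousWithinAt_fst.tendsto_nhdsWithin fun y hy => hy.1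
    filter_upwards [h1.eventually (eventually_mem_chartDomain hz)] with y hy
    exact bundleChart_bundleParam hy

/-- Two forms agree over `S` if and only if their coordinate expressions do. -/
theorem restrictTo_eq_iff (hφ : φ ∈ IsManifold.maximalAtlas (Quad n) ∞ M)
    (hL : AffineRetraction (range (Quad n)) L c) (α β : BundleForm n r E k)
    {v : TotalSpace (Euc r) E} (hv : v.proj ∈ φ.source) (hve : v.proj ∈ e.baseSet)
    (hvS : v.proj ∈ S) (hS : IsCutBy φ S L c v.proj) :
    restrictTo S α v hvS = restrictTo S β v hvS ↔
      (toFlat φ e α (bundleChart φ e v)).compContinuousLinearMap (baseMap r L) =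
        (toFlat φ e β (bundleChart φ e v)).compContinuousLinearMap (baseMap r L) := by
  have hz := extend_mem hv hve
  constructor
  -- Vectors of the form `baseMap r L w` correspond to vectors tangent to the bundle over `S`.
  · intro h
    obtain ⟨z, hzv⟩ : ∃ z, z = bundleChart φ e v := ⟨_, rfl⟩
    have hvz : v = bundleParam φ e z := by rw [hzv, bundleParam_bundleChart hv hve]
    rw [← hzv]
    have hz' : z.1 ∈ range (Quad n) ∩ chartDomain φ e := by rw [hzv]; exact hz
    clear hzv
    subst hvz
    have hpz := proj_bundleParam hz'
    have hLz : L z.1 + c = z.1 := by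
      have := hS.self_of_nhds.1 hvS
      rwa [hpz, extend_symm_eq hz'] at this
    rw [hpz] at hS
    ext ws
    have h2 := congrArg (fun A => A fun j => ⟨_, mfderivWithin_bundleParam_mem_tangentOver hφ hL hz'
      hLz hS (ws j)⟩) h
    exact h2
  -- Conversely, the coordinates of a vector tangent to the bundle over `S` are fixed by `baseMap r
  -- L`, so inserting this map changes nothing.
  · intro h
    have h3 : ∀ γ : BundleForm n r E k, ∀ ws : Fin k → tangentOver (n := n) S v,
        restrictTo S γ v hvS ws = (toFlat φ e γ (bundleChart φ e v)).compContinuousLinearMap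
          (baseMap r L) (fun j => mfderiv (totalModel n r) 𝓘(ℝ, Euc n × Euc r)
            (bundleChart φ e) v (ws j)) := by
      intro γ ws
      have h4 : restrictTo S γ v hvS ws = γ v fun j => (ws j : TangentSpace (totalModel n r) v) :=
        rfl
      rw [h4, ← ofFlat_toFlat hφ γ hv hve]
      have h5 : (fun j => baseMap r L (mfderiv (totalModel n r) 𝓘(ℝ, Euc n × Euc r)
            (bundleChart φ e) v (ws j))) = fun j => mfderiv (totalModel n r) 𝓘(ℝ, Euc n × Euc r)
            (bundleChart φ e) v (ws j) :=
        funext fun j => baseMap_mfderiv_bundleChart hφ hv hve hvS hS (ws j).2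
      exact (congrArg (toFlat φ e γ (bundleChart φ e v)) h5).symm
    ext ws
    rw [h3 α, h3 β, h]

end Conversion

/-! ### Integrals over the fibres in coordinates -/

section FibreIntegral

variable (r : ℕ)

/-- The standard basis of `ℝʳ`. -/
abbrev stdBasis : Module.Basis (Fin r) ℝ (Euc r) := (EuclideanSpace.basisFun (Fin r) ℝ).toBasis

variable {r}

theorem stdBasis_apply (j : Fin r) : stdBasis r j = EuclideanSpace.single j (1 : ℝ) := by
  ext i
  simp

theorem integral_comp_linearEquiv (B : Euc r ≃ₗ[ℝ] Euc r) (h : Euc r → ℝ) :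
    ∫ x, h (B x) = |(LinearMap.det (B : Euc r →ₗ[ℝ] Euc r))⁻¹| * ∫ y, h y := by
  have h1 := (B.toContinuousLinearEquiv.toHomeomorph.measurableEmbedding).integral_map
    (μ := volume) h
  have h2 := Measure.map_linearMap_addHaar_eq_smul_addHaar (volume : Measure (Euc r))
    (f := (B : Euc r →ₗ[ℝ] Euc r)) (LinearEquiv.isUnit_det' B).ne_zero
  have h3 : (⇑B.toContinuousLinearEquiv.toHomeomorph : Euc r → Euc r) =
      ⇑(B : Euc r →ₗ[ℝ] Euc r) := rfl
  rw [h3, h2, integral_smul_measure, ENNReal.toReal_ofReal (abs_nonneg _)] at h1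
  exact h1.symm

variable {n : ℕ} {M : Type*} [TopologicalSpace M] [ChartedSpace (EuclideanQuadrant n) M]
  {E : M → Type*} [TopologicalSpace (TotalSpace (EuclideanSpace ℝ (Fin r)) E)]
  [∀ p, TopologicalSpace (E p)] [FiberBundle (EuclideanSpace ℝ (Fin r)) E]
  [∀ p, AddCommGroup (E p)] [∀ p, Module ℝ (E p)]
  [VectorBundle ℝ (Euc r) E] [IsManifold (Quad n) ∞ M] [ContMDiffVectorBundle ∞ (Euc r) E (Quad n)]
  {φ : OpenPartialHomeomorph M (EuclideanQuadrant n)} {e : Trivialization (Euc r) (π (Euc r) E)}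
  [MemTrivializationAtlas e] {k : ℕ}

/-- Change of variables. Evaluating the form on `b` instead of the standard basis gives a
determinant, and the substitution gives the absolute value of its inverse. The product is a sign
that compares orientations. -/
theorem fiberIntegral_eq (hφ : φ ∈ IsManifold.maximalAtlas (Quad n) ∞ M) (τ : BundleForm n r E r)
    {p : M} (hp : p ∈ φ.source) (hpe : p ∈ e.baseSet) (b : Module.Basis (Fin r) ℝ (E p)) :
    fiberIntegral τ p b = (stdBasis r).det (b.map (e.linearEquivAt ℝ p hpe)) *
      |((stdBasis r).det (b.map (e.linearEquivAt ℝ p hpe)))⁻¹| *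
        flatInt (toFlat φ e τ) (φ.extend (Quad n) p) := by
  set bb := b.map (e.linearEquivAt ℝ p hpe) with hbb
  set B : Euc r ≃ₗ[ℝ] Euc r := (stdBasis r).equiv bb (Equiv.refl _) with hB
  have hBs : ∀ j, B (EuclideanSpace.single j (1 : ℝ)) = bb j := by
    intro j
    rw [← stdBasis_apply, hB, Module.Basis.equiv_apply]
    rfl
  have hBx : ∀ x : Euc r, B x = ∑ j, x j • bb j := by
    intro x
    have h1 : x = ∑ j, x j • EuclideanSpace.single j (1 : ℝ) := by
      ext i
      simp [Finset.sum_apply, Pi.single_apply]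
    conv_lhs => rw [h1]
    simp only [map_sum, map_smul, hBs]
  have hdet : LinearMap.det (B : Euc r →ₗ[ℝ] Euc r) = (stdBasis r).det bb := by
    have h1 := (stdBasis r).det_comp (B : Euc r →ₗ[ℝ] Euc r) (stdBasis r)
    rw [Module.Basis.det_self, mul_one] at h1
    rw [← h1]
    congr 1
    ext1 j
    simp only [Function.comp_apply, LinearEquiv.coe_coe, stdBasis_apply, hBs]
  set C : Set (Euc n × Euc r) := range (Quad n) ×ˢ univ
  set P : Euc n := φ.extend (Quad n) p
  have hP : P ∈ range (Quad n) ∩ chartDomain φ e := extend_mem hp hpe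
  have hfun : fiberMap p b = bundleParam φ e ∘ fun x => (P, B x) := by
    ext1 x
    have h1 : (e (fiberMap p b x)).2 = B x := by
      have : (e (fiberMap p b x)).2 = e.linearEquivAt ℝ p hpe (∑ j, x j • b j) := rfl
      rw [this, hBx]
      simp [hbb]
    have h2 := bundleParam_bundleChart (φ := φ) (e := e) (v := fiberMap p b x) hp hpe
    rw [← h2, Function.comp_apply]
    unfold bundleChart
    rw [h1]
    rfl
  have hgen : ∀ f : Euc r → TotalSpace (Euc r) E, f = fiberMap p b →
      fiberIntegral τ p b = ∫ x, τ (f x) fun j => mfderiv 𝓘(ℝ, Euc r) (totalModel n r) f x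
        (EuclideanSpace.single j (1 : ℝ)) := by
    intro f hf
    subst hf
    rfl
  have hder : ∀ x w, mfderiv 𝓘(ℝ, Euc r) (totalModel n r) (bundleParam φ e ∘ fun x => (P, B x)) x w =
      mfderivWithin 𝓘(ℝ, Euc n × Euc r) (totalModel n r) (bundleParam φ e) C (P, B x) (0, B w) := by
    intro x w
    have hin : HasFDerivAt (fun x : Euc r => (P, B x))
        ((ContinuousLinearMap.inr ℝ (Euc n) (Euc r)).comp
          (B.toContinuousLinearEquiv : Euc r →L[ℝ] Euc r)) x := by
      have h1 := (hasFDerivAt_const P x).prodMk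
        (B.toContinuousLinearEquiv : Euc r →L[ℝ] Euc r).hasFDerivAt
      exact h1
    have h1 := mfderivWithin_comp (I := 𝓘(ℝ, Euc r)) (s := univ) x
      (f := fun x : Euc r => (P, B x)) (g := bundleParam φ e) (u := C)
      ((contMDiffWithinAt_bundleParam hφ hP).mdifferentiableWithinAt (by simp))
      hin.differentiableAt.mdifferentiableAt.mdifferentiableWithinAt
      (fun y _ => ⟨hP.1, mem_univ _⟩) (uniqueMDiffWithinAt_univ _)
    rw [mfderivWithin_univ, mfderivWithin_univ, mfderiv_eq_fderiv, hin.fderiv] at h1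
    rw [h1]
    rfl
  have hint : ∀ x, (τ ((bundleParam φ e ∘ fun x => (P, B x)) x) fun j =>
      mfderiv 𝓘(ℝ, Euc r) (totalModel n r) (bundleParam φ e ∘ fun x => (P, B x)) x
        (EuclideanSpace.single j (1 : ℝ))) =
      (stdBasis r).det bb * toFlat φ e τ (P, B x)
        fun j => (0, EuclideanSpace.single j (1 : ℝ)) := by
    intro x
    have hd : (fun j => mfderiv 𝓘(ℝ, Euc r) (totalModel n r)
        (bundleParam φ e ∘ fun x => (P, B x)) x (EuclideanSpace.single j (1 : ℝ))) = fun j =>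
        mfderivWithin 𝓘(ℝ, Euc n × Euc r) (totalModel n r) (bundleParam φ e) C (P, B x)
          ((0, bb j) : Euc n × Euc r) := by
      ext1 j
      rw [← hBs]
      exact hder x _
    refine (congrArg (τ _) hd).trans ?_
    -- On a fibre an `r`-form is a multiple of the determinant, so its value on `b` is the
    -- determinant of `b` times its value on the standard basis.
    have h1 := AlternatingMap.eq_smul_basis_det (stdBasis r)
      (((toFlat φ e τ (P, B x)).compContinuousLinearMap
        (ContinuousLinearMap.inr ℝ (Euc n) (Euc r))).toAlternatingMap)
    have h2 := congrArg (fun A => A bb) h1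
    have h3 : ∀ v : Fin r → Euc r, (((toFlat φ e τ (P, B x)).compContinuousLinearMap
        (ContinuousLinearMap.inr ℝ (Euc n) (Euc r))).toAlternatingMap) v =
        toFlat φ e τ (P, B x) fun j => (0, v j) := fun v => rfl
    simp only [AlternatingMap.smul_apply, smul_eq_mul, h3, stdBasis_apply] at h2
    rw [mul_comm, ← h2]
    rfl
  rw [hgen _ hfun.symm]
  simp only [hint]
  rw [integral_const_mul, integral_comp_linearEquiv B fun y => toFlat φ e τ (P, y)
        fun j => (0, EuclideanSpace.single j (1 : ℝ)), hdet, ← mul_assoc]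
  rfl

theorem mul_abs_inv_of_pos {d : ℝ} (h : 0 < d) : d * |d⁻¹| = 1 := by
  rw [abs_of_pos (inv_pos.2 h), mul_inv_cancel₀ h.ne']

theorem mul_abs_inv_of_neg {d : ℝ} (h : d < 0) : d * |d⁻¹| = -1 := by
  rw [abs_of_neg (inv_neg''.2 h), mul_neg, mul_inv_cancel₀ h.ne]

/-- The integrals of `τ` over the fibre at `p` are those of a Thom form. -/
def HasThomIntegral (o : ∀ p, Orientation ℝ (E p) (Fin r)) (τ : BundleForm n r E r) (p : M) : Prop :=
  (∀ b : Module.Basis (Fin r) ℝ (E p), b.orientation = o p → fiberIntegral τ p b = 1) ∧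
    ∀ b : Module.Basis (Fin r) ℝ (E p), b.orientation = -o p → fiberIntegral τ p b = -1

/-- `ε` is 1 or -1 according to whether the trivialization takes `o` to the standard orientation. It
is constant near `p₀` since `o` is locally constant. Both normalizations of a Thom form thus become
the single equation `flatInt = ε`. -/
theorem exists_hasThomIntegral_iff {o : ∀ p, Orientation ℝ (E p) (Fin r)}
    (ho : IsBundleOrientation o) (p₀ : M) :
    ∃ ε : ℝ, ∀ᶠ p in 𝓝 p₀, ∀ φ ∈ IsManifold.maximalAtlas (Quad n) ∞ M, p ∈ φ.source →
      ∀ τ : BundleForm n r E r, HasThomIntegral o τ p ↔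
        flatInt (toFlat φ (trivializationAt (Euc r) E p₀) τ) (φ.extend (Quad n) p) = ε := by
  obtain ⟨o₀, ho₀⟩ := ho p₀
  set e := trivializationAt (Euc r) E p₀
  have hbase : ∀ᶠ p in 𝓝 p₀, p ∈ e.baseSet :=
    e.open_baseSet.mem_nhds (FiberBundle.mem_baseSet_trivializationAt' p₀)
  have hsame : ∀ bb : Module.Basis (Fin r) ℝ (Euc r), bb.orientation = (stdBasis r).orientation →
      (stdBasis r).det bb * |((stdBasis r).det bb)⁻¹| = 1 := fun bb h =>
    mul_abs_inv_of_pos ((Module.Basis.orientation_eq_iff_det_pos _ _).1 h.symm)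
  have hopp : ∀ bb : Module.Basis (Fin r) ℝ (Euc r), bb.orientation = -(stdBasis r).orientation →
      (stdBasis r).det bb * |((stdBasis r).det bb)⁻¹| = -1 := by
    intro bb h
    refine mul_abs_inv_of_neg (lt_of_le_of_ne (not_lt.1 fun hpos => ?_) ?_)
    · rw [← Module.Basis.orientation_eq_iff_det_pos, h] at hpos
      exact Module.Ray.ne_neg_self _ hpos
    · exact (Module.Basis.isUnit_det _ bb).ne_zero
  rcases (stdBasis r).orientation_eq_or_eq_neg o₀ with h0 | h0
  · refine ⟨1, ?_⟩
    filter_upwards [ho₀, hbase] with p hop hpe φ hφ hpφ τ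
    have hop' : Orientation.map (Fin r) (e.linearEquivAt ℝ p hpe) (o p) = o₀ := hop hpe
    have hor : ∀ b : Module.Basis (Fin r) ℝ (E p), (b.map (e.linearEquivAt ℝ p hpe)).orientation =
        Orientation.map (Fin r) (e.linearEquivAt ℝ p hpe) b.orientation := fun b =>
      b.orientation_map _
    constructor
    · intro h
      have h1 := h.1 ((stdBasis r).map (e.linearEquivAt ℝ p hpe).symm) (by
        rw [Module.Basis.orientation_map, ← h0, ← hop']
        simp [← Orientation.map_symm])
      rw [fiberIntegral_eq hφ τ hpφ hpe, hsame _ (by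
        rw [hor, Module.Basis.orientation_map]
        simp [← Orientation.map_symm]), one_mul] at h1
      exact h1
    · intro h
      constructor
      · intro b hb
        rw [fiberIntegral_eq hφ τ hpφ hpe, hsame _ (by rw [hor, hb, hop', h0]), h, one_mul]
      · intro b hb
        rw [fiberIntegral_eq hφ τ hpφ hpe, hopp _ (by
          rw [hor, hb, Orientation.map_neg, hop', h0]), h, mul_one]
  · refine ⟨-1, ?_⟩
    filter_upwards [ho₀, hbase] with p hop hpe φ hφ hpφ τ
    have hop' : Orientation.map (Fin r) (e.linearEquivAt ℝ p hpe) (o p) = o₀ := hop hpe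
    have hor : ∀ b : Module.Basis (Fin r) ℝ (E p), (b.map (e.linearEquivAt ℝ p hpe)).orientation =
        Orientation.map (Fin r) (e.linearEquivAt ℝ p hpe) b.orientation := fun b =>
      b.orientation_map _
    constructor
    · intro h
      -- Here the standard basis, transported to the fibre, has the orientation `-o p`, so the
      -- clause with integral -1 applies.
      have h1 := h.2 ((stdBasis r).map (e.linearEquivAt ℝ p hpe).symm) (by
        rw [Module.Basis.orientation_map, ← neg_neg (stdBasis r).orientation, ← h0, ← hop',
          Orientation.map_neg]
        simp [← Orientation.map_symm])
      rw [fiberIntegral_eq hφ τ hpφ hpe, hsame _ (by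
        rw [hor, Module.Basis.orientation_map]
        simp [← Orientation.map_symm]), one_mul] at h1
      exact h1
    · intro h
      constructor
      · intro b hb
        rw [fiberIntegral_eq hφ τ hpφ hpe, hopp _ (by rw [hor, hb, hop', h0]), h]
        norm_num
      · intro b hb
        rw [fiberIntegral_eq hφ τ hpφ hpe, hsame _ (by
          rw [hor, hb, Orientation.map_neg, hop', h0]
          exact neg_neg (stdBasis r).orientation), h, one_mul]

end FibreIntegral

/-! ### Compactness in the vertical direction -/

section Proper

variable {r : ℕ} {M : Type*} [TopologicalSpace M] [LocallyCompactSpace M]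
  {E : M → Type*} [TopologicalSpace (TotalSpace (EuclideanSpace ℝ (Fin r)) E)]
  [∀ p, TopologicalSpace (E p)] [FiberBundle (EuclideanSpace ℝ (Fin r)) E]

/-- Near `p` the set `Z` is contained in a compact set. -/
def LocallyProper (Z : Set (TotalSpace (Euc r) E)) (p : M) : Prop :=
  ∃ K : Set (TotalSpace (Euc r) E), IsCompact K ∧ ∀ᶠ q in 𝓝 p, ∀ v, v.proj = q → v ∈ Z → v ∈ K

variable {Z : Set (TotalSpace (Euc r) E)} {p : M} {e : Trivialization (Euc r) (π (Euc r) E)}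

/-- Over a compact neighbourhood inside the base set, vectors of bounded norm form a compact set,
and conversely the norm is bounded on compact sets. The right side is free of trivializations and
can be compared across charts. -/
theorem exists_bound_iff_locallyProper [T2Space M] (hp : p ∈ e.baseSet) :
    (∃ R : ℝ, ∀ᶠ q in 𝓝 p, ∀ v : TotalSpace (Euc r) E, v.proj = q → v ∈ Z → ‖(e v).2‖ ≤ R) ↔
      LocallyProper Z p := by
  obtain ⟨N, hN, hNe, hNc⟩ := local_compact_nhds (e.open_baseSet.mem_nhds hp)
  constructor
  · rintro ⟨R, hR⟩
    refine ⟨e.toOpenPartialHomeomorph.symm '' (N ×ˢ Metric.closedBall (0 : Euc r) R),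
      (hNc.prod (isCompact_closedBall _ _)).image_of_continuousOn
        (e.toOpenPartialHomeomorph.continuousOn_symm.mono fun x hx => ?_), ?_⟩
    · rw [e.target_eq]
      exact ⟨hNe hx.1, mem_univ _⟩
    · filter_upwards [hR, hN] with q hq hqN v hv hvZ
      subst hv
      refine ⟨(v.proj, (e v).2), ⟨hqN, ?_⟩, e.symm_apply_mk_proj (e.mem_source.2 (hNe hqN))⟩
      rw [mem_closedBall_zero_iff]
      exact hq v rfl hvZ
  · rintro ⟨K, hK, hKZ⟩
    have h1 : IsCompact (K ∩ TotalSpace.proj ⁻¹' N) :=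
      hK.inter_right (hNc.isClosed.preimage (FiberBundle.continuous_proj (Euc r) E))
    have h2 : ContinuousOn (fun v => ‖(e v).2‖) (K ∩ TotalSpace.proj ⁻¹' N) := by
      refine (continuous_snd.comp_continuousOn (e.continuousOn.mono fun v hv => ?_)).norm
      exact e.mem_source.2 (hNe hv.2)
    obtain ⟨R, hR⟩ := h1.bddAbove_image h2
    refine ⟨R, ?_⟩
    filter_upwards [hKZ, hN] with q hq hqN v hv hvZ
    subst hv
    exact hR ⟨v, ⟨hq v rfl hvZ, hqN⟩, rfl⟩

theorem LocallyProper.closure [T2Space M] (h : LocallyProper Z p) :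
    LocallyProper (closure Z) p := by
  set e := trivializationAt (Euc r) E p
  have hp : p ∈ e.baseSet := FiberBundle.mem_baseSet_trivializationAt' p
  rw [← exists_bound_iff_locallyProper hp] at h ⊢
  obtain ⟨R, hR⟩ := h
  refine ⟨R, ?_⟩
  filter_upwards [eventually_eventually_nhds.2 hR, e.open_baseSet.mem_nhds hp] with q hq hqe v hv hvZ
  subst hv
  have h1 : ContinuousAt (fun v => ‖(e v).2‖) v :=
    (continuous_snd.continuousAt.comp (e.continuousOn.continuousAt
      (e.open_source.mem_nhds (e.mem_source.2 hqe)))).norm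
  have h2 := (FiberBundle.continuous_proj (Euc r) E).continuousAt.eventually hq
  have h3 : ∃ᶠ v' in 𝓝 v, v' ∈ Z := mem_closure_iff_frequently.1 hvZ
  refine le_of_tendsto_of_frequently h1 ?_
  exact (h3.and_eventually h2).mono fun v' hv' => hv'.2 v' rfl hv'.1

/-- Finitely many of the local compact sets suffice over the compact set `K`. This turns the local
condition into vertical compactness. -/
theorem isCompact_closure_inter_of_locallyProper [T2Space M] (h : ∀ p, LocallyProper Z p)
    {K : Set M} (hK : IsCompact K) : IsCompact (closure Z ∩ TotalSpace.proj ⁻¹' K) := by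
  choose A hA hAZ using fun p => (h p).closure
  obtain ⟨t, ht⟩ := hK.elim_nhds_subcover' (fun p _ => {q | ∀ v : TotalSpace (Euc r) E,
    v.proj = q → v ∈ closure Z → v ∈ A p}) (fun p _ => hAZ p)
  · refine (t.isCompact_biUnion fun p _ => hA p).of_isClosed_subset
      (isClosed_closure.inter (hK.isClosed.preimage (FiberBundle.continuous_proj (Euc r) E))) ?_
    rintro v ⟨hv, hvK⟩
    obtain ⟨q, hq, hvq⟩ := mem_iUnion₂.1 (ht hvK)
    exact mem_iUnion₂.2 ⟨q, hq, hvq v rfl hv⟩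

/-- As `S` is closed, a compact neighbourhood in `M` meets it in a compact subset of `S`, to which
the hypothesis applies. -/
theorem locallyProper_of_isCompact [T2Space M] {S : Set M} (hS : IsClosed S)
    (hZ : ∀ v ∈ Z, v.proj ∈ S)
    (h : ∀ K ⊆ S, IsCompact K → IsCompact (closure Z ∩ TotalSpace.proj ⁻¹' K)) (p : M) :
    LocallyProper Z p := by
  obtain ⟨N, hNc, hN⟩ := exists_compact_mem_nhds p
  refine ⟨_, h (N ∩ S) inter_subset_right (hNc.inter_right hS), ?_⟩
  filter_upwards [hN] with q hq v hv hvZ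
  subst hv
  exact ⟨subset_closure hvZ, hq, hZ v hvZ⟩

end Proper

/-! ### Flat forms and forms on the total space -/

section FlatConversion

variable {n r : ℕ} {M : Type*} [TopologicalSpace M] [ChartedSpace (EuclideanQuadrant n) M]
  {E : M → Type*} [TopologicalSpace (TotalSpace (EuclideanSpace ℝ (Fin r)) E)]
  [∀ p, TopologicalSpace (E p)] [FiberBundle (EuclideanSpace ℝ (Fin r)) E]
  [∀ p, AddCommGroup (E p)] [∀ p, Module ℝ (E p)]
  [VectorBundle ℝ (Euc r) E] [IsManifold (Quad n) ∞ M] [ContMDiffVectorBundle ∞ (Euc r) E (Quad n)]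
  {φ : OpenPartialHomeomorph M (EuclideanQuadrant n)} {e : Trivialization (Euc r) (π (Euc r) E)}
  [MemTrivializationAtlas e] {k : ℕ} {u : Set (Euc n)}

theorem exists_projection {V : Type*} [NormedAddCommGroup V] [NormedSpace ℝ V]
    [FiniteDimensional ℝ V] (P : Submodule ℝ V) : ∃ f : V →L[ℝ] P, ∀ x : P, f x = x :=
  Submodule.ClosedComplemented.of_finiteDimensional_quotient P.closed_of_finiteDimensional

/-- Precompose at each point with a linear projection onto the tangent space over `S`. No regularity
is claimed; the purpose is to give forms over `S` a coordinate expression `toFlat`. -/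
theorem exists_extension {S : Set M} (τ : FormOver n r E S k) :
    ∃ α : BundleForm n r E k, ∀ v hv, restrictTo S α v hv = τ v hv := by
  classical
  choose f hf using fun v : TotalSpace (Euc r) E =>
    exists_projection (V := Euc n × Euc r) (tangentOver (n := n) S v)
  refine ⟨fun v => if hv : v.proj ∈ S then
    (τ v hv).compContinuousLinearMap (f v) else 0, fun v hv => ?_⟩
  ext ws
  have h1 : restrictTo S (fun v => if hv : v.proj ∈ S then
      (τ v hv).compContinuousLinearMap (f v) else 0) v hv ws = (if hv : v.proj ∈ S then
      (τ v hv).compContinuousLinearMap (f v) else 0) fun j => ((ws j : tangentOver (n := n) S v) : TangentSpace (totalModel n r) v) := rfl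
  rw [h1, dif_pos hv]
  exact congrArg (τ v hv) (funext fun j => hf v (ws j))

/-- An extension (possibly discontinuous) of a form over `S` to a form on the total space. -/
def extension {S : Set M} (τ : FormOver n r E S k) : BundleForm n r E k :=
  (exists_extension τ).choose

theorem restrictTo_extension {S : Set M} (τ : FormOver n r E S k) (v : TotalSpace (Euc r) E)
    (hv : v.proj ∈ S) : restrictTo S (extension τ) v hv = τ v hv :=
  (exists_extension τ).choose_spec v hv

theorem fiberIntegral_extension {S : Set M} (τ : FormOver n r E S r) {p : M} (hp : p ∈ S)
    (b : Module.Basis (Fin r) ℝ (E p)) : fiberIntegral (extension τ) p b = τ.fiberIntegral p hp b := by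
  unfold fiberIntegral FormOver.fiberIntegral
  refine integral_congr_ae (Eventually.of_forall fun x => ?_)
  simp only [← restrictTo_extension τ (fiberMap p b x) hp]
  rfl

theorem toFlat_zero (α : BundleForm n r E k) {z : Euc n × Euc r} (h : α (bundleParam φ e z) = 0) :
    toFlat φ e α z = 0 := pull_zero h

theorem contDiffOn_toFlat (hφ : φ ∈ IsManifold.maximalAtlas (Quad n) ∞ M)
    (hu : u ⊆ chartDomain φ e) {α : BundleForm n r E k}
    (hα : ∀ x ∈ range (Quad n) ∩ u, ∀ v : TotalSpace (Euc r) E,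
      v.proj = (φ.extend (Quad n)).symm x → SmoothAt α v) :
    ContDiffOn ℝ ∞ (toFlat φ e α) ((range (Quad n) ×ˢ univ) ∩ (u ×ˢ univ)) := by
  intro z hz
  have hz' : z.1 ∈ range (Quad n) ∩ chartDomain φ e := ⟨hz.1.1, hu hz.2.1⟩
  exact (contDiffWithinAt_pull isRegularDomain_quad.uniqueDiffOn hz.1
    (contMDiffWithinAt_bundleParam hφ hz')
    (hα z.1 ⟨hz.1.1, hz.2.1⟩ _ (proj_bundleParam hz'))).mono inter_subset_left

theorem extDerivWithin_toFlat (hφ : φ ∈ IsManifold.maximalAtlas (Quad n) ∞ M)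
    {α : BundleForm n r E k} {z : Euc n × Euc r}
    (hz : z.1 ∈ range (Quad n) ∩ chartDomain φ e) (hα : SmoothAt α (bundleParam φ e z)) :
    extDerivWithin (toFlat φ e α) (range (Quad n) ×ˢ univ) z = toFlat φ e α.d z :=
  extDerivWithin_pull isRegularDomain_quad ⟨hz.1, mem_univ _⟩
    (contMDiffWithinAt_bundleParam hφ hz) hα

theorem toFlat_support [T2Space M] [LocallyCompactSpace M] {Z : Set (TotalSpace (Euc r) E)} {x : Euc n}
    (hx : x ∈ range (Quad n) ∩ chartDomain φ e)
    (h : LocallyProper Z ((φ.extend (Quad n)).symm x)) :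
    ∃ R : ℝ, ∀ᶠ x' in 𝓝[range (Quad n)] x, ∀ y, R < ‖y‖ → bundleParam φ e (x', y) ∉ Z := by
  obtain ⟨R, hR⟩ := (exists_bound_iff_locallyProper (symm_mem_baseSet hx)).2 h
  refine ⟨R, ?_⟩
  filter_upwards [(tendsto_extend_symm hx).eventually hR, eventually_mem_chartDomain hx] with
    x' hx' hx'e y hy hcon
  have h1 := hx' _ (proj_bundleParam (z := (x', y)) hx'e) hcon
  have h2 := congrArg Prod.snd (bundleChart_bundleParam (z := (x', y)) hx'e)
  have h3 : (e (bundleParam φ e (x', y))).2 = y := h2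
  rw [h3] at h1
  exact absurd h1 (not_le.2 hy)

theorem isFlatForm_toFlat [T2Space M] [LocallyCompactSpace M] (hφ : φ ∈ IsManifold.maximalAtlas (Quad n) ∞ M)
    (hu : u ⊆ chartDomain φ e) {α : BundleForm n r E k}
    (hα : ∀ x ∈ range (Quad n) ∩ u, ∀ v : TotalSpace (Euc r) E,
      v.proj = (φ.extend (Quad n)).symm x → SmoothAt α v)
    (hd : ∀ x ∈ range (Quad n) ∩ u, ∀ v : TotalSpace (Euc r) E,
      v.proj = (φ.extend (Quad n)).symm x → α.d v = 0)
    (hs : ∀ x ∈ range (Quad n) ∩ u, LocallyProper {v | α v ≠ 0} ((φ.extend (Quad n)).symm x)) :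
    IsFlatForm (range (Quad n)) u (toFlat φ e α) := by
  refine ⟨contDiffOn_toFlat hφ hu hα, fun z hz => ?_, fun x hx => ?_⟩
  · have hz' : z.1 ∈ range (Quad n) ∩ chartDomain φ e := ⟨hz.1.1, hu hz.2.1⟩
    rw [extDerivWithin_toFlat hφ hz' (hα z.1 ⟨hz.1.1, hz.2.1⟩ _ (proj_bundleParam hz'))]
    exact toFlat_zero _ (hd z.1 ⟨hz.1.1, hz.2.1⟩ _ (proj_bundleParam hz'))
  · obtain ⟨R, hR⟩ := toFlat_support ⟨hx.1, hu hx.2⟩ (hs x hx)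
    refine ⟨R, ?_⟩
    filter_upwards [hR] with x' hx' y hy
    exact toFlat_zero _ (not_not.1 (hx' y hy))

/-- The pullback of a Thom form over `S` under the retraction to `S` in a chart. -/
theorem isFlatForm_extension [T2Space M] [LocallyCompactSpace M] (hφ : φ ∈ IsManifold.maximalAtlas (Quad n) ∞ M)
    (huo : IsOpen u) (hu : u ⊆ chartDomain φ e) {S : Set M} {L : Euc n →L[ℝ] Euc n} {c : Euc n}
    (hL : AffineRetraction (range (Quad n)) L c)
    (hLu : ∀ x ∈ range (Quad n) ∩ u, L x + c ∈ u)
    (hS : ∀ x ∈ range (Quad n) ∩ u, ((φ.extend (Quad n)).symm x ∈ S ↔ L x + c = x))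
    {τ : FormOver n r E S k} (hτ : τ.IsSmooth) (hd : τ.IsClosed)
    (hs : ∀ p, LocallyProper {v | ∃ hv : v.proj ∈ S, τ v hv ≠ 0} p) :
    IsFlatForm (range (Quad n)) u fun z =>
      (toFlat φ e (extension τ) (L z.1 + c, z.2)).compContinuousLinearMap (baseMap r L) := by
  have heq : ∀ z : Euc n × Euc r, (L z.1 + c, z.2) = baseMap r L z + (c, 0) := by
    intro z; simp
  set C : Set (Euc n × Euc r) := range (Quad n) ×ˢ univ with hC
  set A : Euc n × Euc r → Euc n × Euc r := fun z => (L z.1 + c, z.2) with hA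
  have hAC : ∀ z ∈ C ∩ u ×ˢ univ, A z ∈ C ∩ u ×ˢ univ := fun z hz =>
    ⟨⟨hL.mem _ hz.1.1, mem_univ _⟩, ⟨hLu _ ⟨hz.1.1, hz.2.1⟩, mem_univ _⟩⟩
  have hAc : Continuous A := by fun_prop
  have hcut : ∀ x ∈ range (Quad n) ∩ u, IsCutBy φ S L c ((φ.extend (Quad n)).symm x) := by
    intro x hx
    have hx' : x ∈ range (Quad n) ∩ chartDomain φ e := ⟨hx.1, hu hx.2⟩
    have hc := φ.continuousAt_extend (I := Quad n) (symm_mem_source hx')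
    have h1 : u ∈ 𝓝 (φ.extend (Quad n) ((φ.extend (Quad n)).symm x)) := by
      rw [extend_symm_eq hx']
      exact huo.mem_nhds hx.2
    filter_upwards [hc h1, φ.open_source.mem_nhds (symm_mem_source hx')] with q hq hqs
    have h2 := hS (φ.extend (Quad n) q) ⟨mem_range_self _, hq⟩
    rwa [φ.extend_left_inv hqs] at h2
  -- two forms that agree over `S` near a point
  have hagree : ∀ (α β : BundleForm n r E k) (z), z ∈ C ∩ u ×ˢ univ →
      (∀ hv, restrictTo S α (bundleParam φ e (A z)) hv =
        restrictTo S β (bundleParam φ e (A z)) hv) →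
      (toFlat φ e α (A z)).compContinuousLinearMap (baseMap r L) =
        (toFlat φ e β (A z)).compContinuousLinearMap (baseMap r L) := by
    intro α β z hz h
    have hAz := hAC z hz
    have hAz' : (A z).1 ∈ range (Quad n) ∩ chartDomain φ e := ⟨hAz.1.1, hu hAz.2.1⟩
    have hp := proj_bundleParam (φ := φ) (e := e) hAz'
    have hmem : (bundleParam φ e (A z)).proj ∈ S := by
      rw [hp]
      exact (hS _ ⟨hAz.1.1, hAz.2.1⟩).2 (hL.idem z.1)
    have h1 := (restrictTo_eq_iff (e := e) hφ hL α β (v := bundleParam φ e (A z)) (by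
      rw [hp]; exact symm_mem_source hAz') (by rw [hp]; exact symm_mem_baseSet hAz') hmem (by
      rw [hp]; exact hcut _ ⟨hAz.1.1, hAz.2.1⟩)).1 (h hmem)
    rwa [bundleChart_bundleParam hAz'] at h1
  -- After composition with the retraction only restrictions to `S` matter. So near each point the
  -- irregular extension may be replaced by a smooth form `α` that restricts to `τ`, and `dα`
  -- restricts to zero since `τ` is closed.
  have key : ∀ z ∈ C ∩ u ×ˢ univ, ∃ α : BundleForm n r E k, α.IsSmooth ∧
      (∀ hv, restrictTo S α.d (bundleParam φ e (A z)) hv = 0) ∧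
      (fun z => (toFlat φ e (extension τ) (A z)).compContinuousLinearMap (baseMap r L)) =ᶠ[𝓝[C] z]
        fun z => (toFlat φ e α (A z)).compContinuousLinearMap (baseMap r L) := by
    intro z hz
    have hAz := hAC z hz
    have hAz' : (A z).1 ∈ range (Quad n) ∩ chartDomain φ e := ⟨hAz.1.1, hu hAz.2.1⟩
    have hp := proj_bundleParam (φ := φ) (e := e) hAz'
    have hmem : (bundleParam φ e (A z)).proj ∈ S := by
      rw [hp]
      exact (hS _ ⟨hAz.1.1, hAz.2.1⟩).2 (hL.idem z.1)
    obtain ⟨α, hα, hατ⟩ := hτ _ hmem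
    refine ⟨α, hα, fun hv => hd _ hv α hα hατ, ?_⟩
    have ht : Tendsto (fun y => bundleParam φ e (A y)) (𝓝[C] z) (𝓝 (bundleParam φ e (A z))) := by
      have h1 : Tendsto (bundleParam φ e) (𝓝[C] (A z)) (𝓝 (bundleParam φ e (A z))) :=
        (contMDiffWithinAt_bundleParam hφ hAz').continuousWithinAt
      refine h1.comp ?_
      exact hAc.continuousWithinAt.tendsto_nhdsWithin fun y hy =>
        ⟨hL.mem _ hy.1, mem_univ _⟩
    filter_upwards [ht.eventually hατ, self_mem_nhdsWithin,
      mem_nhdsWithin_of_mem_nhds ((isOpen_prod_univ (r := r) huo).mem_nhds hz.2)] with y hy hyC hyu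
    refine hagree _ _ y ⟨hyC, hyu⟩ fun hv => ?_
    rw [restrictTo_extension, hy hv]
  have hsm : ∀ α : BundleForm n r E k, α.IsSmooth → ContDiffOn ℝ ∞ (toFlat φ e α) (C ∩ u ×ˢ univ) :=
    fun α hα => contDiffOn_toFlat hφ hu fun _ _ v _ => isSmooth_iff.1 hα v
  refine ⟨fun z hz => ?_, fun z hz => ?_, fun x hx => ?_⟩
  · obtain ⟨α, hα, -, h⟩ := key z hz
    refine ContDiffWithinAt.congr_of_eventuallyEq ?_
      (h.filter_mono (nhdsWithin_mono _ inter_subset_left)) (h.self_of_nhdsWithin hz.1)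
    refine ContDiffWithinAt.compContinuousLinearMap_alternating ?_ contDiffWithinAt_const
    exact ContDiffWithinAt.comp z (hsm α hα _ (hAC z hz)) (by fun_prop) fun y hy => hAC y hy
  · obtain ⟨α, hα, hαd, h⟩ := key z hz
    have hAz := hAC z hz
    have hAz' : (A z).1 ∈ range (Quad n) ∩ chartDomain φ e := ⟨hAz.1.1, hu hAz.2.1⟩
    rw [h.extDerivWithin_eq_of_mem hz.1]
    have h2 := extDerivWithin_comp_affine (L := baseMap r L) (c := (c, 0)) (x := z)
      (convex_prod_univ (Quad n).convex_range)
      (interior_prod_univ_nonempty (Quad n).nonempty_interior) (isOpen_prod_univ huo)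
      (fun y hy => by
        rw [← heq]
        exact ⟨hL.mem _ hy.1, mem_univ _⟩) (hsm α hα) hz.1 (by rw [← heq]; exact hAz.2)
    simp only [← heq] at h2
    refine h2.trans ?_
    have h3 := extDerivWithin_toFlat (e := e) hφ hAz' (isSmooth_iff.1 hα _)
    have h4 : extDerivWithin (toFlat φ e α) C (L z.1 + c, z.2) = toFlat φ e α.d (A z) := h3
    rw [h4]
    have h5 : ∀ (β : BundleForm n r E (k + 1)), (∀ hv, restrictTo S β (bundleParam φ e (A z)) hv = 0) →
        (toFlat φ e β (A z)).compContinuousLinearMap (baseMap r L) = 0 := by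
      intro β hβ
      have hp := proj_bundleParam (φ := φ) (e := e) hAz'
      have hmem : (bundleParam φ e (A z)).proj ∈ S := by
        rw [hp]
        exact (hS _ ⟨hAz.1.1, hAz.2.1⟩).2 (hL.idem z.1)
      have h1 := (restrictTo_eq_iff (e := e) hφ hL β 0 (v := bundleParam φ e (A z)) (by
        rw [hp]; exact symm_mem_source hAz') (by rw [hp]; exact symm_mem_baseSet hAz') hmem (by
        rw [hp]; exact hcut _ ⟨hAz.1.1, hAz.2.1⟩)).1 (by rw [hβ]; rfl)
      rw [bundleChart_bundleParam hAz'] at h1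
      rw [h1]
      rfl
    exact h5 _ hαd
  · have hAx : L x + c ∈ range (Quad n) ∩ chartDomain φ e := ⟨hL.mem _ hx.1, hu (hLu x hx)⟩
    obtain ⟨R, hR⟩ := toFlat_support (e := e) hAx (hs _)
    refine ⟨R, ?_⟩
    have ht : Tendsto (fun x => L x + c) (𝓝[range (Quad n)] x) (𝓝[range (Quad n)] (L x + c)) := by
      have : ContinuousWithinAt (fun x => L x + c) (range (Quad n)) x := by fun_prop
      exact this.tendsto_nhdsWithin fun y hy => hL.mem y hy
    filter_upwards [ht.eventually hR, self_mem_nhdsWithin,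
      mem_nhdsWithin_of_mem_nhds (huo.mem_nhds hx.2)] with x' hx' hx'Q hx'u y hy
    have h1 := hagree (extension τ) 0 (x', y) ⟨⟨hx'Q, mem_univ _⟩, ⟨hx'u, mem_univ _⟩⟩ (by
      intro hv
      rw [restrictTo_extension]
      by_contra hcon
      exact hx' y hy ⟨hv, hcon⟩)
    exact h1

/-- The way back from coordinates: smoothness, closedness and vertical boundedness of a flat form
are inherited by the form on the total space. -/
theorem IsFlatForm.goodAt [T2Space M] [LocallyCompactSpace M] (hφ : φ ∈ IsManifold.maximalAtlas (Quad n) ∞ M)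
    (huo : IsOpen u) (hu : u ⊆ chartDomain φ e)
    {a : Euc n × Euc r → (Euc n × Euc r) [⋀^Fin k]→L[ℝ] ℝ}
    (ha : IsFlatForm (range (Quad n)) u a) {p : M} (hp : p ∈ φ.source)
    (hpu : φ.extend (Quad n) p ∈ u) :
    (∀ v : TotalSpace (Euc r) E, v.proj = p →
      SmoothAt (ofFlat (J := totalModel n r) (bundleChart φ e) a) v ∧
      (ofFlat (J := totalModel n r) (bundleChart φ e) a).d v = 0) ∧
    LocallyProper {v : TotalSpace (Euc r) E |
      ofFlat (J := totalModel n r) (bundleChart φ e) a v ≠ 0} p := by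
  have hx : φ.extend (Quad n) p ∈ range (Quad n) ∩ u := ⟨mem_range_self _, hpu⟩
  have hpe : p ∈ e.baseSet := by
    have := symm_mem_baseSet (φ := φ) (e := e) ⟨hx.1, hu hx.2⟩
    rwa [φ.extend_left_inv hp] at this
  refine ⟨fun v hv => ?_, ?_⟩
  · subst hv
    have hz : bundleChart φ e v ∈ (range (Quad n) ×ˢ univ) ∩ (u ×ˢ univ) :=
      ⟨⟨hx.1, mem_univ _⟩, ⟨hx.2, mem_univ _⟩⟩
    have h1 : ContDiffWithinAt ℝ ∞ a (range (Quad n) ×ˢ univ) (bundleChart φ e v) :=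
      ContDiffOn.contDiffWithinAt_of_isOpen (isOpen_prod_univ huo) ha.smooth hz
    exact ⟨smoothAt_ofFlat (contMDiffAt_bundleChart hφ hp hpe) bundleChart_mem h1,
      d_ofFlat_eq_zero (contMDiffAt_bundleChart hφ hp hpe) bundleChart_mem
        (h1.differentiableWithinAt (by simp)) (ha.closed _ hz)⟩
  · rw [← exists_bound_iff_locallyProper hpe]
    obtain ⟨R, hR⟩ := ha.support _ hx
    refine ⟨R, ?_⟩
    have ht : Tendsto (φ.extend (Quad n)) (𝓝 p) (𝓝[range (Quad n)] (φ.extend (Quad n) p)) :=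
      tendsto_nhdsWithin_iff.2 ⟨φ.continuousAt_extend hp, Eventually.of_forall fun q => mem_range_self _⟩
    filter_upwards [ht.eventually hR] with q hq v hv hvZ
    subst hv
    by_contra! hcon
    refine hvZ ?_
    unfold ofFlat
    have h2 : a (bundleChart φ e v) = 0 := hq _ hcon
    rw [h2]
    rfl

end FlatConversion

/-! ### Coordinate subspaces -/

section Coordinates

variable {n : ℕ}

/-- The projection that sets the coordinates in `K` to `0`. -/
def coordProj (K : Finset (Fin n)) : Euc n →L[ℝ] Euc n :=
  LinearMap.toContinuousLinearMap
    { toFun := fun x => WithLp.toLp 2 fun c => if c ∈ K then 0 else x c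
      map_add' := fun x y => by
        ext c
        by_cases h : c ∈ K <;> simp [h]
      map_smul' := fun a x => by
        ext c
        by_cases h : c ∈ K <;> simp [h] }

/-- The point with the coordinates of `x₀` in `K`, and `0` otherwise. -/
def coordConst (K : Finset (Fin n)) (x₀ : Euc n) : Euc n :=
  WithLp.toLp 2 fun c => if c ∈ K then x₀ c else 0

theorem coordProj_add_apply (K : Finset (Fin n)) (x₀ x : Euc n) (c : Fin n) :
    (coordProj K x + coordConst K x₀) c = if c ∈ K then x₀ c else x c := by
  by_cases h : c ∈ K <;> simp [coordProj, coordConst, h]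

theorem coordProj_add_eq_iff (K : Finset (Fin n)) (x₀ x : Euc n) :
    coordProj K x + coordConst K x₀ = x ↔ ∀ c ∈ K, x c = x₀ c := by
  constructor
  · intro h c hc
    rw [← h, coordProj_add_apply, if_pos hc]
  · intro h
    ext c
    rw [coordProj_add_apply]
    split_ifs with hc
    · exact (h c hc).symm
    · rfl

/-- Both sides take the coordinates in `K` and `K'` from the same point `x₀` and keep the others.
The commutation rests on having a single chart for all the submanifolds. -/
theorem coordProj_add_comm (K K' : Finset (Fin n)) (x₀ x : Euc n) :
    coordProj K (coordProj K' x + coordConst K' x₀) + coordConst K x₀ =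
      coordProj K' (coordProj K x + coordConst K x₀) + coordConst K' x₀ := by
  ext c
  simp only [coordProj_add_apply]
  split_ifs <;> rfl

theorem coordProj_comp (K K' : Finset (Fin n)) :
    (coordProj K).comp (coordProj K') = coordProj (K ∪ K') := by
  ext x c
  by_cases h : c ∈ K <;> by_cases h' : c ∈ K' <;> simp [coordProj, h, h']

theorem range_quad : range (Quad n) = {x | ∀ i, 0 ≤ x i} := range_euclideanQuadrant n

theorem affineRetraction_coordProj (K : Finset (Fin n)) {x₀ : Euc n} (hx₀ : x₀ ∈ range (Quad n)) :
    AffineRetraction (range (Quad n)) (coordProj K) (coordConst K x₀) where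
  mem := fun x hx => by
    rw [range_quad] at *
    intro c
    rw [coordProj_add_apply]
    split_ifs
    · exact hx₀ c
    · exact hx c
  idem := fun x => by
    rw [coordProj_add_eq_iff]
    intro c hc
    rw [coordProj_add_apply, if_pos hc]

/-- Replacing coordinates by those of the centre decreases the distance to the centre, so balls
around `x₀` are preserved by all the retractions. -/
theorem coordProj_mem_ball (K : Finset (Fin n)) {x₀ x : Euc n} {ρ : ℝ} (hx : x ∈ Metric.ball x₀ ρ) :
    coordProj K x + coordConst K x₀ ∈ Metric.ball x₀ ρ := by
  refine Metric.mem_ball.2 (lt_of_le_of_lt ?_ (Metric.mem_ball.1 hx))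
  rw [EuclideanSpace.dist_eq, EuclideanSpace.dist_eq]
  refine Real.sqrt_le_sqrt (Finset.sum_le_sum fun c _ => ?_)
  rw [coordProj_add_apply]
  split_ifs
  · rw [dist_self, zero_pow two_ne_zero]
    positivity
  · exact le_rfl

end Coordinates

/-! ### Local models -/

section Local

variable {n r : ℕ} {M : Type*} [TopologicalSpace M] [ChartedSpace (EuclideanQuadrant n) M]
  {E : M → Type*} [TopologicalSpace (TotalSpace (EuclideanSpace ℝ (Fin r)) E)]
  [∀ p, TopologicalSpace (E p)] [FiberBundle (EuclideanSpace ℝ (Fin r)) E]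
  [∀ p, AddCommGroup (E p)] [∀ p, Module ℝ (E p)]
  [VectorBundle ℝ (Euc r) E] [IsManifold (Quad n) ∞ M] [ContMDiffVectorBundle ∞ (Euc r) E (Quad n)]
  {ι : Type*}

/-- The chart `φ`, the trivialization `e` and the open set `u` describe a part of the base over
which the submanifolds are coordinate subspaces, and `base` is a Thom form there that extends the
given forms. -/
structure ThomBox (o : ∀ p, Orientation ℝ (E p) (Fin r)) (S : ι → Set M)
    (τ : ∀ i, FormOver n r E (S i) r) where
  φ : OpenPartialHomeomorph M (EuclideanQuadrant n)
  e : Trivialization (Euc r) (π (Euc r) E)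
  u : Set (Euc n)
  s : Finset ι
  L : ι → Euc n →L[ℝ] Euc n
  c : ι → Euc n
  ε : ℝ
  base : Euc n × Euc r → (Euc n × Euc r) [⋀^Fin r]→L[ℝ] ℝ
  mem_maximalAtlas : φ ∈ IsManifold.maximalAtlas (Quad n) ∞ M
  memTrivializationAtlas : MemTrivializationAtlas e
  isOpen : IsOpen u
  subset : u ⊆ chartDomain φ e
  retraction : ∀ i ∈ s, AffineRetraction (range (Quad n)) (L i) (c i)
  cut : ∀ i ∈ s, ∀ x ∈ range (Quad n) ∩ u,
    ((φ.extend (Quad n)).symm x ∈ S i ↔ L i x + c i = x)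
  notMem : ∀ i ∉ s, ∀ x ∈ range (Quad n) ∩ u, (φ.extend (Quad n)).symm x ∉ S i
  thom : ∀ x ∈ range (Quad n) ∩ u, ∀ σ : BundleForm n r E r,
    HasThomIntegral o σ ((φ.extend (Quad n)).symm x) ↔ flatInt (toFlat φ e σ) x = ε
  flat : IsFlatForm (range (Quad n)) u base
  integral : ∀ x ∈ range (Quad n) ∩ u, flatInt base x = ε
  agrees : ∀ i ∈ s, ∀ x ∈ range (Quad n) ∩ u, L i x + c i = x → ∀ y,
    (base (x, y)).compContinuousLinearMap (baseMap r (L i)) =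
      (toFlat φ e (extension (τ i)) (x, y)).compContinuousLinearMap (baseMap r (L i))

theorem isCutBy_of_forall_mem {φ : OpenPartialHomeomorph M (EuclideanQuadrant n)}
    {u : Set (Euc n)} (huo : IsOpen u) {S : Set M}
    {L : Euc n →L[ℝ] Euc n} {c : Euc n}
    (hS : ∀ x ∈ range (Quad n) ∩ u, ((φ.extend (Quad n)).symm x ∈ S ↔ L x + c = x))
    {p : M} (hp : p ∈ φ.source) (hpu : φ.extend (Quad n) p ∈ u) : IsCutBy φ S L c p := by
  have hc := φ.continuousAt_extend (I := Quad n) hp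
  filter_upwards [hc (huo.mem_nhds hpu), φ.open_source.mem_nhds hp] with q hq hqs
  have h2 := hS (φ.extend (Quad n) q) ⟨mem_range_self _, hq⟩
  rwa [φ.extend_left_inv hqs] at h2

theorem hasThomIntegral_extension {o : ∀ p, Orientation ℝ (E p) (Fin r)} {S : Set M}
    {τ : FormOver n r E S r} (hτ : IsThomFormOver S o τ) {p : M} (hp : p ∈ S) :
    HasThomIntegral o (extension τ) p :=
  ⟨fun b hb => by rw [fiberIntegral_extension τ hp, hτ.integral_pos p hp b hb],
    fun b hb => by rw [fiberIntegral_extension τ hp, hτ.integral_neg p hp b hb]⟩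

theorem restrictTo_eq_of_restrict_eq {S T : Set M} {τ : FormOver n r E S r} {τ' : FormOver n r E T r}
    (h : τ.restrict (inter_subset_left : S ∩ T ⊆ S) = τ'.restrict (inter_subset_right : S ∩ T ⊆ T))
    (v : TotalSpace (Euc r) E) (hv : v.proj ∈ S ∩ T) :
    restrictTo (S ∩ T) (extension τ) v hv = restrictTo (S ∩ T) (extension τ') v hv := by
  have h1 : restrictTo (S ∩ T) (extension τ) v hv =
      τ.restrict (inter_subset_left : S ∩ T ⊆ S) v hv := by
    unfold FormOver.restrict
    rw [← restrictTo_extension τ v hv.1]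
    rfl
  have h2 : restrictTo (S ∩ T) (extension τ') v hv =
      τ'.restrict (inter_subset_right : S ∩ T ⊆ T) v hv := by
    unfold FormOver.restrict
    rw [← restrictTo_extension τ' v hv.2]
    rfl
  rw [h1, h2, h]

/-- In a clean chart take a ball around the image of `p₀` on which the trivialization is defined,
the sign `ε` is constant, and the closed sets `S i` that miss `p₀` do not occur. The retractions
preserve this ball, so the flat extension applies. -/
theorem exists_thomBox [T2Space M] [LocallyCompactSpace M] [Finite ι]
    {o : ∀ p, Orientation ℝ (E p) (Fin r)} (ho : IsBundleOrientation o) {S : ι → Set M}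
    (hclosed : ∀ i, IsClosed (S i)) (hclean : CleanFamily (n := n) S)
    {τ : ∀ i, FormOver n r E (S i) r} (hτ : ∀ i, IsThomFormOver (S i) o (τ i))
    (hagree : ∀ i j, (τ i).restrict (inter_subset_left : S i ∩ S j ⊆ S i) =
      (τ j).restrict (inter_subset_right : S i ∩ S j ⊆ S j)) (p₀ : M) :
    ∃ b : ThomBox o S τ, p₀ ∈ b.φ.source ∧ b.φ.extend (Quad n) p₀ ∈ b.u := by
  classical
  obtain ⟨φ, hφ, hp₀, hK⟩ := hclean p₀
  have hK' : ∀ i, ∃ K : Finset (Fin n), p₀ ∈ S i → ∀ x ∈ φ.source,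
      (x ∈ S i ↔ ∀ c ∈ K, (φ x).1 c = (φ p₀).1 c) := by
    intro i
    by_cases hi : p₀ ∈ S i
    · obtain ⟨K, hK⟩ := hK i hi
      exact ⟨K, fun _ => hK⟩
    -- A default value; indices of submanifolds that miss `p₀` are excluded from `s`.
    · exact ⟨∅, fun h => absurd h hi⟩
  choose K hK using hK'
  set e := trivializationAt (Euc r) E p₀
  have hpe : p₀ ∈ e.baseSet := FiberBundle.mem_baseSet_trivializationAt' p₀
  obtain ⟨ε, hε⟩ := exists_hasThomIntegral_iff (n := n) ho p₀
  set x₀ : Euc n := φ.extend (Quad n) p₀ with hx₀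
  have hx₀m : x₀ ∈ range (Quad n) ∩ chartDomain φ e := extend_mem hp₀ hpe
  have hx₀s : (φ.extend (Quad n)).symm x₀ = p₀ := φ.extend_left_inv hp₀
  have hN2 : ∀ᶠ p in 𝓝 p₀, ∀ i, p₀ ∉ S i → p ∉ S i := by
    rw [eventually_all]
    intro i
    by_cases hi : p₀ ∈ S i
    · exact Eventually.of_forall fun p h => absurd hi h
    · filter_upwards [(hclosed i).isOpen_compl.mem_nhds hi] with p hp _ using hp
  have ht := tendsto_extend_symm hx₀m
  rw [hx₀s] at ht
  obtain ⟨ρ, hρ, hball⟩ := Metric.mem_nhdsWithin_iff.1 (ht.eventually (hε.and hN2))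
  obtain ⟨ρ', hρ', hball'⟩ := Metric.isOpen_iff.1 (isOpen_chartDomain (φ := φ) (e := e)) x₀ hx₀m.2
  set u : Set (Euc n) := Metric.ball x₀ (min ρ ρ') with hu
  have huo : IsOpen u := Metric.isOpen_ball
  have hux₀ : x₀ ∈ u := Metric.mem_ball_self (lt_min hρ hρ')
  have huc : u ⊆ chartDomain φ e := (Metric.ball_subset_ball (min_le_right _ _)).trans hball'
  have hdom : ∀ x ∈ range (Quad n) ∩ u, x ∈ range (Quad n) ∩ chartDomain φ e :=
    fun x hx => ⟨hx.1, huc hx.2⟩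
  have hthom : ∀ x ∈ range (Quad n) ∩ u, ∀ σ : BundleForm n r E r,
      HasThomIntegral o σ ((φ.extend (Quad n)).symm x) ↔ flatInt (toFlat φ e σ) x = ε := by
    intro x hx σ
    have h1 := (hball ⟨Metric.ball_subset_ball (min_le_left _ _) hx.2, hx.1⟩).1 φ hφ
      (symm_mem_source (hdom x hx)) σ
    rwa [extend_symm_eq (hdom x hx)] at h1
  have hcoord : ∀ x ∈ range (Quad n) ∩ u, (φ ((φ.extend (Quad n)).symm x)).1 = x :=
    fun x hx => extend_symm_eq (hdom x hx)
  have hcut : ∀ i, p₀ ∈ S i → ∀ x ∈ range (Quad n) ∩ u,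
      ((φ.extend (Quad n)).symm x ∈ S i ↔ coordProj (K i) x + coordConst (K i) x₀ = x) := by
    intro i hi x hx
    rw [hK i hi _ (symm_mem_source (hdom x hx)), coordProj_add_eq_iff, hcoord x hx]
    rfl
  set s : Finset ι := (Set.toFinite {i | p₀ ∈ S i}).toFinset
  have hs : ∀ i, i ∈ s ↔ p₀ ∈ S i := fun i => by simp [s]
  have hret : ∀ i, AffineRetraction (range (Quad n)) (coordProj (K i)) (coordConst (K i) x₀) :=
    fun i => affineRetraction_coordProj (K i) hx₀m.1
  have hLu : ∀ i, ∀ x ∈ range (Quad n) ∩ u, coordProj (K i) x + coordConst (K i) x₀ ∈ u :=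
    fun i x hx => coordProj_mem_ball (K i) hx.2
  obtain ⟨σ, hσ, hσi, hσe⟩ := exists_flat_extension (Q := range (Quad n)) (u := u)
    (Quad n).convex_range (Quad n).nonempty_interior huo s (fun i => coordProj (K i))
    (fun i => coordConst (K i) x₀) (fun i => toFlat φ e (extension (τ i))) ε
    (fun i _ => hret i) (fun i _ => hLu i) (fun i _ j _ x => coordProj_add_comm _ _ _ _)
    (fun i hi => isFlatForm_extension hφ huo huc (hret i) (hLu i) (hcut i ((hs i).1 hi))
      (hτ i).smooth (hτ i).closed (locallyProper_of_isCompact (hclosed i) (fun v hv => hv.1)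
        (hτ i).compact_vertical))
    (fun i hi x hx => by
      rw [flatInt_pullback]
      have hx' : coordProj (K i) x + coordConst (K i) x₀ ∈ range (Quad n) ∩ u :=
        ⟨(hret i).mem x hx.1, hLu i x hx⟩
      exact (hthom _ hx' _).1 (hasThomIntegral_extension (hτ i)
        ((hcut i ((hs i).1 hi) _ hx').2 ((hret i).idem x))))
    (fun i hi j hj x hx hxi hxj y => by
      have hzx : ((x, y) : Euc n × Euc r).1 ∈ range (Quad n) ∩ chartDomain φ e := hdom x hx
      have hp := proj_bundleParam (φ := φ) (e := e) hzx
      -- The intersection is again a coordinate subspace, cut out by `K i ∪ K j`. So agreement over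
      -- it can be read off in coordinates.
      have hcut2 : ∀ x ∈ range (Quad n) ∩ u, ((φ.extend (Quad n)).symm x ∈ S i ∩ S j ↔
          coordProj (K i ∪ K j) x + coordConst (K i ∪ K j) x₀ = x) := by
        intro x hx
        rw [mem_inter_iff, hcut i ((hs i).1 hi) x hx, hcut j ((hs j).1 hj) x hx,
          coordProj_add_eq_iff, coordProj_add_eq_iff, coordProj_add_eq_iff]
        constructor
        · rintro ⟨h1, h2⟩ c hc
          rcases Finset.mem_union.1 hc with h | h
          · exact h1 c h
          · exact h2 c h
        · exact fun h => ⟨fun c hc => h c (Finset.mem_union_left _ hc),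
            fun c hc => h c (Finset.mem_union_right _ hc)⟩
      have hmem : (bundleParam φ e (x, y)).proj ∈ S i ∩ S j := by
        rw [hp]
        exact ⟨(hcut i ((hs i).1 hi) x hx).2 hxi, (hcut j ((hs j).1 hj) x hx).2 hxj⟩
      have hsrc : (bundleParam φ e (x, y)).proj ∈ φ.source := by
        rw [hp]; exact symm_mem_source hzx
      have h1 := (restrictTo_eq_iff (e := e) hφ
        (affineRetraction_coordProj (K i ∪ K j) hx₀m.1) (extension (τ i)) (extension (τ j))
        (v := bundleParam φ e (x, y)) hsrc (by rw [hp]; exact symm_mem_baseSet hzx) hmem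
        (isCutBy_of_forall_mem huo hcut2 hsrc (by
          rw [hp, extend_symm_eq hzx]; exact hx.2))).1
        (restrictTo_eq_of_restrict_eq (hagree i j) _ hmem)
      rw [bundleChart_bundleParam hzx] at h1
      rwa [coordProj_comp])
  exact ⟨{ φ := φ, e := e, u := u, s := s, L := fun i => coordProj (K i),
           c := fun i => coordConst (K i) x₀, ε := ε, base := σ, mem_maximalAtlas := hφ,
           memTrivializationAtlas := inferInstance, isOpen := huo, subset := huc,
           retraction := fun i _ => hret i, cut := fun i hi => hcut i ((hs i).1 hi),
           notMem := fun i hi x hx => (hball ⟨Metric.ball_subset_ball (min_le_left _ _) hx.2,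
             hx.1⟩).2 i (fun h => hi ((hs i).2 h)),
           thom := hthom, flat := hσ, integral := hσi, agrees := hσe }, hp₀, hux₀⟩

end Local

/-! ### The local extension step -/

section FlatLocal

variable {B : Type*} [NormedAddCommGroup B] [NormedSpace ℝ B] {k r : ℕ} {Q u : Set B}

theorem IsFlatForm.of_local
    {b : B × EuclideanSpace ℝ (Fin r) → (B × EuclideanSpace ℝ (Fin r)) [⋀^Fin k]→L[ℝ] ℝ}
    (h : ∀ x ∈ Q ∩ u, ∃ w, IsOpen w ∧ x ∈ w ∧
      ∃ β : B × EuclideanSpace ℝ (Fin r) → (B × EuclideanSpace ℝ (Fin r)) [⋀^Fin k]→L[ℝ] ℝ,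
        IsFlatForm Q w β ∧ ∀ x' ∈ Q ∩ w, ∀ y, b (x', y) = β (x', y)) : IsFlatForm Q u b := by
  refine ⟨fun z hz => ?_, fun z hz => ?_, fun x hx => ?_⟩
  · obtain ⟨w, hwo, hzw, β, hβ, hb⟩ := h z.1 ⟨hz.1.1, hz.2.1⟩
    have h1 : ContDiffWithinAt ℝ ∞ β (Q ×ˢ univ) z :=
      ContDiffOn.contDiffWithinAt_of_isOpen (isOpen_prod_univ hwo) hβ.smooth
        ⟨hz.1, hzw, mem_univ _⟩
    refine (h1.congr_of_eventuallyEq ?_ (hb z.1 ⟨hz.1.1, hzw⟩ z.2)).mono inter_subset_left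
    filter_upwards [self_mem_nhdsWithin, mem_nhdsWithin_of_mem_nhds
      ((isOpen_prod_univ (r := r) hwo).mem_nhds ⟨hzw, mem_univ z.2⟩)] with y hy hyw
    exact hb y.1 ⟨hy.1, hyw.1⟩ y.2
  · obtain ⟨w, hwo, hzw, β, hβ, hb⟩ := h z.1 ⟨hz.1.1, hz.2.1⟩
    have h1 : b =ᶠ[𝓝[Q ×ˢ univ] z] β := by
      filter_upwards [self_mem_nhdsWithin, mem_nhdsWithin_of_mem_nhds
        ((isOpen_prod_univ (r := r) hwo).mem_nhds ⟨hzw, mem_univ z.2⟩)] with y hy hyw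
      exact hb y.1 ⟨hy.1, hyw.1⟩ y.2
    rw [h1.extDerivWithin_eq_of_mem hz.1]
    exact hβ.closed z ⟨hz.1, hzw, mem_univ _⟩
  · obtain ⟨w, hwo, hxw, β, hβ, hb⟩ := h x hx
    obtain ⟨R, hR⟩ := hβ.support x ⟨hx.1, hxw⟩
    refine ⟨R, ?_⟩
    filter_upwards [hR, self_mem_nhdsWithin, mem_nhdsWithin_of_mem_nhds (hwo.mem_nhds hxw)] with
      x' hx' hxQ hxw' y hy
    rw [hb x' ⟨hxQ, hxw'⟩ y, hx' y hy]

theorem isFlatForm_zero : IsFlatForm Q u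
    (fun _ => (0 : (B × EuclideanSpace ℝ (Fin r)) [⋀^Fin k]→L[ℝ] ℝ)) :=
  ⟨contDiffOn_const, fun _ _ => extDerivWithin_zero, fun _ _ => ⟨0, Eventually.of_forall fun _ _ _ => rfl⟩⟩

end FlatLocal

/-! ### Modification of a Thom form inside a local model -/

section Step

variable {n r : ℕ} {M : Type*} [TopologicalSpace M] [ChartedSpace (EuclideanQuadrant n) M]
  {E : M → Type*} [TopologicalSpace (TotalSpace (EuclideanSpace ℝ (Fin r)) E)]
  [∀ p, TopologicalSpace (E p)] [FiberBundle (EuclideanSpace ℝ (Fin r)) E]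
  [∀ p, AddCommGroup (E p)] [∀ p, Module ℝ (E p)]
  [VectorBundle ℝ (Euc r) E] [IsManifold (Quad n) ∞ M] [ContMDiffVectorBundle ∞ (Euc r) E (Quad n)]
  {ι : Type*}

/-- Near the fibre at `p` the form `σ` is a Thom form, and over `p` it extends the given forms. -/
structure GoodAt (o : ∀ p, Orientation ℝ (E p) (Fin r)) (S : ι → Set M)
    (τ : ∀ i, FormOver n r E (S i) r) (σ : BundleForm n r E r) (p : M) : Prop where
  smooth : ∀ v : TotalSpace (Euc r) E, v.proj = p → SmoothAt σ v
  closed : ∀ v : TotalSpace (Euc r) E, v.proj = p → σ.d v = 0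
  proper : LocallyProper {v | σ v ≠ 0} p
  integral : HasThomIntegral o σ p
  restrict : ∀ (i) (v : TotalSpace (Euc r) E) (hv : v.proj ∈ S i), v.proj = p →
    restrictTo (S i) σ v hv = τ i v hv

variable {o : ∀ p, Orientation ℝ (E p) (Fin r)} {S : ι → Set M} {τ : ∀ i, FormOver n r E (S i) r}
  {σ σ' : BundleForm n r E r} {p : M}

theorem HasThomIntegral.congr (h : HasThomIntegral o σ p)
    (hσ : ∀ v : TotalSpace (Euc r) E, v.proj = p → σ v = σ' v) : HasThomIntegral o σ' p := by
  have h1 : ∀ b : Module.Basis (Fin r) ℝ (E p), fiberIntegral σ' p b = fiberIntegral σ p b := by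
    intro b
    unfold fiberIntegral
    refine integral_congr_ae (Eventually.of_forall fun x => ?_)
    simp only [hσ (fiberMap p b x) rfl]
  exact ⟨fun b hb => by rw [h1, h.1 b hb], fun b hb => by rw [h1, h.2 b hb]⟩

theorem GoodAt.congr (h : GoodAt o S τ σ p)
    (hσ : ∀ᶠ q in 𝓝 p, ∀ v : TotalSpace (Euc r) E, v.proj = q → σ v = σ' v) :
    GoodAt o S τ σ' p := by
  have hnear : ∀ v : TotalSpace (Euc r) E, v.proj = p → ∀ᶠ v' in 𝓝 v, σ v' = σ' v' := by
    intro v hv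
    subst hv
    have := (FiberBundle.continuous_proj (Euc r) E).continuousAt.eventually hσ
    filter_upwards [this] with v' hv'
    exact hv' v' rfl
  refine ⟨fun v hv => (h.smooth v hv).congr (hnear v hv), fun v hv => ?_, ?_,
    h.integral.congr hσ.self_of_nhds, fun i v hv hvp => ?_⟩
  · rw [← d_congr (hnear v hv), h.closed v hv]
  · obtain ⟨K, hK, hKZ⟩ := h.proper
    refine ⟨K, hK, ?_⟩
    filter_upwards [hKZ, hσ] with q hq hqσ v hv hvZ
    refine hq v hv ?_
    rw [hqσ v hv]
    exact hvZ
  · rw [← h.restrict i v hv hvp]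
    unfold restrictTo
    rw [hσ.self_of_nhds v hvp]

/-- `σ` is a Thom form that extends the given forms over a neighbourhood of `p`. -/
def GoodNear (o : ∀ p, Orientation ℝ (E p) (Fin r)) (S : ι → Set M)
    (τ : ∀ i, FormOver n r E (S i) r) (σ : BundleForm n r E r) (p : M) : Prop :=
  ∀ᶠ q in 𝓝 p, GoodAt o S τ σ q

theorem GoodNear.congr (h : GoodNear o S τ σ p)
    (hσ : ∀ᶠ q in 𝓝 p, ∀ v : TotalSpace (Euc r) E, v.proj = q → σ v = σ' v) :
    GoodNear o S τ σ' p := by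
  filter_upwards [h, eventually_eventually_nhds.2 hσ] with q hq hqσ
  exact hq.congr hqσ

/-- The part of the base that a local model describes. -/
def ThomBox.domain (b : ThomBox o S τ) : Set M :=
  b.φ.source ∩ b.φ.extend (Quad n) ⁻¹' b.u

theorem ThomBox.isOpen_domain (b : ThomBox o S τ) : IsOpen b.domain :=
  b.φ.isOpen_extend_preimage (I := Quad n) b.isOpen

theorem ThomBox.mem_chartDomain (b : ThomBox o S τ) {x : Euc n} (hx : x ∈ range (Quad n) ∩ b.u) :
    x ∈ range (Quad n) ∩ chartDomain b.φ b.e := ⟨hx.1, b.subset hx.2⟩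

theorem ThomBox.symm_mem_domain (b : ThomBox o S τ) {x : Euc n} (hx : x ∈ range (Quad n) ∩ b.u) :
    (b.φ.extend (Quad n)).symm x ∈ b.domain := by
  refine ⟨symm_mem_source (b.mem_chartDomain hx), ?_⟩
  rw [mem_preimage, extend_symm_eq (b.mem_chartDomain hx)]
  exact hx.2

theorem ThomBox.extend_mem (b : ThomBox o S τ) (hp : p ∈ b.domain) :
    b.φ.extend (Quad n) p ∈ range (Quad n) ∩ b.u := ⟨mem_range_self _, hp.2⟩

theorem ThomBox.mem_baseSet (b : ThomBox o S τ) (hp : p ∈ b.domain) : p ∈ b.e.baseSet := by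
  have := symm_mem_baseSet (b.mem_chartDomain (b.extend_mem hp))
  rwa [b.φ.extend_left_inv hp.1] at this

theorem ThomBox.isCutBy (b : ThomBox o S τ) {i : ι} (hi : i ∈ b.s) (hp : p ∈ b.domain) :
    IsCutBy b.φ (S i) (b.L i) (b.c i) p :=
  isCutBy_of_forall_mem b.isOpen (b.cut i hi) hp.1 hp.2

theorem ThomBox.mem_of_mem (b : ThomBox o S τ) {i : ι} (hp : p ∈ b.domain) (hpi : p ∈ S i) :
    i ∈ b.s := by
  by_contra hi
  refine b.notMem i hi _ (b.extend_mem hp) ?_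
  rwa [b.φ.extend_left_inv hp.1]

/-- Any closed form in the local model with the fibre integrals of `base` and its restrictions to
the submanifolds is as good as `base`. This leaves the freedom to add a cut-off difference. -/
theorem ThomBox.goodAt_ofFlat [T2Space M] [LocallyCompactSpace M] (b : ThomBox o S τ)
    {a : Euc n × Euc r → (Euc n × Euc r) [⋀^Fin r]→L[ℝ] ℝ}
    (ha : IsFlatForm (range (Quad n)) b.u a)
    (hint : ∀ x ∈ range (Quad n) ∩ b.u, flatInt a x = b.ε)
    (hagr : ∀ i ∈ b.s, ∀ x ∈ range (Quad n) ∩ b.u, b.L i x + b.c i = x → ∀ y,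
      (a (x, y)).compContinuousLinearMap (baseMap r (b.L i)) =
        (b.base (x, y)).compContinuousLinearMap (baseMap r (b.L i)))
    (hp : p ∈ b.domain) :
    GoodAt o S τ (ofFlat (J := totalModel n r) (bundleChart b.φ b.e) a) p := by
  have := b.memTrivializationAtlas
  have hx := b.extend_mem hp
  obtain ⟨h1, h2⟩ := ha.goodAt b.mem_maximalAtlas b.isOpen b.subset hp.1 hp.2
  refine ⟨fun v hv => (h1 v hv).1, fun v hv => (h1 v hv).2, h2, ?_, fun i v hv hvp => ?_⟩
  · have h3 := b.thom _ hx (ofFlat (J := totalModel n r) (bundleChart b.φ b.e) a)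
    rw [b.φ.extend_left_inv hp.1] at h3
    rw [h3, ← hint _ hx]
    unfold flatInt
    refine integral_congr_ae (Eventually.of_forall fun y => ?_)
    simp only
    rw [toFlat_ofFlat b.mem_maximalAtlas a (b.mem_chartDomain hx)]
  · subst hvp
    have hi := b.mem_of_mem hp hv
    rw [← restrictTo_extension (τ i) v hv, restrictTo_eq_iff b.mem_maximalAtlas (b.retraction i hi)
      _ _ hp.1 (b.mem_baseSet hp) hv (b.isCutBy hi hp),
      toFlat_ofFlat b.mem_maximalAtlas a (b.mem_chartDomain hx)]
    have hL : b.L i (b.φ.extend (Quad n) v.proj) + b.c i = b.φ.extend (Quad n) v.proj := by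
      rw [← b.cut i hi _ hx, b.φ.extend_left_inv hp.1]
      exact hv
    exact (hagr i hi _ hx hL _).trans (b.agrees i hi _ hx hL _)

/-- A Thom form over an open set can be changed in a local model so that it becomes a Thom form
over an additional compact set. -/
theorem ThomBox.exists_step [T2Space M] [LocallyCompactSpace M] (b : ThomBox o S τ) {V : Set M}
    (hV : IsOpen V) (hVb : V ⊆ b.domain) (σ : BundleForm n r E r) {C D : Set M}
    (hC : IsClosed C) (hσ : ∀ q ∈ C, GoodNear o S τ σ q) (hD : IsCompact D) (hDV : D ⊆ V) :
    ∃ σ' : BundleForm n r E r, (∀ v, v.proj ∉ V → σ' v = σ v) ∧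
      ∀ q ∈ C ∪ D, GoodNear o S τ σ' q := by
  classical
  have := b.memTrivializationAtlas
  obtain ⟨D', hD', hDD', hD'V⟩ := exists_compact_between hD hV hDV
  set U : Set M := {q | GoodNear o S τ σ q} with hU
  have hUo : IsOpen U := isOpen_iff_mem_nhds.2 fun q hq => eventually_eventually_nhds.2 hq
  set Q : Set (Euc n) := range (Quad n) with hQ
  have hQc : Convex ℝ Q := (Quad n).convex_range
  have hQi : (interior Q).Nonempty := (Quad n).nonempty_interior
  set ψ := b.φ.extend (Quad n) with hψ
  -- The part of the chart over which `σ` is already a good extension.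
  set u' : Set (Euc n) := b.u ∩ (Quad n).symm ⁻¹' (b.φ.target ∩ b.φ.symm ⁻¹' U) with hu'
  have hu'o : IsOpen u' := b.isOpen.inter
    ((b.φ.isOpen_inter_preimage_symm hUo).preimage (Quad n).continuous_symm)
  have hu'U : ∀ x ∈ Q ∩ u', ψ.symm x ∈ U := fun x hx => hx.2.2.2
  have hu'b : ∀ x ∈ Q ∩ u', x ∈ Q ∩ b.u := fun x hx => ⟨hx.1, hx.2.1⟩
  have hUu' : ∀ q ∈ b.domain, q ∈ U → ψ q ∈ u' := by
    intro q hq hqU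
    have h1 : (Quad n).symm (ψ q) = b.φ q := by
      rw [hψ, b.φ.extend_coe]
      exact (Quad n).left_inv _
    refine ⟨hq.2, ?_⟩
    rw [mem_preimage, h1]
    refine ⟨b.φ.map_source hq.1, ?_⟩
    rwa [mem_preimage, b.φ.left_inv hq.1]
  have hgood : ∀ x ∈ Q ∩ u', GoodAt o S τ σ (ψ.symm x) := fun x hx => (hu'U x hx).self_of_nhds
  have hσf : IsFlatForm Q u' (toFlat b.φ b.e σ) :=
    isFlatForm_toFlat b.mem_maximalAtlas (inter_subset_left.trans b.subset)
      (fun x hx v hv => (hgood x hx).smooth v hv) (fun x hx v hv => (hgood x hx).closed v hv)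
      (fun x hx => (hgood x hx).proper)
  have hbf : IsFlatForm Q u' b.base := IsFlatForm.of_local fun x hx =>
    ⟨b.u, b.isOpen, hx.2.1, b.base, b.flat, fun _ _ _ => rfl⟩
  have hσagr : ∀ i ∈ b.s, ∀ x ∈ Q ∩ u', b.L i x + b.c i = x → ∀ y,
      (toFlat b.φ b.e σ (x, y)).compContinuousLinearMap (baseMap r (b.L i)) =
        (b.base (x, y)).compContinuousLinearMap (baseMap r (b.L i)) := by
    intro i hi x hx hxL y
    have hxb := hu'b x hx
    have hzx : ((x, y) : Euc n × Euc r).1 ∈ range (Quad n) ∩ chartDomain b.φ b.e :=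
      b.mem_chartDomain hxb
    have hp := proj_bundleParam hzx
    have hdom : (bundleParam b.φ b.e (x, y)).proj ∈ b.domain := by
      rw [hp]; exact b.symm_mem_domain hxb
    have hmem : (bundleParam b.φ b.e (x, y)).proj ∈ S i := by
      rw [hp]; exact (b.cut i hi x hxb).2 hxL
    have h1 := (restrictTo_eq_iff b.mem_maximalAtlas (b.retraction i hi) σ (extension (τ i))
      hdom.1 (b.mem_baseSet hdom) hmem (b.isCutBy hi hdom)).1 (by
        rw [restrictTo_extension, (hgood x hx).restrict i _ hmem hp])
    rw [bundleChart_bundleParam hzx] at h1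
    rw [h1, b.agrees i hi x hxb hxL y]
  have hDc : IsCompact (ψ '' (C ∩ D')) := by
    refine (hD'.inter_left hC).image_of_continuousOn ?_
    intro q hq
    exact (b.φ.continuousAt_extend (hVb (hD'V hq.2)).1).continuousWithinAt
  -- `ρ` is 1 near the image of `C ∩ D'`, where `σ` has to be kept, and 0 near the complement of
  -- `u'`, where `σ` is unusable.
  obtain ⟨ρ, hρ0, hρ1, -⟩ := exists_contMDiffMap_zero_one_nhds_of_isClosed (n := ⊤)
    (𝓘(ℝ, Euc n)) hu'o.isClosed_compl hDc.isClosed (by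
      rw [Set.disjoint_left]
      rintro _ hx ⟨q, hq, rfl⟩
      exact hx (hUu' q (hVb (hD'V hq.2)) (hσ q hq.1)))
  have hρs : ContDiff ℝ ∞ ρ := ρ.contMDiff.contDiff
  obtain ⟨η, hηf, hηi, hη1, hη0, hηv⟩ := (hσf.sub hQc hQi hu'o hbf).exists_cutoff hQc hQi hu'o
    (fun x hx => by
      rw [flatInt_sub hσf hbf hx, b.integral x (hu'b x hx),
        (b.thom x (hu'b x hx) σ).1 (hgood x hx).integral, sub_self]) hρs
  -- Extension by zero preserves smoothness because `η` vanishes near the complement of `u'`.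
  set η' : Euc n × Euc r → (Euc n × Euc r) [⋀^Fin r]→L[ℝ] ℝ :=
    fun z => if z.1 ∈ u' then η z else 0 with hη'
  have hη'f : IsFlatForm Q b.u η' := by
    refine IsFlatForm.of_local fun x hx => ?_
    by_cases hxu : x ∈ u'
    · refine ⟨u', hu'o, hxu, η, hηf, fun x' hx' y => ?_⟩
      simp only [hη', if_pos hx'.2]
    · obtain ⟨w, hwo, hxw, hw0⟩ := mem_nhdsSet_iff_exists.1 hρ0
      refine ⟨w, hwo, hxw hxu, fun _ => 0, isFlatForm_zero, fun x' hx' y => ?_⟩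
      by_cases hx'u : x' ∈ u'
      · simp only [hη', if_pos hx'u]
        refine hη0 x' ⟨hx'.1, hx'u⟩ ?_ y
        filter_upwards [mem_nhdsWithin_of_mem_nhds (hwo.mem_nhds hx'.2)] with x'' hx''
        exact hw0 hx''
      · simp only [hη', if_neg hx'u]
  -- `a` is `base` where `ρ` is locally 0 and `σ` where `ρ` is locally 1.
  set a : Euc n × Euc r → (Euc n × Euc r) [⋀^Fin r]→L[ℝ] ℝ := fun z => b.base z + η' z with ha
  have hgoodV : ∀ q ∈ b.domain,
      GoodAt o S τ (ofFlat (J := totalModel n r) (bundleChart b.φ b.e) a) q := by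
    intro q hq
    refine b.goodAt_ofFlat (b.flat.add hQc hQi b.isOpen hη'f) (fun x hx => ?_)
      (fun i hi x hx hxL y => ?_) hq
    · rw [flatInt_add b.flat hη'f hx, b.integral x hx]
      by_cases hxu : x ∈ u'
      · have h1 : flatInt η' x = flatInt η x := by
          unfold flatInt
          simp only [hη', if_pos hxu]
        rw [h1, hηi x ⟨hx.1, hxu⟩, add_zero]
      · have h1 : flatInt η' x = 0 := by
          unfold flatInt
          simp only [hη', if_neg hxu]
          exact integral_zero _ _
        rw [h1, add_zero]
    · have h1 : (η' (x, y)).compContinuousLinearMap (baseMap r (b.L i)) = 0 := by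
        by_cases hxu : x ∈ u'
        · simp only [hη', if_pos hxu]
          refine hηv (b.L i) (b.c i) (b.retraction i hi) (fun x hx hxL y => ?_) x ⟨hx.1, hxu⟩ hxL y
          have h2 := hσagr i hi x hx hxL y
          have h3 : (toFlat b.φ b.e σ (x, y) - b.base (x, y)).compContinuousLinearMap
              (baseMap r (b.L i)) = (toFlat b.φ b.e σ (x, y)).compContinuousLinearMap
              (baseMap r (b.L i)) - (b.base (x, y)).compContinuousLinearMap (baseMap r (b.L i)) := rfl
          rw [h3, h2, sub_self]
        · simp only [hη', if_neg hxu]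
          rfl
      have h2 : (a (x, y)).compContinuousLinearMap (baseMap r (b.L i)) =
          (b.base (x, y)).compContinuousLinearMap (baseMap r (b.L i)) +
            (η' (x, y)).compContinuousLinearMap (baseMap r (b.L i)) := rfl
      rw [h2, h1, add_zero]
  -- The result may jump at the frontier of `D'`, but not near `C ∪ D`: points of `D` are interior
  -- to `D'`, and near points of `C` the two pieces coincide.
  refine ⟨fun v => if v.proj ∈ D' then ofFlat (J := totalModel n r) (bundleChart b.φ b.e) a v
    else σ v, fun v hv => if_neg fun h => hv (hD'V h), fun q hq => ?_⟩
  by_cases hqD : q ∈ D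
  · have h1 : GoodNear o S τ (ofFlat (J := totalModel n r) (bundleChart b.φ b.e) a) q := by
      filter_upwards [b.isOpen_domain.mem_nhds (hVb (hDV hqD))] with q' hq' using hgoodV q' hq'
    refine h1.congr ?_
    filter_upwards [isOpen_interior.mem_nhds (hDD' hqD)] with q' hq' v hv
    subst hv
    exact (if_pos (interior_subset hq')).symm
  · have hqC : q ∈ C := hq.resolve_right hqD
    refine (hσ q hqC).congr ?_
    by_cases hqD' : q ∈ D'
    · have hqb : q ∈ b.domain := hVb (hD'V hqD')
      have h1 : ∀ᶠ x in 𝓝 (ψ q), ∀ᶠ x' in 𝓝 x, ρ x' = 1 := by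
        rw [eventually_eventually_nhds]
        have hm : ψ q ∈ ψ '' (C ∩ D') := ⟨q, ⟨hqC, hqD'⟩, rfl⟩
        exact hρ1.filter_mono (nhds_le_nhdsSet hm)
      filter_upwards [(b.φ.continuousAt_extend hqb.1).eventually h1, b.isOpen_domain.mem_nhds hqb,
        hUo.mem_nhds (hσ q hqC)] with q' hq'1 hq'b hq'U v hv
      subst hv
      split_ifs with hvD
      · have hx' : ψ v.proj ∈ Q ∩ u' := ⟨mem_range_self _, hUu' _ hq'b hq'U⟩
        have h2 : a (bundleChart b.φ b.e v) = toFlat b.φ b.e σ (bundleChart b.φ b.e v) := by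
          have h3 : η' (bundleChart b.φ b.e v) = η (bundleChart b.φ b.e v) := if_pos hx'.2
          have h4 := hη1 (ψ v.proj) hx' (hq'1.filter_mono nhdsWithin_le_nhds) (b.e v).2
          simp only [ha]
          rw [h3]
          refine (congrArg (fun A => b.base (bundleChart b.φ b.e v) + A) h4).trans ?_
          exact add_sub_cancel _ _
        rw [← ofFlat_toFlat b.mem_maximalAtlas σ hq'b.1 (b.mem_baseSet hq'b)]
        unfold ofFlat
        rw [h2]
      · rfl
    · filter_upwards [hD'.isClosed.isOpen_compl.mem_nhds hqD'] with q' hq' v hv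
      subst hv
      exact (if_neg hq').symm

end Step

/-! ### Gluing along a locally finite cover -/

section Gluing

variable {X M A : Type*} [TopologicalSpace M] {F : X → Type*}

/-- A section that can be improved near each member of a locally finite family of closed sets,
without changing it far away, can be improved near all of them. -/
theorem exists_forall_near (pr : X → M) (Near : (∀ v, F v) → M → Prop)
    (hcongr : ∀ σ σ' q, Near σ q → (∀ᶠ q' in 𝓝 q, ∀ v, pr v = q' → σ v = σ' v) → Near σ' q)
    {V D : A → Set M} (hV : LocallyFinite V) (hD : ∀ a, IsClosed (D a)) (hDV : ∀ a, D a ⊆ V a)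
    (step : ∀ a σ C, IsClosed C → (∀ q ∈ C, Near σ q) →
      ∃ σ', (∀ v, pr v ∉ V a → σ' v = σ v) ∧ ∀ q ∈ C ∪ D a, Near σ' q)
    (σ₀ : ∀ v, F v) : ∃ σ, ∀ a, ∀ q ∈ D a, Near σ q := by
  classical
  -- Partial solutions: a set of indices that are settled, and a section that is good near their
  -- closed sets.
  let P : Type _ := {x : Set A × (∀ v, F v) // ∀ a ∈ x.1, ∀ q ∈ D a, Near x.2 q}
  -- Passing to a larger solution may alter the section only over the `V a` of newly settled
  -- indices. By local finiteness the values then stabilize along a chain.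
  let R : P → P → Prop := fun x y =>
    x.1.1 ⊆ y.1.1 ∧ ∀ v, (∀ a ∈ y.1.1, a ∉ x.1.1 → pr v ∉ V a) → y.1.2 v = x.1.2 v
  have hrefl : ∀ x : P, R x x := fun x => ⟨subset_rfl, fun _ _ => rfl⟩
  have htrans : ∀ {x y z : P}, R x y → R y z → R x z := by
    intro x y z h1 h2
    refine ⟨h1.1.trans h2.1, fun v hv => ?_⟩
    rw [h2.2 v fun a ha hna => hv a ha fun h => hna (h1.1 h),
      h1.2 v fun a ha hna => hv a (h2.1 ha) hna]
  have hbound : ∀ c : Set P, IsChain R c → ∃ ub, ∀ x ∈ c, R x ub := by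
    intro c hc
    rcases c.eq_empty_or_nonempty with rfl | hne
    · exact ⟨⟨(∅, σ₀), fun a ha => ha.elim⟩, fun x hx => hx.elim⟩
    have htot : ∀ x ∈ c, ∀ y ∈ c, R x y ∨ R y x := fun x hx y hy => by
      by_cases h : x = y
      · exact Or.inl (h ▸ hrefl x)
      · exact hc hx hy h
    let B : Set A := {a | ∃ x ∈ c, a ∈ x.1.1}
    -- A chain is directed, so finitely many settled indices are settled by one member.
    have hfin : ∀ T : Set A, T.Finite → ∃ x ∈ c, ∀ a ∈ T, a ∈ B → a ∈ x.1.1 := by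
      intro T hT
      induction T, hT using Set.Finite.induction_on with
      | empty => exact ⟨hne.some, hne.some_mem, fun a ha => ha.elim⟩
      | @insert a T _ _ ih =>
        obtain ⟨x, hx, hxT⟩ := ih
        by_cases ha : a ∈ B
        · obtain ⟨y, hy, hya⟩ := ha
          rcases htot x hx y hy with h | h
          · refine ⟨y, hy, fun a' ha' hB => ?_⟩
            rcases ha' with rfl | ha'
            · exact hya
            · exact h.1 (hxT a' ha' hB)
          · refine ⟨x, hx, fun a' ha' hB => ?_⟩
            rcases ha' with rfl | ha'
            · exact h.1 hya
            · exact hxT a' ha' hB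
        · refine ⟨x, hx, fun a' ha' hB => ?_⟩
          rcases ha' with rfl | ha'
          · exact (ha hB).elim
          · exact hxT a' ha' hB
    -- At `v` take a member of the chain that has settled every relevant index whose `V a` contains
    -- `v`; later members no longer change the value there.
    choose y hyc hyB using fun v : X => hfin {a | pr v ∈ V a} (hV.point_finite (pr v))
    let s : ∀ v, F v := fun v => (y v).1.2 v
    have hs : ∀ x ∈ c, ∀ v, (∀ a, pr v ∈ V a → a ∈ B → a ∈ x.1.1) → s v = x.1.2 v := by
      intro x hx v hv
      rcases htot x hx (y v) (hyc v) with h | h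
      · exact h.2 v fun a ha hna hva => hna (hv a hva ⟨y v, hyc v, ha⟩)
      · exact (h.2 v fun a ha hna hva => hna (hyB v a hva ⟨x, hx, ha⟩)).symm
    refine ⟨⟨(B, s), fun a ha q hq => ?_⟩, fun x hx => ⟨fun a ha => ⟨x, hx, ha⟩, fun v hv => ?_⟩⟩
    · obtain ⟨W, hW, hWfin⟩ := hV q
      obtain ⟨x, hx, hxW⟩ := hfin _ hWfin
      have hqW := mem_of_mem_nhds hW
      refine hcongr x.1.2 s q (x.2 a (hxW a ⟨q, hDV a hq, hqW⟩ ha) q hq) ?_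
      filter_upwards [hW] with q' hq' v hv
      exact (hs x hx v fun a' ha' hB => hxW a' ⟨pr v, ha', hv ▸ hq'⟩ hB).symm
    · refine hs x hx v fun a hva hB => ?_
      by_contra hna
      exact hv a hB hna hva
  obtain ⟨x, hx⟩ := exists_maximal_of_chains_bounded hbound htrans
  refine ⟨x.1.2, fun a => ?_⟩
  -- A locally finite union of closed sets is closed, so the step applies to everything settled so
  -- far. It settles one more index, against maximality.
  have hC : IsClosed (⋃ b : x.1.1, D b) :=
    ((hV.subset hDV).comp_injective Subtype.val_injective).isClosed_iUnion fun b => hD b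
  obtain ⟨σ', hσ', hgood⟩ := step a x.1.2 (⋃ b : x.1.1, D b) hC fun q hq => by
    obtain ⟨b, hb⟩ := mem_iUnion.1 hq
    exact x.2 b b.2 q hb
  let z : P := ⟨(insert a x.1.1, σ'), fun b hb q hq => by
    rcases hb with rfl | hb
    · exact hgood q (Or.inr hq)
    · exact hgood q (Or.inl (mem_iUnion.2 ⟨⟨b, hb⟩, hq⟩))⟩
  by_cases hax : a ∈ x.1.1
  · exact x.2 a hax
  have hxz : R x z := ⟨subset_insert _ _, fun v hv => hσ' v (hv a (mem_insert _ _) hax)⟩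
  exact x.2 a ((hx z hxz).1 (mem_insert _ _))

end Gluing

/-! ### Extension over the whole base without the group action -/

section GlobalExtension

variable {n r : ℕ} {M : Type*} [TopologicalSpace M] [ChartedSpace (EuclideanQuadrant n) M]
  {E : M → Type*} [TopologicalSpace (TotalSpace (EuclideanSpace ℝ (Fin r)) E)]
  [∀ p, TopologicalSpace (E p)] [FiberBundle (EuclideanSpace ℝ (Fin r)) E]
  [∀ p, AddCommGroup (E p)] [∀ p, Module ℝ (E p)]
  [VectorBundle ℝ (Euc r) E] [IsManifold (Quad n) ∞ M] [ContMDiffVectorBundle ∞ (Euc r) E (Quad n)]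
  {ι : Type*} {o : ∀ p, Orientation ℝ (E p) (Fin r)} {S : ι → Set M}
  {τ : ∀ i, FormOver n r E (S i) r}

/-- Compatible Thom forms over a clean family extend to a Thom form, without any group action. -/
theorem exists_goodAt [T2Space M] [ParacompactSpace M] [LocallyCompactSpace M] [Finite ι]
    (ho : IsBundleOrientation o) (hclosed : ∀ i, IsClosed (S i))
    (hclean : CleanFamily (n := n) S) (hτ : ∀ i, IsThomFormOver (S i) o (τ i))
    (hagree : ∀ i j, (τ i).restrict (inter_subset_left : S i ∩ S j ⊆ S i) =
      (τ j).restrict (inter_subset_right : S i ∩ S j ⊆ S j)) :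
    ∃ σ : BundleForm n r E r, ∀ p, GoodAt o S τ σ p := by
  choose b hb1 hb2 using exists_thomBox ho hclosed hclean hτ hagree
  -- Cutting the domains down to relatively compact sets makes the closed sets `D p` of the shrunken
  -- cover compact, as the local step requires.
  choose K hKc hK using fun p : M => exists_compact_mem_nhds p
  obtain ⟨V, hVo, hVc, hVf, hVb⟩ := precise_refinement (fun p => (b p).domain ∩ interior (K p))
    (fun p => (b p).isOpen_domain.inter isOpen_interior)
    (iUnion_eq_univ_iff.2 fun p => ⟨p, ⟨hb1 p, hb2 p⟩, mem_interior_iff_mem_nhds.2 (hK p)⟩)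
  obtain ⟨D, hDc, hDcl, hDV⟩ := exists_iUnion_eq_closed_subset hVo hVf.point_finite hVc
  have hDK : ∀ p, IsCompact (D p) := fun p => (hKc p).of_isClosed_subset (hDcl p)
    ((hDV p).trans ((hVb p).trans (inter_subset_right.trans interior_subset)))
  obtain ⟨σ, hσ⟩ := exists_forall_near (F := fun v : TotalSpace (Euc r) E =>
      TangentSpace (totalModel n r) v [⋀^Fin r]→L[ℝ] ℝ)
    (TotalSpace.proj : TotalSpace (Euc r) E → M) (fun σ q => GoodNear o S τ σ q)
    (fun σ σ' q h h' => h.congr h') hVf hDcl hDV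
    (fun a σ C hC hσ => (b a).exists_step (hVo a) ((hVb a).trans inter_subset_left) σ hC hσ
      -- The starting section is irrelevant, because the sets `D p` cover `M`.
      (hDK a) (hDV a)) 0
  refine ⟨σ, fun p => ?_⟩
  obtain ⟨a, ha⟩ := iUnion_eq_univ_iff.1 hDc p
  exact (hσ a p ha).self_of_nhds

end GlobalExtension

/-! ### Averaging forms over a compact Lie group -/

section Parametric

variable {T : Type*} [TopologicalSpace T] [T2Space T] [MeasurableSpace T] [BorelSpace T]
  {V W W' : Type*} [NormedAddCommGroup V] [NormedSpace ℝ V]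
  [NormedAddCommGroup W] [NormedSpace ℝ W] [CompleteSpace W]
  [NormedAddCommGroup W'] [NormedSpace ℝ W'] [CompleteSpace W']

/-- Differentiation and the linear map `L` both pass under the integral. With the antisymmetrization
as `L`, an average of closed forms is closed. -/
theorem apply_fderivWithin_integral_eq_zero {μ : Measure T} [IsFiniteMeasure μ] {k : Set T}
    (hk : IsCompact k) (hμ : ∀ᵐ t ∂μ, t ∈ k) {C O : Set V} (hC : Convex ℝ C) (hO : IsOpen O)
    (hu : UniqueDiffOn ℝ (C ∩ O)) {F : T → V → W} (hF : ∀ t ∈ k, ContDiffOn ℝ ∞ (F t) (C ∩ O))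
    (hc : ContinuousOn (Function.uncurry F) (k ×ˢ (C ∩ O)))
    (hc' : ContinuousOn (Function.uncurry fun t y => iteratedFDerivWithin ℝ 1 (F t) (C ∩ O) y)
      (k ×ˢ (C ∩ O))) {z : V} (hz : z ∈ C ∩ O) (L : (V →L[ℝ] W) →L[ℝ] W')
    (hL : ∀ t, L (fderivWithin ℝ (F t) (C ∩ O) z) = 0) :
    L (fderivWithin ℝ (fun y => ∫ t, F t y ∂μ) (C ∩ O) z) = 0 := by
  have h7 : ContinuousOn (Function.uncurry fun t y => fderivWithin ℝ (F t) (C ∩ O) y)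
      (k ×ˢ (C ∩ O)) := by
    refine ((continuousMultilinearCurryFin1 ℝ V W).continuous.comp_continuousOn hc').congr ?_
    rintro ⟨g, y⟩ hy
    ext1 w
    simp [Function.uncurry, iteratedFDerivWithin_one_apply (hu y hy.2)]
  have h8 := hasFDerivWithinAt_integral_of_compact hk hμ hC hO (fun g hg y hy =>
    ((hF g hg).differentiableOn (by simp) y hy).hasFDerivWithinAt) hc h7 hz
  have h10 : Integrable (fun g => fderivWithin ℝ (F g) (C ∩ O) z) μ :=
    integrable_of_continuousOn_compact hk hμ (continuousOn_slice h7 hz)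
  rw [h8.fderivWithin (hu z hz), ← L.integral_comp_comm h10]
  simp [hL]

end Parametric

section Average

variable {m : ℕ} {G : Type*} [TopologicalSpace G] [Group G]
  [ChartedSpace (EuclideanSpace ℝ (Fin m)) G] [IsManifold (𝓡 m) ∞ G]
  {V : Type*} [NormedAddCommGroup V] [NormedSpace ℝ V]
  {H : Type*} [TopologicalSpace H] {J : ModelWithCorners ℝ V H}
  {N : Type*} [TopologicalSpace N] [ChartedSpace H N] [IsManifold J ∞ N]
  [MulAction G N]
  {W : Type*} [NormedAddCommGroup W] [NormedSpace ℝ W] {k : ℕ}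

/-- The pullback `g^*α` of a form under the action of `g`. -/
def translate (g : G) (α : Form J (N := N) k) : Form J (N := N) k := fun v =>
  (α (g • v)).compContinuousLinearMap (mfderiv J J (fun w : N => g • w) v)

/-- The value of `g^*α` as a form on the model space. -/
def translateVal (g : G) (α : Form J (N := N) k) (v : N) : V [⋀^Fin k]→L[ℝ] ℝ := translate g α v

theorem contMDiff_const_smul
    (hG : ContMDiff ((𝓡 m).prod J) J ∞ fun q : G × N => q.1 • q.2) (g : G) :
    ContMDiff J J ∞ fun v : N => g • v :=
  hG.comp (contMDiff_const.prodMk contMDiff_id)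

theorem mdifferentiableAt_const_smul
    (hG : ContMDiff ((𝓡 m).prod J) J ∞ fun q : G × N => q.1 • q.2) (g : G) (v : N) :
    MDifferentiableAt J J (fun v : N => g • v) v :=
  (contMDiff_const_smul hG g).contMDiffAt.mdifferentiableAt (by simp)

variable {s : Set W} {f : W → N} {α : Form J (N := N) k} {z : W}

theorem pull_translate
    (hG : ContMDiff ((𝓡 m).prod J) J ∞ fun q : G × N => q.1 • q.2) (g : G) (hs : UniqueDiffWithinAt ℝ s z)
    (hf : MDifferentiableWithinAt 𝓘(ℝ, W) J f s z) :
    pull s f (translate g α) z = pull s (fun y => g • f y) α z := by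
  have h := mfderiv_comp_mfderivWithin (I := 𝓘(ℝ, W)) (I' := J) (I'' := J)
    (g := fun v : N => g • v) (f := f) z
    (mdifferentiableAt_const_smul hG g (f z)) hf hs.uniqueMDiffWithinAt
  change ((α (g • f z)).compContinuousLinearMap (mfderiv J J (fun v : N => g • v) (f z))).compContinuousLinearMap
    (mfderivWithin 𝓘(ℝ, W) J f s z) = (α (g • f z)).compContinuousLinearMap
      (mfderivWithin 𝓘(ℝ, W) J ((fun v : N => g • v) ∘ f) s z)
  rw [h]
  rfl

theorem pull_inter {O : Set W} (hO : O ∈ 𝓝 z) : pull (s ∩ O) f α z = pull s f α z := by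
  unfold pull
  rw [mfderivWithin_inter hO]

theorem contMDiffOn_smul_comp
    (hG : ContMDiff ((𝓡 m).prod J) J ∞ fun q : G × N => q.1 • q.2) (hf : ContMDiffOn 𝓘(ℝ, W) J ∞ f s) (g₀ : G) :
    ContMDiffOn 𝓘(ℝ, EuclideanSpace ℝ (Fin m) × W) J ∞
      (fun q : EuclideanSpace ℝ (Fin m) × W => (extChartAt (𝓡 m) g₀).symm q.1 • f q.2)
      ((extChartAt (𝓡 m) g₀).target ×ˢ s) := by
  have h1 : ContMDiffOn 𝓘(ℝ, EuclideanSpace ℝ (Fin m) × W) (𝓡 m) ∞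
      (fun q : EuclideanSpace ℝ (Fin m) × W => (extChartAt (𝓡 m) g₀).symm q.1)
      ((extChartAt (𝓡 m) g₀).target ×ˢ s) :=
    (contMDiffOn_extChartAt_symm g₀).comp contDiff_fst.contMDiff.contMDiffOn fun q hq => hq.1
  have h2 : ContMDiffOn 𝓘(ℝ, EuclideanSpace ℝ (Fin m) × W) J ∞
      (fun q : EuclideanSpace ℝ (Fin m) × W => f q.2)
      ((extChartAt (𝓡 m) g₀).target ×ˢ s) :=
    hf.comp contDiff_snd.contMDiff.contMDiffOn fun q hq => hq.2
  exact fun q hq => hG.contMDiffAt.comp_contMDiffWithinAt q ((h1 q hq).prodMk (h2 q hq))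

theorem isOpen_target_chart (g₀ : G) : IsOpen (extChartAt (𝓡 m) g₀).target :=
  isOpen_extChartAt_target g₀

/-- The pullbacks of a smooth form under the translates of a map depend smoothly on the group
element. -/
theorem contDiffOn_pull_smul
    (hG : ContMDiff ((𝓡 m).prod J) J ∞ fun q : G × N => q.1 • q.2) (hs : UniqueDiffOn ℝ s) (hf : ContMDiffOn 𝓘(ℝ, W) J ∞ f s)
    (hα : ∀ x, SmoothAt α x) (g₀ : G) :
    ContDiffOn ℝ ∞ (Function.uncurry fun (t : EuclideanSpace ℝ (Fin m)) (y : W) =>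
      pull s (fun y => (extChartAt (𝓡 m) g₀).symm t • f y) α y)
      ((extChartAt (𝓡 m) g₀).target ×ˢ s) := by
  set u := (extChartAt (𝓡 m) g₀).target
  set h : EuclideanSpace ℝ (Fin m) × W → N :=
    fun q => (extChartAt (𝓡 m) g₀).symm q.1 • f q.2 with hh
  have hu : UniqueDiffOn ℝ (u ×ˢ s) := (isOpen_target_chart g₀).uniqueDiffOn.prod hs
  have hhs : ContMDiffOn 𝓘(ℝ, EuclideanSpace ℝ (Fin m) × W) J ∞ h (u ×ˢ s) :=
    contMDiffOn_smul_comp hG hf g₀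
  -- Pull back once under the map of both variables, which is smooth on the product, and then
  -- restrict to vectors along `W`.
  have h1 : ContDiffOn ℝ ∞ (pull (u ×ˢ s) h α) (u ×ˢ s) := fun q hq =>
    contDiffWithinAt_pull hu hq (hhs q hq) (hα _)
  have h2 : ContDiffOn ℝ ∞ (fun q => (pull (u ×ˢ s) h α q).compContinuousLinearMap
      (ContinuousLinearMap.inr ℝ (EuclideanSpace ℝ (Fin m)) W)) (u ×ˢ s) := fun q hq =>
    ContDiffWithinAt.compContinuousLinearMap_alternating (h1 q hq) contDiffWithinAt_const
  refine h2.congr ?_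
  rintro ⟨t, y⟩ hq
  have hin : HasFDerivAt (fun y : W => (t, y))
      (ContinuousLinearMap.inr ℝ (EuclideanSpace ℝ (Fin m)) W) y := hasFDerivAt_prodMk_right t y
  have h3 := mfderivWithin_comp (I := 𝓘(ℝ, W)) (s := s) y (f := fun y : W => (t, y)) (g := h)
    (u := u ×ˢ s) ((hhs (t, y) hq).mdifferentiableWithinAt (by simp))
    hin.differentiableAt.mdifferentiableAt.mdifferentiableWithinAt
    (fun y' hy' => ⟨hq.1, hy'⟩) (hs y hq.2).uniqueMDiffWithinAt
  rw [mfderivWithin_eq_fderivWithin, hin.hasFDerivWithinAt.fderivWithin (hs y hq.2)] at h3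
  change (α (h (t, y))).compContinuousLinearMap
    (mfderivWithin 𝓘(ℝ, W) J (h ∘ fun y => (t, y)) s y) = _
  rw [h3]
  rfl

/-- Continuity is local in `g`, and in a chart of the group the pullback is jointly smooth. This
supplies the hypotheses for differentiation under the integral over `G`. -/
theorem continuousOn_iteratedFDerivWithin_pull_smul
    (hG : ContMDiff ((𝓡 m).prod J) J ∞ fun q : G × N => q.1 • q.2) (hs : UniqueDiffOn ℝ s)
    (hf : ContMDiffOn 𝓘(ℝ, W) J ∞ f s) (hα : ∀ x, SmoothAt α x) (j : ℕ) :
    ContinuousOn (Function.uncurry fun (g : G) (y : W) =>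
      iteratedFDerivWithin ℝ j (pull s (fun y => g • f y) α) s y) (univ ×ˢ s) := by
  rintro ⟨g₀, y₀⟩ hy₀
  have h1 := (contDiffOn_iteratedFDerivWithin_uncurry hs
    (contDiffOn_pull_smul hG hs hf hα g₀) j).continuousOn
  have h2 : ContinuousOn (fun q : G × W => (extChartAt (𝓡 m) g₀ q.1, q.2))
      ((extChartAt (𝓡 m) g₀).source ×ˢ s) :=
    ((continuousOn_extChartAt g₀).comp continuousOn_fst fun q hq => hq.1).prodMk continuousOn_snd
  have h3 := h1.comp h2 fun q hq => ⟨(extChartAt (𝓡 m) g₀).map_source hq.1, hq.2⟩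
  have h4 : ContinuousOn (Function.uncurry fun (g : G) (y : W) =>
      iteratedFDerivWithin ℝ j (pull s (fun y => g • f y) α) s y)
      ((extChartAt (𝓡 m) g₀).source ×ˢ s) := by
    refine h3.congr ?_
    rintro ⟨g, y⟩ hq
    simp only [Function.comp, Function.uncurry, (extChartAt (𝓡 m) g₀).left_inv hq.1]
  have h5 := h4 (g₀, y₀) ⟨mem_extChartAt_source g₀, hy₀.2⟩
  refine h5.mono_of_mem_nhdsWithin ?_
  rw [nhdsWithin_prod_eq, nhdsWithin_univ]
  exact prod_mem_prod (extChartAt_source_mem_nhds g₀) self_mem_nhdsWithin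

theorem continuousOn_pull_smul
    (hG : ContMDiff ((𝓡 m).prod J) J ∞ fun q : G × N => q.1 • q.2) (hs : UniqueDiffOn ℝ s)
    (hf : ContMDiffOn 𝓘(ℝ, W) J ∞ f s) (hα : ∀ x, SmoothAt α x) :
    ContinuousOn (Function.uncurry fun (g : G) (y : W) => pull s (fun y => g • f y) α y)
      (univ ×ˢ s) := by
  have h := continuousOn_iteratedFDerivWithin_pull_smul hG hs hf hα 0
  have h1 := (continuousMultilinearCurryFin0 ℝ W (W [⋀^Fin k]→L[ℝ] ℝ)).continuous.comp_continuousOn h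
  exact h1

theorem contDiffOn_pull (hs : UniqueDiffOn ℝ s) (hf : ContMDiffOn 𝓘(ℝ, W) J ∞ f s)
    (hα : ∀ x, SmoothAt α x) : ContDiffOn ℝ ∞ (pull s f α) s := fun z hz =>
  contDiffWithinAt_pull hs hz (hf z hz) (hα _)

theorem contMDiffOn_const_smul_comp
    (hG : ContMDiff ((𝓡 m).prod J) J ∞ fun q : G × N => q.1 • q.2) (hf : ContMDiffOn 𝓘(ℝ, W) J ∞ f s) (g : G) :
    ContMDiffOn 𝓘(ℝ, W) J ∞ (fun y => g • f y) s :=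
  (contMDiff_const_smul hG g).comp_contMDiffOn hf

/-- Expresses the translate at `x` as a fixed linear image of a pullback in the chart at `x`, so
that continuity in `g` can be read off. -/
theorem translate_eq_ofFlat
    (hG : ContMDiff ((𝓡 m).prod J) J ∞ fun q : G × N => q.1 • q.2) (g : G) (x : N) :
    translate g α x = ofFlat (extChartAt J x)
      (pull (range J) (fun y => g • (extChartAt J x).symm y) α) x := by
  have h1 : MDifferentiableWithinAt 𝓘(ℝ, V) J (extChartAt J x).symm (range J) (extChartAt J x x) :=
    (contMDiffWithinAt_symm_self x).mdifferentiableWithinAt (by simp)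
  have h2 := ofFlat_pull_eq_self (α := translate g α) (s := range J)
    (mdifferentiableAt_extChartAt (mem_chart_source H x)) h1
    (Eventually.of_forall fun y => extChartAt_mem_range x y)
    (by filter_upwards [extChartAt_source_mem_nhds (I := J) x] with y hy
        exact (extChartAt J x).left_inv hy)
  rw [← h2]
  unfold ofFlat
  rw [pull_translate hG g (J.uniqueDiffOn _ (extChartAt_mem_range x x)) h1]

theorem target_eq_inter (x : N) :
    (extChartAt J x).target = range J ∩ J.symm ⁻¹' (chartAt H x).target := by
  rw [extChartAt_target, inter_comm]

theorem isOpen_preimage_target (x : N) : IsOpen (J.symm ⁻¹' (chartAt H x).target) :=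
  (chartAt H x).open_target.preimage J.continuous_symm

theorem uniqueDiffOn_target (x : N) : UniqueDiffOn ℝ (extChartAt J x).target :=
  uniqueDiffOn_extChartAt_target x

theorem pull_target {x : N} {f : V → N} {y : V} (hy : y ∈ (extChartAt J x).target) :
    pull (extChartAt J x).target f α y = pull (range J) f α y := by
  rw [target_eq_inter] at hy ⊢
  exact pull_inter ((isOpen_preimage_target x).mem_nhds hy.2)

theorem continuous_translate
    (hG : ContMDiff ((𝓡 m).prod J) J ∞ fun q : G × N => q.1 • q.2) (hα : ∀ x, SmoothAt α x) (x : N) :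
    Continuous fun g : G => translateVal g α x := by
  have h1 := continuousOn_pull_smul hG (uniqueDiffOn_target (J := J) x)
    (contMDiffOn_extChartAt_symm x) hα
  have h2 : Continuous fun g : G => pull (extChartAt J x).target
      (fun y => g • (extChartAt J x).symm y) α (extChartAt J x x) :=
    h1.comp_continuous (by fun_prop : Continuous fun g : G => (g, extChartAt J x x))
      fun g => ⟨mem_univ _, mem_extChartAt_target x⟩
  have h3 := (ContinuousAlternatingMap.compContinuousLinearMapCLM (𝕜 := ℝ) (F := ℝ)
    (ι := Fin k) (mfderiv J 𝓘(ℝ, V) (extChartAt J x) x : V →L[ℝ] V)).continuous.comp h2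
  refine h3.congr fun g => ?_
  unfold translateVal
  rw [translate_eq_ofFlat hG]
  simp only [Function.comp, pull_target (mem_extChartAt_target x)]
  rfl

variable [T2Space G] [CompactSpace G] [MeasurableSpace G] [BorelSpace G]
  {μ : Measure G} [IsFiniteMeasure μ]

variable (μ) in
/-- The average of the translates of a form. -/
def average (α : Form J (N := N) k) : Form J (N := N) k := fun v =>
  (∫ g, translateVal g α v ∂μ : V [⋀^Fin k]→L[ℝ] ℝ)

theorem integrable_translate
    (hG : ContMDiff ((𝓡 m).prod J) J ∞ fun q : G × N => q.1 • q.2) (hα : ∀ x, SmoothAt α x) (x : N) :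
    Integrable (fun g : G => translateVal g α x) μ :=
  integrable_of_continuousOn_compact isCompact_univ (Eventually.of_forall fun _ => mem_univ _)
    (continuous_translate hG hα x).continuousOn

theorem average_comp
    (hG : ContMDiff ((𝓡 m).prod J) J ∞ fun q : G × N => q.1 • q.2) (hα : ∀ x, SmoothAt α x) (x : N) (D : W →L[ℝ] V) :
    ContinuousAlternatingMap.compContinuousLinearMap (average μ α x : V [⋀^Fin k]→L[ℝ] ℝ) D =
      ∫ g, (translateVal g α x).compContinuousLinearMap D ∂μ :=
  ((ContinuousAlternatingMap.compContinuousLinearMapCLM (𝕜 := ℝ) (F := ℝ)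
    (ι := Fin k) D).integral_comp_comm (integrable_translate hG hα x)).symm

theorem average_apply
    (hG : ContMDiff ((𝓡 m).prod J) J ∞ fun q : G × N => q.1 • q.2) (hα : ∀ x, SmoothAt α x) (x : N) (w : Fin k → V) :
    (average μ α x : V [⋀^Fin k]→L[ℝ] ℝ) w = ∫ g, (translateVal g α x) w ∂μ :=
  ((ContinuousAlternatingMap.apply ℝ V ℝ w).integral_comp_comm
    (integrable_translate hG hα x)).symm

/-- Pullback is continuous and linear in the form, so in a fixed chart the average is an integral of
forms on a vector space, to which the parametric results apply. -/
theorem inChart_average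
    (hG : ContMDiff ((𝓡 m).prod J) J ∞ fun q : G × N => q.1 • q.2) (hα : ∀ x, SmoothAt α x) {x : N} {y : V}
    (hy : y ∈ (extChartAt J x).target) :
    (average μ α).inChart x y = ∫ g, pull (extChartAt J x).target
      (fun y => g • (extChartAt J x).symm y) α y ∂μ := by
  refine (average_comp hG hα _ _).trans (integral_congr_ae
    (Eventually.of_forall fun g => ?_))
  simp only [pull_target hy]
  exact pull_translate hG g (J.uniqueDiffOn _ (extChartAt_target_subset_range x hy))
    (mdifferentiableWithinAt_extChartAt_symm hy)

theorem smoothAt_average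
    (hG : ContMDiff ((𝓡 m).prod J) J ∞ fun q : G × N => q.1 • q.2) (hα : ∀ x, SmoothAt α x) (x : N) : SmoothAt (average μ α) x := by
  have hu := uniqueDiffOn_target (J := J) x
  have hf := contMDiffOn_extChartAt_symm (I := J) (n := ∞) x
  have h1 : ContDiffOn ℝ ∞ (fun y => ∫ g, pull (extChartAt J x).target
      (fun y => g • (extChartAt J x).symm y) α y ∂μ) (extChartAt J x).target := by
    have h2 := fun g : G => contDiffOn_pull hu (contMDiffOn_const_smul_comp hG hf g) hα
    have h3 := continuousOn_iteratedFDerivWithin_pull_smul hG hu hf hα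
    have h4 := target_eq_inter (J := J) x
    generalize hF : (fun g : G => pull (extChartAt J x).target
      (fun y => g • (extChartAt J x).symm y) α) = F
    have hF' : ∀ g, pull (extChartAt J x).target
      (fun y => g • (extChartAt J x).symm y) α = F g := fun g => congrFun hF g
    simp only [hF'] at h2 h3 ⊢
    rw [h4] at h2 h3 hu ⊢
    exact contDiffOn_integral_of_compact isCompact_univ (Eventually.of_forall fun _ => mem_univ _)
      J.convex_range (isOpen_preimage_target x) hu (fun g _ => h2 g) h3
  refine ((h1.congr fun y hy => inChart_average hG hα hy) _
    (mem_extChartAt_target x)).mono_of_mem_nhdsWithin (extChartAt_target_mem_nhdsWithin x)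

set_option synthInstance.maxHeartbeats 200000 in
-- Each translate is closed by naturality of `d`, and `d` passes under the integral over the compact
-- group.
theorem d_average
    (hG : ContMDiff ((𝓡 m).prod J) J ∞ fun q : G × N => q.1 • q.2) (hα : ∀ x, SmoothAt α x) (hd : α.d = 0) : (average μ α).d = 0 := by
  funext x
  refine d_eq_zero_of_extDerivWithin ?_
  set T := (extChartAt J x).target with hT
  set z := extChartAt J x x with hz
  have hzT : z ∈ T := mem_extChartAt_target x
  have hu : UniqueDiffOn ℝ T := uniqueDiffOn_target (J := J) x
  have hf := contMDiffOn_extChartAt_symm (I := J) (n := ∞) x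
  have h2 := fun g : G => contDiffOn_pull hu (contMDiffOn_const_smul_comp hG hf g) hα
  have h3 := continuousOn_pull_smul hG hu hf hα
  have h3' := continuousOn_iteratedFDerivWithin_pull_smul hG hu hf hα 1
  have h4 : T = range J ∩ _ := target_eq_inter (J := J) x
  have h5 : ∀ g : G, extDerivWithin (pull T (fun y => g • (extChartAt J x).symm y) α) T z = 0 := by
    intro g
    have hreg : IsRegularDomain T := ⟨hu, fun y hy => by
      have hO := isOpen_preimage_target (J := J) x
      rw [h4] at hy ⊢
      rw [interior_inter, hO.interior_eq, inter_comm]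
      exact hO.inter_closure ⟨hy.2, J.range_subset_closure_interior hy.1⟩⟩
    rw [extDerivWithin_pull hreg hzT (contMDiffOn_const_smul_comp hG hf g z hzT) (hα _), hd]
    exact pull_zero rfl
  have h6 : extDerivWithin ((average μ α).inChart x) (range J) z =
      extDerivWithin (fun y => ∫ g, pull T (fun y => g • (extChartAt J x).symm y) α y ∂μ) T z := by
    have h7 : extDerivWithin ((average μ α).inChart x) (range J) z =
        extDerivWithin ((average μ α).inChart x) T z := by
      unfold extDerivWithin
      rw [h4, fderivWithin_inter ((isOpen_preimage_target x).mem_nhds (by rw [h4] at hzT; exact hzT.2))]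
    rw [h7]
    exact extDerivWithin_congr (fun y hy => inChart_average hG hα hy) (inChart_average hG hα hzT)
  rw [h6]
  generalize hF : (fun g : G => pull T (fun y => g • (extChartAt J x).symm y) α) = F
  have hF' : ∀ g, pull T (fun y => g • (extChartAt J x).symm y) α = F g := fun g => congrFun hF g
  simp only [hF'] at h2 h3 h3' h5 ⊢
  clear_value T
  subst h4
  unfold extDerivWithin at h5 ⊢
  exact apply_fderivWithin_integral_eq_zero isCompact_univ
    (Eventually.of_forall fun _ => mem_univ _) J.convex_range (isOpen_preimage_target x) hu
    (fun g _ => h2 g) h3 h3' hzT (ContinuousAlternatingMap.alternatizeUncurryFinCLM ℝ V ℝ) h5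

end Average

/-! ### Averages of Thom forms -/

section Invariance

variable {m : ℕ} {G : Type*} [TopologicalSpace G] [Group G]
  [ChartedSpace (EuclideanSpace ℝ (Fin m)) G] [IsManifold (𝓡 m) ∞ G]
  {V : Type*} [NormedAddCommGroup V] [NormedSpace ℝ V]
  {H : Type*} [TopologicalSpace H] {J : ModelWithCorners ℝ V H}
  {N : Type*} [TopologicalSpace N] [ChartedSpace H N] [IsManifold J ∞ N]
  [MulAction G N] {k : ℕ} {α : Form J (N := N) k}
  [T2Space G] [CompactSpace G] [MeasurableSpace G] [BorelSpace G]
  {μ : Measure G} [IsFiniteMeasure μ]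

/-- Functoriality `h^* g^* = (g h)^*`. The element `h` enters on the right, and this is why `μ` has
to be right invariant. -/
theorem translateVal_smul
    (hG : ContMDiff ((𝓡 m).prod J) J ∞ fun q : G × N => q.1 • q.2) (g h : G) (v : N) :
    (translateVal g α (h • v)).compContinuousLinearMap
      (mfderiv J J (fun w : N => h • w) v : V →L[ℝ] V) = translateVal (g * h) α v := by
  have h1 : ∀ f : N → N, f = (fun w => (g * h) • w) → (α (f v)).compContinuousLinearMap
      (mfderiv J J f v) = translateVal (g * h) α v := by
    intro f hf
    subst hf
    rfl
  have h2 := mfderiv_comp (I := J) (I' := J) (I'' := J) (g := fun w : N => g • w)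
    (f := fun w : N => h • w) v (mdifferentiableAt_const_smul hG g (h • v))
    (mdifferentiableAt_const_smul hG h v)
  have h3 := h1 ((fun w : N => g • w) ∘ fun w : N => h • w) (by ext w; exact (mul_smul g h w).symm)
  rw [← h3, h2]
  rfl

theorem average_smul [ContinuousMul G] [μ.IsMulRightInvariant]
    (hG : ContMDiff ((𝓡 m).prod J) J ∞ fun q : G × N => q.1 • q.2)
    (hα : ∀ x, SmoothAt α x) (h : G) (v : N) :
    (average μ α (h • v)).compContinuousLinearMap (mfderiv J J (fun w : N => h • w) v) =
      average μ α v := by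
  obtain ⟨D, hD⟩ : ∃ D : V →L[ℝ] V, D = mfderiv J J (fun w : N => h • w) v := ⟨_, rfl⟩
  have h1 : ∀ g : G, (translateVal g α (h • v)).compContinuousLinearMap D =
      translateVal (g * h) α v := fun g => by
    rw [hD]
    exact translateVal_smul hG g h v
  have h2 := average_comp (μ := μ) hG hα (h • v) D
  have h3 := integral_mul_right_eq_self (μ := μ) (fun g => translateVal g α v) h
  rw [← integral_congr_ae (Eventually.of_forall h1)] at h3
  rw [hD] at h2 h3
  exact h2.trans h3

theorem exists_ne_zero_of_average_ne_zero {v : N} (h : average μ α v ≠ 0) :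
    ∃ g : G, α (g • v) ≠ 0 := by
  by_contra! h0
  refine h ?_
  have h1 : ∀ g : G, translateVal g α v = 0 := fun g => by
    unfold translateVal translate
    rw [h0 g]
    exact map_zero (ContinuousAlternatingMap.compContinuousLinearMapCLM (𝕜 := ℝ) (F := ℝ)
      (ι := Fin k) (mfderiv J J (fun w : N => g • w) v : V →L[ℝ] V))
  unfold average
  simp only [h1, integral_zero]
  rfl

end Invariance

/-! ### The Thom form conditions and the restrictions survive averaging -/

section BundleAverage

variable {n r : ℕ} {M : Type*} [TopologicalSpace M] [ChartedSpace (EuclideanQuadrant n) M]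
  {E : M → Type*} [TopologicalSpace (TotalSpace (EuclideanSpace ℝ (Fin r)) E)]
  [∀ p, TopologicalSpace (E p)] [FiberBundle (EuclideanSpace ℝ (Fin r)) E]
  [∀ p, AddCommGroup (E p)] [∀ p, Module ℝ (E p)]
  [VectorBundle ℝ (Euc r) E] [IsManifold (Quad n) ∞ M] [ContMDiffVectorBundle ∞ (Euc r) E (Quad n)]
  {m : ℕ} {G : Type*} [TopologicalSpace G] [Group G]
  [ChartedSpace (EuclideanSpace ℝ (Fin m)) G] [IsManifold (𝓡 m) ∞ G]
  [MulAction G M] [MulAction G (TotalSpace (EuclideanSpace ℝ (Fin r)) E)]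
  {o : ∀ p, Orientation ℝ (E p) (Fin r)} {p : M} {k : ℕ}

theorem exists_equiv_fiberMap {e : Trivialization (Euc r) (π (Euc r) E)} [MemTrivializationAtlas e]
    (hpe : p ∈ e.baseSet) (b : Module.Basis (Fin r) ℝ (E p)) :
    ∃ B : Euc r ≃ₗ[ℝ] Euc r, ∀ x, (e (fiberMap p b x)).2 = B x := by
  refine ⟨(WithLp.linearEquiv 2 ℝ (Fin r → ℝ)).trans
    (b.equivFun.symm.trans (e.linearEquivAt ℝ p hpe)), fun x => ?_⟩
  have h1 : (e (fiberMap p b x)).2 = e.linearEquivAt ℝ p hpe (∑ j, x j • b j) := rfl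
  rw [h1, LinearEquiv.trans_apply, LinearEquiv.trans_apply, Module.Basis.equivFun_symm_apply]
  rfl

theorem contMDiff_fiberMap (b : Module.Basis (Fin r) ℝ (E p)) :
    ContMDiff 𝓘(ℝ, Euc r) (totalModel n r) ∞ (fiberMap p b) := by
  intro x
  rw [Bundle.contMDiffAt_totalSpace]
  refine ⟨contMDiffAt_const, ?_⟩
  obtain ⟨B, hB⟩ := exists_equiv_fiberMap (FiberBundle.mem_baseSet_trivializationAt' p) b
  have h1 : ContMDiffAt 𝓘(ℝ, Euc r) 𝓘(ℝ, Euc r) ∞ B x :=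
    B.toContinuousLinearEquiv.contDiff.contMDiff.contMDiffAt
  exact h1.congr_of_eventuallyEq (Eventually.of_forall hB)

theorem proj_smul (hGE : ActsByOrientedBundleMaps G o) (g : G) (v : TotalSpace (Euc r) E) :
    (g • v).proj = g • v.proj := by
  obtain ⟨ρ, hρ, -⟩ := hGE g v.proj
  exact congrArg TotalSpace.proj (hρ v.2)

/-- The projection is equivariant, so the claim reduces to the action on `M`, which preserves `S`.
-/
theorem actionDeriv_mem_tangentOver (hGE : ActsByOrientedBundleMaps G o)
    {S : Set M} {g : G} (hS : ∀ q ∈ S, g • q ∈ S)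
    (hg : ContMDiff (Quad n) (Quad n) ∞ fun q : M => g • q)
    (hgE : ContMDiff (totalModel n r) (totalModel n r) ∞ fun v : TotalSpace (Euc r) E => g • v)
    {v : TotalSpace (Euc r) E} {w : TangentSpace (totalModel n r) v}
    (hw : w ∈ tangentOver (n := n) S v) : actionDeriv G g v w ∈ tangentOver (n := n) S (g • v) := by
  have hpr : ∀ v : TotalSpace (Euc r) E, MDifferentiableAt (totalModel n r) (Quad n)
      (TotalSpace.proj : TotalSpace (Euc r) E → M) v := fun v =>
    (contMDiffAt_proj (n := ∞) E).mdifferentiableAt (by simp)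
  have hd : MDifferentiableAt (Quad n) (Quad n) (fun q : M => g • q) v.proj :=
    hg.contMDiffAt.mdifferentiableAt (by simp)
  have h1 := mfderiv_comp v (hpr (g • v)) (hgE.contMDiffAt.mdifferentiableAt (by simp))
  have h2 := mfderiv_comp v hd (hpr v)
  have h3 : ∀ f : TotalSpace (Euc r) E → M, f = TotalSpace.proj ∘ (fun v => g • v) →
      mfderiv (totalModel n r) (Quad n) f v w ∈ tangentSub (Quad n) S (f v) →
      actionDeriv G g v w ∈ tangentOver (n := n) S (g • v) := by
    intro f hf hfw
    subst hf
    rw [h1] at hfw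
    exact hfw
  refine h3 ((fun q : M => g • q) ∘ TotalSpace.proj)
    (by ext v; exact (proj_smul hGE g v).symm) ?_
  rw [h2]
  exact mfderiv_mem_tangentSub hd hS hw

/-- The action carries the fibre at `p` with the basis `b` to the fibre at `g • p` with the image
basis, of corresponding orientation. Thus the integral of `g^*σ` is an integral of `σ`. -/
theorem fiberIntegral_translate (hGE : ActsByOrientedBundleMaps G o)
    (hG : ContMDiff ((𝓡 m).prod (totalModel n r)) (totalModel n r) ∞
      fun q : G × TotalSpace (Euc r) E => q.1 • q.2) {σ : BundleForm n r E r}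
    (hσ : ∀ q, HasThomIntegral o σ q) (g : G) : HasThomIntegral o (translate g σ) p := by
  obtain ⟨ρ, hρ, hρo⟩ := hGE g p
  have h1 : ∀ b : Module.Basis (Fin r) ℝ (E p),
      fiberIntegral (translate g σ) p b = fiberIntegral σ (g • p) (b.map ρ) := by
    intro b
    have h2 : ∀ f : Euc r → TotalSpace (Euc r) E, f = fiberMap (g • p) (b.map ρ) →
        ∫ x, σ (f x) (fun j => mfderiv 𝓘(ℝ, Euc r) (totalModel n r) f x
          (EuclideanSpace.single j (1 : ℝ))) = fiberIntegral σ (g • p) (b.map ρ) := by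
      intro f hf
      subst hf
      rfl
    rw [← h2 ((fun v : TotalSpace (Euc r) E => g • v) ∘ fiberMap p b) (by
      ext1 x
      refine (hρ _).trans ?_
      unfold fiberMap
      simp)]
    refine integral_congr_ae (Eventually.of_forall fun x => ?_)
    have h3 := mfderiv_comp x (mdifferentiableAt_const_smul hG g (fiberMap p b x))
      ((contMDiff_fiberMap (n := n) b).contMDiffAt.mdifferentiableAt (by simp))
    simp only [h3]
    rfl
  constructor
  · intro b hb
    rw [h1]
    refine (hσ (g • p)).1 _ ?_
    rw [Module.Basis.orientation_map, hb, hρo]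
  · intro b hb
    rw [h1]
    refine (hσ (g • p)).2 _ ?_
    rw [Module.Basis.orientation_map, hb, Orientation.map_neg, hρo]

variable [T2Space M] [LocallyCompactSpace M] [CompactSpace G]

/-- Over a compact `N` the saturation of `Z` lies in the image of `G` times the part of `closure Z`
over the compact set `G • N`, under `(g, v) ↦ g⁻¹ • v`. -/
theorem locallyProper_smul [ContinuousSMul G M] [ContinuousSMul G (TotalSpace (Euc r) E)]
    [ContinuousInv G] (hGE : ActsByOrientedBundleMaps G o)
    {Z : Set (TotalSpace (Euc r) E)} (h : ∀ p, LocallyProper Z p) (p : M) :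
    LocallyProper {v : TotalSpace (Euc r) E | ∃ g : G, g • v ∈ Z} p := by
  obtain ⟨N, hNc, hN⟩ := exists_compact_mem_nhds p
  have hL : IsCompact ((fun q : G × M => q.1 • q.2) '' (univ ×ˢ N)) :=
    (isCompact_univ.prod hNc).image continuous_smul
  have hA := isCompact_closure_inter_of_locallyProper h hL
  refine ⟨_, (isCompact_univ.prod hA).image (f := fun q : G × TotalSpace (Euc r) E => q.1⁻¹ • q.2)
    (continuous_fst.inv.smul continuous_snd), ?_⟩
  filter_upwards [hN] with q hq v hv hvZ
  obtain ⟨g, hg⟩ := hvZ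
  refine ⟨(g, g • v), ⟨mem_univ _, subset_closure hg, ?_⟩, inv_smul_smul g v⟩
  rw [mem_preimage, proj_smul hGE, hv]
  exact ⟨(g, q), ⟨mem_univ _, hq⟩, rfl⟩

variable [T2Space G] [MeasurableSpace G] [BorelSpace G] {μ : Measure G}

/-- Invariance of `τ` gives each translate of `σ` the restriction `τ`, and the average of a constant
over a probability measure is that constant. -/
theorem restrictTo_average [IsProbabilityMeasure μ] (hGE : ActsByOrientedBundleMaps G o)
    (hGM : ContMDiff ((𝓡 m).prod (Quad n)) (Quad n) ∞ fun q : G × M => q.1 • q.2)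
    (hG : ContMDiff ((𝓡 m).prod (totalModel n r)) (totalModel n r) ∞
      fun q : G × TotalSpace (Euc r) E => q.1 • q.2) {σ : BundleForm n r E k}
    (hσ : ∀ v, SmoothAt σ v) {S : Set M} (hS : ∀ g : G, ∀ q ∈ S, g • q ∈ S)
    {τ : FormOver n r E S k} (hτ : τ.Invariant G) (hστ : restrictTo S σ = τ) :
    restrictTo S (average μ σ) = τ := by
  funext v hv
  ext w
  have hgv : ∀ g : G, (g • v).proj ∈ S := fun g => by
    rw [proj_smul hGE]
    exact hS g _ hv
  refine (average_apply hG hσ v fun j => (w j).1).trans ?_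
  have h1 : ∀ g : G, (translateVal g σ v) (fun j => (w j).1) = τ v hv w := by
    intro g
    have h2 := hτ g v hv (hgv g) w (fun j => ⟨actionDeriv G g v (w j),
      actionDeriv_mem_tangentOver hGE (hS g) (contMDiff_const_smul hGM g)
        (contMDiff_const_smul hG g) (w j).2⟩) (fun j => rfl)
    rw [← h2, ← hστ]
    rfl
  simp [h1]

/-- Exchange the integrals over the fibre and over `G`; every translate has the correct fibre
integral. -/
theorem hasThomIntegral_average [IsProbabilityMeasure μ] (hGE : ActsByOrientedBundleMaps G o)
    (hG : ContMDiff ((𝓡 m).prod (totalModel n r)) (totalModel n r) ∞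
      fun q : G × TotalSpace (Euc r) E => q.1 • q.2) {σ : BundleForm n r E r}
    (hσ : ∀ v, SmoothAt σ v)
    (hproper : LocallyProper {v : TotalSpace (Euc r) E | ∃ g : G, g • v ∈ {v | σ v ≠ 0}} p)
    (hint : ∀ q, HasThomIntegral o σ q) : HasThomIntegral o (average μ σ) p := by
  have h1 : ∀ b : Module.Basis (Fin r) ℝ (E p), fiberIntegral (average μ σ) p b =
      ∫ g, fiberIntegral (translate g σ) p b ∂μ := by
    intro b
    set Φ : Euc r → G → ℝ := fun x g => translateVal g σ (fiberMap p b x) (fiberVec p b x) with hΦ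
    have hfib := contMDiff_fiberMap (n := n) b
    have h2 : ∀ x g, Φ x g = pull univ (fun y => g • fiberMap p b y) σ x
        fun j => EuclideanSpace.single j (1 : ℝ) := by
      intro x g
      rw [← pull_translate hG g uniqueDiffWithinAt_univ
        (hfib.contMDiffAt.mdifferentiableAt (by simp)).mdifferentiableWithinAt]
      unfold pull
      rw [mfderivWithin_univ]
      rfl
    have h3 : Continuous (Function.uncurry Φ) := by
      have h4 := continuousOn_pull_smul hG uniqueDiffOn_univ hfib.contMDiffOn hσ
      rw [univ_prod_univ, continuousOn_univ] at h4
      have h5 := ((ContinuousAlternatingMap.apply ℝ (Euc r) ℝ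
        fun j : Fin r => EuclideanSpace.single j (1 : ℝ)).continuous.comp h4).comp continuous_swap
      refine h5.congr ?_
      rintro ⟨x, g⟩
      exact (h2 x g).symm
    have hpe := FiberBundle.mem_baseSet_trivializationAt (F := Euc r) (E := E) p
    obtain ⟨R, hR⟩ := (exists_bound_iff_locallyProper hpe).2 hproper
    obtain ⟨B, hB⟩ := exists_equiv_fiberMap hpe b
    -- The supports of all translates on this fibre lie in one ball, which justifies the exchange
    -- for a continuous integrand.
    have h6 : HasCompactSupport (Function.uncurry Φ) := by
      refine HasCompactSupport.intro (K := (B.toContinuousLinearEquiv ⁻¹' Metric.closedBall 0 R) ×ˢ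
        (univ : Set G)) ((B.toContinuousLinearEquiv.toHomeomorph.isCompact_preimage.2
          (isCompact_closedBall 0 R)).prod isCompact_univ) ?_
      rintro ⟨x, g⟩ hx
      by_contra hne
      refine hx ⟨?_, mem_univ _⟩
      have h7 := hR.self_of_nhds (fiberMap p b x) rfl ⟨g, fun h0 => hne ?_⟩
      · rw [hB] at h7
        simpa using h7
      · change ((σ (g • fiberMap p b x)).compContinuousLinearMap _) _ = 0
        rw [h0]
        rfl
    calc fiberIntegral (average μ σ) p b = ∫ x, ∫ g, Φ x g ∂μ :=
          integral_congr_ae (Eventually.of_forall fun x => average_apply hG hσ _ _)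
      _ = ∫ g, (∫ x, Φ x g) ∂μ := integral_integral_swap_of_hasCompactSupport h3 h6
      _ = _ := rfl
  have h2 := fun g : G => fiberIntegral_translate (p := p) hGE hG hint g
  constructor
  · intro b hb
    rw [h1]
    simp [(h2 _).1 b hb]
  · intro b hb
    rw [h1]
    simp [(h2 _).2 b hb]

end BundleAverage

/-- A compact topological group carries a right invariant probability measure. -/
theorem exists_isMulRightInvariant {G : Type*} [TopologicalSpace G] [Group G] [IsTopologicalGroup G]
    [CompactSpace G] [MeasurableSpace G] [BorelSpace G] :
    ∃ μ : Measure G, IsProbabilityMeasure μ ∧ μ.IsMulRightInvariant := by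
  -- Haar measure normalized on the whole group has mass 1; inversion turns left invariance into
  -- right invariance.
  refine ⟨(Measure.haarMeasure (⊤ : TopologicalSpace.PositiveCompacts G)).inv, ⟨?_⟩, inferInstance⟩
  rw [Measure.inv_apply, inv_univ]
  exact Measure.haarMeasure_self (K₀ := (⊤ : TopologicalSpace.PositiveCompacts G))

end ThomExt

end

theorem mainTheorem8
    -- a manifold with corners
    {n : ℕ} {M : Type*} [TopologicalSpace M] [T2Space M] [ParacompactSpace M]
    [ChartedSpace (EuclideanQuadrant n) M]
    [IsManifold (modelWithCornersEuclideanQuadrant n) ∞ M]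
    -- a compact Lie group that acts on it smoothly and almost freely
    {m : ℕ} {G : Type*} [TopologicalSpace G] [Group G]
    [ChartedSpace (EuclideanSpace ℝ (Fin m)) G] [LieGroup (𝓡 m) ∞ G] [CompactSpace G]
    [MulAction G M] [ContMDiffSMul (𝓡 m) (modelWithCornersEuclideanQuadrant n) ∞ G M]
    (hfree : ∀ p : M, Finite (MulAction.stabilizer G p))
    -- a smooth vector bundle of rank `r`
    {r : ℕ} {E : M → Type*} [TopologicalSpace (TotalSpace (EuclideanSpace ℝ (Fin r)) E)]
    [∀ p, TopologicalSpace (E p)] [∀ p, AddCommGroup (E p)] [∀ p, Module ℝ (E p)]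
    [FiberBundle (EuclideanSpace ℝ (Fin r)) E] [VectorBundle ℝ (EuclideanSpace ℝ (Fin r)) E]
    [ContMDiffVectorBundle ∞ (EuclideanSpace ℝ (Fin r)) E (modelWithCornersEuclideanQuadrant n)]
    -- an orientation of it, and a smooth lift of the action by oriented bundle maps
    (o : ∀ p, Orientation ℝ (E p) (Fin r)) (ho : ThomExt.IsBundleOrientation o)
    [MulAction G (TotalSpace (EuclideanSpace ℝ (Fin r)) E)]
    [ContMDiffSMul (𝓡 m) (ThomExt.totalModel n r) ∞ G
      (TotalSpace (EuclideanSpace ℝ (Fin r)) E)]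
    (hGE : ThomExt.ActsByOrientedBundleMaps G o)
    -- finitely many closed invariant submanifolds with clean intersections
    {ι : Type*} [Finite ι] (S : ι → Set M) (hclosed : ∀ i, IsClosed (S i))
    (hinv : ∀ (i : ι) (g : G), ∀ p ∈ S i, g • p ∈ S i)
    (hclean : ThomExt.CleanFamily (n := n) S)
    -- invariant Thom forms over them that agree over the pairwise intersections
    (τ : ∀ i, ThomExt.FormOver n r E (S i) r)
    (hτ : ∀ i, ThomExt.IsThomFormOver (S i) o (τ i))
    (hτinv : ∀ i, (τ i).Invariant G)
    (hagree : ∀ i j, (τ i).restrict (inter_subset_left : S i ∩ S j ⊆ S i) =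
      (τ j).restrict (inter_subset_right : S i ∩ S j ⊆ S j)) :
    ∃ τM : ThomExt.BundleForm n r E r, ThomExt.IsThomForm o τM ∧
      ThomExt.InvariantForm G τM ∧ ∀ i, ThomExt.restrictTo (S i) τM = τ i := by
  open ThomExt in
  have : LocallyCompactSpace M := Manifold.locallyCompact_of_finiteDimensional (Quad n)
  have : IsTopologicalGroup G := topologicalGroup_of_lieGroup (𝓡 m) ∞
  -- Charts make points closed, and a topological group with this property is Hausdorff.
  have : T1Space G := (𝓡 m).t1Space G
  have : ContinuousSMul G M := ContMDiffSMul.continuousSMul (I := 𝓡 m) (I' := Quad n) ∞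
  have : ContinuousSMul G (TotalSpace (EuclideanSpace ℝ (Fin r)) E) :=
    ContMDiffSMul.continuousSMul (I := 𝓡 m) (I' := totalModel n r) ∞
  have hGM := contMDiff_smul (I := 𝓡 m) (I' := Quad n) (n := ∞) (G := G) (M := M)
  have hG := contMDiff_smul (I := 𝓡 m) (I' := totalModel n r) (n := ∞) (G := G)
    (M := TotalSpace (EuclideanSpace ℝ (Fin r)) E)
  obtain ⟨σ, hσ⟩ := exists_goodAt ho hclosed hclean hτ hagree
  have hsmooth : ∀ v, SmoothAt σ v := fun v => (hσ v.proj).smooth v rfl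
  have hproper := locallyProper_smul (G := G) hGE fun p => (hσ p).proper
  borelize G
  obtain ⟨μ, hμ, hμr⟩ := exists_isMulRightInvariant (G := G)
  have hint : ∀ p, HasThomIntegral o (average μ σ) p := fun p =>
    hasThomIntegral_average hGE hG hsmooth (hproper p) fun q => (hσ q).integral
  refine ⟨average μ σ, ⟨isSmooth_iff.2 fun v => smoothAt_average hG hsmooth v,
    d_average hG hsmooth (funext fun v => (hσ v.proj).closed v rfl), fun K hK => ?_,
    fun p => (hint p).1, fun p => (hint p).2⟩, fun g v => average_smul hG hsmooth g v, fun i => ?_⟩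
  -- The average vanishes at vectors whose orbit misses the support of `σ`, so its support is
  -- controlled by the saturation under the group.
  · refine isCompact_closure_inter_of_locallyProper (fun p => ?_) hK
    obtain ⟨A, hA, hAZ⟩ := hproper p
    refine ⟨A, hA, ?_⟩
    filter_upwards [hAZ] with q hq v hv hvZ
    exact hq v hv (exists_ne_zero_of_average_ne_zero hvZ)
  · exact restrictTo_average hGE hGM hG hsmooth (hinv i) (hτinv i)
      (funext fun v => funext fun hv => (hσ v.proj).restrict i v hv rfl)
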